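/- All Lie algebras are real. A complex product structure on a Lie algebra $\mathfrak g$ is a pair $\{J,E\}$ of linear endomorphisms of $\mathfrak g$ such that $J^2=-\mathrm{Id}$, $E^2=\mathrm{Id}$, $E\neq\pm\mathrm{Id}$, $JE=-EJ$ and, for all $x,y\in\mathfrak g$, $$J[x,y]=[Jx,y]+[x,Jy]+J[Jx,Jy],\qquad E[x,y]=[Ex,y]+[x,Ey]-E[Ex,Ey].$$ The $\pm1$-eigenspaces $\mathfrak g_\pm$ of $E$ are then Lie subalgebras with $\mathfrak g=\mathfrak g_+\oplus\mathfrak g_-$ as vector spaces, and we write $\mathfrak g=\mathfrak g_+\bowtie\mathfrak g_-$. Let $\mathfrak h_3$ be the 3-dimensional Heisenberg algebra, with basis $e_1,e_2,e_3$ and only non-zero bracket $[e_1,e_2]=e_3$. We say that $\{J,E\}$ is of type $\mathbb R^3\bowtie\mathbb R^3$ if both $\mathfrak g_\pm$ are isomorphic to $\mathbb R^3$, of type $\mathfrak h_3\bowtie\mathbb R^3$ if one of them is isomorphic to $\mathfrak h_3$ and the other to $\mathbb R^3$, and of type $\mathfrak h_3\bowtie\mathfrak h_3$ if both are isomorphic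 to $\mathfrak h_3$. A tuple such as $(0,0,0,0,12,14+23)$ denotes the Lie algebra with a basis $e_1,\dots,e_6$ whose dual basis $e^1,\dots,e^6$ satisfies $de^1=\dots=de^4=0$, $de^5=e^1\wedge e^2$, $de^6=e^1\wedge e^4+e^2\wedge e^3$, where $df(x\wedge y)=-f([x,y])$. Theorem. The fifteen tuples in the table below define pairwise non-isomorphic 6-dimensional nilpotent Lie algebras. A 6-dimensional nilpotent Lie algebra admits a complex product structure if and only if it is isomorphic to one of them. Every complex product structure on a 6-dimensional nilpotent Lie algebra is of one of the three types above, and, for each of the fifteen algebras, the table tells for each type whether the algebra admits a complex product structure of that type. $$\begin{array}{l|c|c|c} & \mathbb R^3\bowtie\mathbb R^3 & \mathfrak h_3\bowtie\mathbb R^3 & \mathfrak h_3\bowtie\mathfrak h_3\\ \hline (0,0,0,0,0,0) & \text{yes} & \text{no} & \text{no}\\ (0,0,0,0,0,12) & \text{yes} & \text{no} & \text{no}\\ (0,0,0,0,0,12+34) & \text{yes} & \text{no} & \text{no}\\ (0,0,0,0,12,14+25) & \text{yes} & \text{no} & \text{no}\\ (0,0,0,0,12,13) & \text{no} & \text{yes}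 & \text{yes}\\ (0,0,0,0,13+42,14+23) & \text{yes} & \text{yes} & \text{yes}\\ (0,0,0,0,12,14+23) & \text{yes} & \text{yes} & \text{yes}\\ (0,0,0,0,12,34) & \text{yes} & \text{yes} & \text{yes}\\ (0,0,0,12,13,14) & \text{no} & \text{yes} & \text{yes}\\ (0,0,0,12,13,23) & \text{no} & \text{yes} & \text{yes}\\ (0,0,0,12,14,24) & \text{no} & \text{yes} & \text{yes}\\ (0,0,0,12,13,24) & \text{no} & \text{yes} & \text{yes}\\ (0,0,0,12,13+14,24) & \text{no} & \text{yes} & \text{yes}\\ (0,0,0,12,13,14+23) & \text{no} & \text{yes} & \text{yes}\\ (0,0,0,12,14,13+42) & \text{no} & \text{yes} & \text{yes} \end{array}$$ -/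

import Mathlib

/-- A product structure on a real Lie algebra: an integrable endomorphism `E ≠ ± Id` with
`E² = Id`. -/
structure IsProductStructure {g : Type*} [LieRing g] [LieAlgebra ℝ g]
    (E : g →ₗ[ℝ] g) : Prop where
  sq : ∀ x, E (E x) = x
  ne_id : E ≠ LinearMap.id
  ne_neg_id : E ≠ -LinearMap.id
  integrable : ∀ x y, E ⁅x, y⁆ = ⁅E x, y⁆ + ⁅x, E y⁆ - E ⁅E x, E y⁆

/-- A complex structure on a real Lie algebra: an integrable endomorphism with `J² = -Id`. -/
structure IsComplexStructure {g : Type*} [LieRing g] [LieAlgebra ℝ g]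
    (J : g →ₗ[ℝ] g) : Prop where
  sq : ∀ x, J (J x) = -x
  integrable : ∀ x y, J ⁅x, y⁆ = ⁅J x, y⁆ + ⁅x, J y⁆ + J ⁅J x, J y⁆

/-- A complex product structure `{J, E}` on a real Lie algebra. -/
structure IsComplexProductStructure {g : Type*} [LieRing g] [LieAlgebra ℝ g]
    (J E : g →ₗ[ℝ] g) : Prop where
  complex : IsComplexStructure J
  product : IsProductStructure E
  anticomm : ∀ x, J (E x) = -E (J x)

/-- The subalgebra `g₊`, the `+1`-eigenspace of a product structure. -/
def IsProductStructure.plus {g : Type*} [LieRing g] [LieAlgebra ℝ g]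
    {E : g →ₗ[ℝ] g} (hE : IsProductStructure E) : LieSubalgebra ℝ g where
  carrier := {x | E x = x}
  add_mem' := by
    intro x y hx hy
    simp only [Set.mem_ofPred_eq] at *
    rw [map_add, hx, hy]
  zero_mem' := by simp
  smul_mem' := by
    intro c x hx
    simp only [Set.mem_ofPred_eq] at *
    rw [map_smul, hx]
  lie_mem' := by
    intro x y hx hy
    have hx : E x = x := hx
    have hy : E y = y := hy
    have h := hE.integrable x y
    rw [hx, hy] at h
    have h2 : (2 : ℝ) • E ⁅x, y⁆ = (2 : ℝ) • ⁅x, y⁆ := by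
      rw [two_smul, two_smul]
      exact eq_sub_iff_add_eq.mp h
    exact smul_right_injective g (two_ne_zero : (2 : ℝ) ≠ 0) h2

/-- The subalgebra `g₋`, the `-1`-eigenspace of a product structure. -/
def IsProductStructure.minus {g : Type*} [LieRing g] [LieAlgebra ℝ g]
    {E : g →ₗ[ℝ] g} (hE : IsProductStructure E) : LieSubalgebra ℝ g where
  carrier := {x | E x = -x}
  add_mem' := by
    intro x y hx hy
    simp only [Set.mem_ofPred_eq] at *
    rw [map_add, hx, hy]
    abel
  zero_mem' := by simp
  smul_mem' := by
    intro c x hx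
    simp only [Set.mem_ofPred_eq] at *
    rw [map_smul, hx, smul_neg]
  lie_mem' := by
    intro x y hx hy
    have hx : E x = -x := hx
    have hy : E y = -y := hy
    have h := hE.integrable x y
    rw [hx, hy, neg_lie, lie_neg, neg_lie, lie_neg, neg_neg] at h
    have h2 : (2 : ℝ) • E ⁅x, y⁆ = (2 : ℝ) • (-⁅x, y⁆) := by
      rw [two_smul, two_smul]
      exact eq_sub_iff_add_eq.mp h
    exact smul_right_injective g (two_ne_zero : (2 : ℝ) ≠ 0) h2

/-- `h` is isomorphic to the abelian Lie algebra `ℝ³`. -/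
def IsAbelianThree (h : Type*) [LieRing h] [LieAlgebra ℝ h] : Prop :=
  Module.finrank ℝ h = 3 ∧ ∀ x y : h, ⁅x, y⁆ = 0

/-- `h` is isomorphic to the Heisenberg algebra `h₃`: it has a basis `e₁, e₂, e₃` with
`[e₁, e₂] = e₃` and `e₃` central. -/
def IsHeisenbergThree (h : Type*) [LieRing h] [LieAlgebra ℝ h] : Prop :=
  ∃ e : Module.Basis (Fin 3) ℝ h, ⁅e 0, e 1⁆ = e 2 ∧ ⁅e 0, e 2⁆ = 0 ∧ ⁅e 1, e 2⁆ = 0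

/-- The three (unordered) types `ℝ³ ⋈ ℝ³`, `h₃ ⋈ ℝ³`, `h₃ ⋈ h₃` of double Lie algebras. -/
inductive DoubleType : Type
  | RR
  | HR
  | HH

/-- The double Lie algebra `(g, g₊, g₋)` of the product structure `E` is of the given type. -/
def IsProductStructure.HasType {g : Type*} [LieRing g] [LieAlgebra ℝ g]
    {E : g →ₗ[ℝ] g} (hE : IsProductStructure E) : DoubleType → Prop
  | .RR => IsAbelianThree hE.plus ∧ IsAbelianThree hE.minus
  | .HR => (IsHeisenbergThree hE.plus ∧ IsAbelianThree hE.minus) ∨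
      (IsAbelianThree hE.plus ∧ IsHeisenbergThree hE.minus)
  | .HH => IsHeisenbergThree hE.plus ∧ IsHeisenbergThree hE.minus

/-- `g` admits a complex product structure. -/
def AdmitsCPS (g : Type*) [LieRing g] [LieAlgebra ℝ g] : Prop :=
  ∃ J E : g →ₗ[ℝ] g, IsComplexProductStructure J E

/-- `g` admits a complex product structure whose double Lie algebra is of type `t`. -/
def AdmitsCPSOfType (g : Type*) [LieRing g] [LieAlgebra ℝ g] (t : DoubleType) : Prop :=
  ∃ (J E : g →ₗ[ℝ] g) (h : IsComplexProductStructure J E), h.product.HasType t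

/-- The labels `1, …, 6` as elements of `Fin 6 = {0, …, 5}`. -/
def label : ℕ → Fin 6
  | 1 => 0
  | 2 => 1
  | 3 => 2
  | 4 => 3
  | 5 => 4
  | _ => 5

/-- The abbreviation `ij` for the 2-form `eⁱ ∧ eʲ` on a 6-dimensional space. -/
def wedge (i j : ℕ) : Fin 6 × Fin 6 := (label i, label j)

/-- The fifteen tuples `(de¹, …, de⁶)`. Each entry is a sum of 2-forms `eⁱ ∧ eʲ`, given as the
list of its summands; the empty list is `0`. -/
def differentials : Fin 15 → Fin 6 → List (Fin 6 × Fin 6) := ![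
  ![[], [], [], [], [], []],
  ![[], [], [], [], [], [wedge 1 2]],
  ![[], [], [], [], [], [wedge 1 2, wedge 3 4]],
  ![[], [], [], [], [wedge 1 2], [wedge 1 4, wedge 2 5]],
  ![[], [], [], [], [wedge 1 2], [wedge 1 3]],
  ![[], [], [], [], [wedge 1 3, wedge 4 2], [wedge 1 4, wedge 2 3]],
  ![[], [], [], [], [wedge 1 2], [wedge 1 4, wedge 2 3]],
  ![[], [], [], [], [wedge 1 2], [wedge 3 4]],
  ![[], [], [], [wedge 1 2], [wedge 1 3], [wedge 1 4]],
  ![[], [], [], [wedge 1 2], [wedge 1 3], [wedge 2 3]],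
  ![[], [], [], [wedge 1 2], [wedge 1 4], [wedge 2 4]],
  ![[], [], [], [wedge 1 2], [wedge 1 3], [wedge 2 4]],
  ![[], [], [], [wedge 1 2], [wedge 1 3, wedge 1 4], [wedge 2 4]],
  ![[], [], [], [wedge 1 2], [wedge 1 3], [wedge 1 4, wedge 2 3]],
  ![[], [], [], [wedge 1 2], [wedge 1 4], [wedge 1 3, wedge 4 2]]]

/-- The entries of the table: is there, on the `i`-th algebra, a complex product structure of
the given type? -/
def tableEntry (i : Fin 15) : DoubleType → Bool
  | .RR => (![true, true, true, true, false, true, true, true,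
      false, false, false, false, false, false, false] : Fin 15 → Bool) i
  | .HR => (![false, false, false, false, true, true, true, true,
      true, true, true, true, true, true, true] : Fin 15 → Bool) i
  | .HH => (![false, false, false, false, true, true, true, true,
      true, true, true, true, true, true, true] : Fin 15 → Bool) i

/-- The `i`-th listed algebra. Its underlying space is `ℝ⁶`; its bracket is defined below. -/
def ListedAlgebra (_i : Fin 15) : Type := Fin 6 → ℝ

noncomputable instance (i : Fin 15) : AddCommGroup (ListedAlgebra i) :=
  inferInstanceAs (AddCommGroup (Fin 6 → ℝ))

noncomputable instance (i : Fin 15) : Module ℝ (ListedAlgebra i) :=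
  inferInstanceAs (Module ℝ (Fin 6 → ℝ))

/-- The value `(deᵏ)(x, y)`, with `(eᵃ ∧ eᵇ)(x, y) = xₐ y_b - x_b yₐ`. -/
def ListedAlgebra.dForm (i : Fin 15) (k : Fin 6) (x y : Fin 6 → ℝ) : ℝ :=
  ((differentials i k).map fun p => x p.1 * y p.2 - x p.2 * y p.1).sum

/-- The bracket with `eᵏ([x, y]) = -(deᵏ)(x, y)`. -/
instance (i : Fin 15) : Bracket (ListedAlgebra i) (ListedAlgebra i) where
  bracket x y := fun k => -ListedAlgebra.dForm i k x y

theorem ListedAlgebra.lie_apply (i : Fin 15) (x y : ListedAlgebra i) (k : Fin 6) :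
    (⁅x, y⁆ : ListedAlgebra i) k = -ListedAlgebra.dForm i k x y := rfl

theorem ListedAlgebra.add_apply (i : Fin 15) (x y : ListedAlgebra i) (k : Fin 6) :
    (x + y) k = x k + y k := rfl

theorem ListedAlgebra.smul_apply (i : Fin 15) (c : ℝ) (x : ListedAlgebra i) (k : Fin 6) :
    (c • x) k = c * x k := rfl

theorem ListedAlgebra.zero_apply (i : Fin 15) (k : Fin 6) :
    (0 : ListedAlgebra i) k = 0 := rfl

theorem ListedAlgebra.ext' {i : Fin 15} {x y : ListedAlgebra i} (h : ∀ k, x k = y k) :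
    x = y := funext h

theorem ListedAlgebra.dForm_add_left (i : Fin 15) (k : Fin 6) (x y z : ListedAlgebra i) :
    ListedAlgebra.dForm i k (x + y) z =
      ListedAlgebra.dForm i k x z + ListedAlgebra.dForm i k y z := by
  unfold ListedAlgebra.dForm
  rw [← List.sum_map_add]
  congr 1
  apply List.map_congr_left
  intro p _
  simp only [ListedAlgebra.add_apply]
  ring

theorem ListedAlgebra.dForm_smul_right (i : Fin 15) (k : Fin 6) (c : ℝ)
    (x y : ListedAlgebra i) :
    ListedAlgebra.dForm i k x (c • y) = c * ListedAlgebra.dForm i k x y := by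
  unfold ListedAlgebra.dForm
  rw [← List.sum_map_mul_left]
  congr 1
  apply List.map_congr_left
  intro p _
  simp only [ListedAlgebra.smul_apply]
  ring

theorem ListedAlgebra.dForm_swap (i : Fin 15) (k : Fin 6) (x y : ListedAlgebra i) :
    ListedAlgebra.dForm i k x y = -ListedAlgebra.dForm i k y x := by
  unfold ListedAlgebra.dForm
  rw [← neg_one_mul, ← List.sum_map_mul_left]
  congr 1
  apply List.map_congr_left
  intro p _
  ring

set_option maxHeartbeats 2000000 in
theorem ListedAlgebra.jacobi (i : Fin 15) (x y z : ListedAlgebra i) :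
    ⁅x, ⁅y, z⁆⁆ = ⁅⁅x, y⁆, z⁆ + ⁅y, ⁅x, z⁆⁆ := by
  apply ListedAlgebra.ext'
  intro k
  simp only [ListedAlgebra.add_apply, ListedAlgebra.lie_apply]
  fin_cases i <;> fin_cases k <;>
    simp [ListedAlgebra.dForm, differentials, wedge, label, ListedAlgebra.lie_apply] <;> try ring

noncomputable instance (i : Fin 15) : LieRing (ListedAlgebra i) where
  add_lie x y z := by
    apply ListedAlgebra.ext'
    intro k
    simp only [ListedAlgebra.add_apply, ListedAlgebra.lie_apply, ListedAlgebra.dForm_add_left]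
    ring
  lie_add x y z := by
    apply ListedAlgebra.ext'
    intro k
    simp only [ListedAlgebra.add_apply, ListedAlgebra.lie_apply]
    rw [ListedAlgebra.dForm_swap, ListedAlgebra.dForm_add_left,
      ListedAlgebra.dForm_swap i k x y, ListedAlgebra.dForm_swap i k x z]
    ring
  lie_self x := by
    apply ListedAlgebra.ext'
    intro k
    have h := ListedAlgebra.dForm_swap i k x x
    simp only [ListedAlgebra.lie_apply, ListedAlgebra.zero_apply]
    linarith
  leibniz_lie := ListedAlgebra.jacobi i

noncomputable instance (i : Fin 15) : LieAlgebra ℝ (ListedAlgebra i) where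
  lie_smul c x y := by
    apply ListedAlgebra.ext'
    intro k
    simp only [ListedAlgebra.smul_apply, ListedAlgebra.lie_apply,
      ListedAlgebra.dForm_smul_right]
    ring

/-! Let ∇ be the torsion-free connection preserving both J and E. With V = g₊ it gives two products
on V, A from ∇ along g₊ and B from ∇ along J g₊, and g becomes V ⊗ ℝ² with a bracket depending on A
and B alone (`IsComplexProductStructure.isPencil`). Conversely such a presentation carries a complex
product structure (`IsPencil.isComplexProductStructure`). The bracket formula does not depend on the
basis of ℝ², so GL₂(ℝ) acts on presentations (`IsPencil.mix`) and whatever is proved for A holds for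
every non-zero combination of A and B. Jacobi makes each combination left-symmetric; nilpotency of g
makes all left multiplications and all commutator maps nilpotent.

In dimension three this forces a strict triangular form. A central element of g yields a vector
killed by all left multiplications (`exists_parallel`), then one annihilated from both sides
(`exists_isCentral`), then a flag common to A and B (`exists_preservesFlag`), and finally the
five-parameter tables of `exists_isTriangular`. The subalgebra iV is abelian when p = q and
Heisenberg otherwise, whence the three types. Left-symmetry says that the linear forms s and r on
the pencil have product zero (`forms_eq_zero_of_isTriangular`).

If s vanishes on the pencil, g is at most two-step and amounts to a pair of alternating forms on ℝ⁴;
these are sorted by whether the pair has a degenerate combination and by how the second form meets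
the radical of the first (`IsTwoStep.classify`). Otherwise r vanishes, s is normalised to 0 on A and
1 on B, and only the values of p and q matter; `classify_ext` sorts them by relative position.

The positive entries come from explicit parameters in `TriangularAlgebra`; once p ≠ q for one
product and p' = q' for the other, replacing one product by the sum turns type h₃ ⋈ ℝ³ into h₃ ⋈ h₃.
For the negative entries, p = q and p' = q' force a derived algebra of dimension at most two
(`IsPencil.derivedRankLE_two`) and exclude one further algebra (`not_isPencil_four`), while p ≠ q
forces a plane inside the intersection of centre and derived algebra (`not_isPencil_of_ne`). The
fifteen algebras are separated by dimensions in the lower central series, by ranks of ad x, and by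
commutation properties. -/

/-- A presentation of the Lie algebra `g` as `V ⊗ ℝ²`, with `V ⊗ ℝ²` identified with `g` through
`i` and `j`, in which the bracket comes from the bilinear products `A` and `B` on `V` by
`[x ⊗ a, y ⊗ b] = (x *ₐ y) ⊗ b - (y *_b x) ⊗ a`. -/
structure IsPencil {V g : Type*} [AddCommGroup V] [Module ℝ V] [LieRing g] [LieAlgebra ℝ g]
    (i j : V →ₗ[ℝ] g) (A B : V →ₗ[ℝ] V →ₗ[ℝ] V) : Prop where
  inj : ∀ x y, i x + j y = 0 → x = 0 ∧ y = 0
  surj : ∀ z, ∃ x y, i x + j y = z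
  lie_ii : ∀ x y, ⁅i x, i y⁆ = i (A x y - A y x)
  lie_jj : ∀ x y, ⁅j x, j y⁆ = j (B x y - B y x)
  lie_ij : ∀ x y, ⁅i x, j y⁆ = j (A x y) - i (B y x)

/-! ### Pencils of products: change of basis, Jacobi identities, nilpotency. -/

namespace IsPencil

variable {V g : Type*} [AddCommGroup V] [Module ℝ V] [LieRing g] [LieAlgebra ℝ g]
  {i j : V →ₗ[ℝ] g} {A B : V →ₗ[ℝ] V →ₗ[ℝ] V}

theorem lie_ji (h : IsPencil i j A B) (x y : V) : ⁅j x, i y⁆ = i (B x y) - j (A y x) := by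
  rw [← lie_skew, h.lie_ij]
  abel

theorem swap (h : IsPencil i j A B) : IsPencil j i B A where
  inj x y hxy := (h.inj y x (by rw [add_comm, hxy])).symm
  surj z := by
    obtain ⟨x, y, hxy⟩ := h.surj z
    exact ⟨y, x, by rw [add_comm, hxy]⟩
  lie_ii := h.lie_jj
  lie_jj := h.lie_ii
  lie_ij := h.lie_ji

/-- GL₂(ℝ) acts on the factor ℝ²: with x *ₐ y linear in a, the formula for [x ⊗ a, y ⊗ b] has the
same shape in every basis. Results about A thereby extend to all combinations sA + tB. -/
theorem mix (h : IsPencil i j A B) {s t s' t' : ℝ} (hd : s * t' - t * s' ≠ 0) :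
    IsPencil (s • i + t • j) (s' • i + t' • j) (s • A + t • B) (s' • A + t' • B) where
  inj x y hxy := by
    have h1 : i (s • x + s' • y) + j (t • x + t' • y) = 0 := by
      rw [← hxy]
      simp only [map_add, map_smul, LinearMap.add_apply, LinearMap.smul_apply]
      abel
    obtain ⟨h2, h3⟩ := h.inj _ _ h1
    have hx : (s * t' - t * s') • x = 0 := by
      have : (s * t' - t * s') • x = t' • (s • x + s' • y) - s' • (t • x + t' • y) := by module
      rw [this, h2, h3]; simp
    have hy : (s * t' - t * s') • y = 0 := by
      have : (s * t' - t * s') • y = s • (t • x + t' • y) - t • (s • x + s' • y) := by module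
      rw [this, h2, h3]; simp
    exact ⟨(smul_eq_zero.mp hx).resolve_left hd, (smul_eq_zero.mp hy).resolve_left hd⟩
  surj z := by
    obtain ⟨x, y, hxy⟩ := h.surj z
    set d := s * t' - t * s' with hdd
    refine ⟨d⁻¹ • (t' • x - s' • y), d⁻¹ • (s • y - t • x), ?_⟩
    have : d⁻¹ • d • z = z := inv_smul_smul₀ hd z
    rw [← this, ← hxy, hdd]
    simp only [map_smul, map_sub, LinearMap.add_apply, LinearMap.smul_apply]
    module
  lie_ii x y := by
    simp only [LinearMap.add_apply, LinearMap.smul_apply, add_lie, lie_add, smul_lie, lie_smul,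
      h.lie_ii, h.lie_jj, h.lie_ij, h.lie_ji, map_add, map_sub, map_smul]
    module
  lie_jj x y := by
    simp only [LinearMap.add_apply, LinearMap.smul_apply, add_lie, lie_add, smul_lie, lie_smul,
      h.lie_ii, h.lie_jj, h.lie_ij, h.lie_ji, map_add, map_sub, map_smul]
    module
  lie_ij x y := by
    simp only [LinearMap.add_apply, LinearMap.smul_apply, add_lie, lie_add, smul_lie, lie_smul,
      h.lie_ii, h.lie_jj, h.lie_ij, h.lie_ji, map_add, map_sub, map_smul]
    module

theorem ext_pair (h : IsPencil i j A B) {x y x' y' : V} (e : i x + j y = i x' + j y') :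
    x = x' ∧ y = y' := by
  have : i (x - x') + j (y - y') = 0 := by
    rw [map_sub, map_sub, sub_add_sub_comm, e, sub_self]
  obtain ⟨h1, h2⟩ := h.inj _ _ this
  exact ⟨sub_eq_zero.mp h1, sub_eq_zero.mp h2⟩

theorem injective_left (h : IsPencil i j A B) : Function.Injective i := by
  intro x y hxy
  exact (h.ext_pair (x := x) (y := 0) (x' := y) (y' := 0) (by rw [hxy])).1

theorem bijective (h : IsPencil i j A B) : Function.Bijective (i.coprod j) := by
  constructor
  · rintro ⟨x, y⟩ ⟨x', y'⟩ e
    simp only [LinearMap.coprod_apply] at e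
    obtain ⟨h1, h2⟩ := h.ext_pair e
    rw [h1, h2]
  · intro z
    obtain ⟨x, y, e⟩ := h.surj z
    exact ⟨(x, y), by simpa using e⟩

/-- The linear isomorphism `V × V ≃ g` of a pencil. -/
noncomputable def equiv (h : IsPencil i j A B) : (V × V) ≃ₗ[ℝ] g :=
  LinearEquiv.ofBijective (i.coprod j) h.bijective

theorem equiv_apply (h : IsPencil i j A B) (x y : V) : h.equiv (x, y) = i x + j y := by
  rw [equiv, LinearEquiv.ofBijective_apply, LinearMap.coprod_apply]

/-- The Jacobi identity for i x, i y, j z, read in jV and in iV. The first component says that A is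
left-symmetric; the second couples A and B. -/
theorem jacobi_aux (h : IsPencil i j A B) (x y z : V) :
    A (A x y - A y x) z = A x (A y z) - A y (A x z) ∧
    B z (A x y - A y x) = A x (B z y) - A y (B z x) + B (A y z) x - B (A x z) y
      - A (B z y) x + A (B z x) y := by
  have e := leibniz_lie (i x) (i y) (j z)
  simp only [h.lie_ij, h.lie_ii, lie_sub] at e
  have e2 : i (-(A x (B z y) - A (B z y) x) - B (A y z) x) + j (A x (A y z)) =
      i (-(B z (A x y - A y x)) - (A y (B z x) - A (B z x) y) - B (A x z) y)
        + j (A (A x y - A y x) z + A y (A x z)) := by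
    simp only [map_sub, map_add, map_neg, LinearMap.sub_apply] at e ⊢
    linear_combination (norm := module) e
  obtain ⟨h1, h2⟩ := h.ext_pair e2
  constructor
  · rw [h2]; abel
  · linear_combination (norm := module) h1

theorem left_symm (h : IsPencil i j A B) (x y z : V) :
    A (A x y - A y x) z = A x (A y z) - A y (A x z) := (h.jacobi_aux x y z).1

theorem mixed_symm (h : IsPencil i j A B) (x y z : V) :
    B z (A x y - A y x) = A x (B z y) - A y (B z x) + B (A y z) x - B (A x z) y
      - A (B z y) x + A (B z x) y := (h.jacobi_aux x y z).2

theorem nilpotent_ad (h : IsPencil i j A B) [LieRing.IsNilpotent g] (x : V) :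
    IsNilpotent (A x - A.flip x) := by
  obtain ⟨n, hn⟩ := LieModule.isNilpotent_toEnd_of_isNilpotent ℝ g g (i x)
  refine ⟨n, ?_⟩
  have key : ∀ (m : ℕ) (y : V), i (((A x - A.flip x) ^ m) y) =
      ((LieModule.toEnd ℝ g g (i x)) ^ m) (i y) := by
    intro m
    induction m with
    | zero => intro y; simp
    | succ m ih =>
      intro y
      rw [pow_succ, pow_succ, Module.End.mul_apply, Module.End.mul_apply, ih]
      congr 1
      simp [h.lie_ii]
  ext y
  apply h.injective_left
  rw [key, hn]
  simp

/-- The subspace iV is stable under ad (i x), and on the quotient g / iV ≅ V this map acts as A x.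
-/
theorem nilpotent_left (h : IsPencil i j A B) [LieRing.IsNilpotent g] (x : V) :
    IsNilpotent (A x) := by
  obtain ⟨n, hn⟩ := LieModule.isNilpotent_toEnd_of_isNilpotent ℝ g g (i x)
  refine ⟨n, ?_⟩
  have key : ∀ (m : ℕ) (y z : V), ∃ y', ((LieModule.toEnd ℝ g g (i x)) ^ m) (i y + j z) =
      i y' + j ((A x ^ m) z) := by
    intro m
    induction m with
    | zero => intro y z; exact ⟨y, by simp⟩
    | succ m ih =>
      intro y z
      obtain ⟨y', hy'⟩ := ih (A x y - A y x - B z x) (A x z)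
      refine ⟨y', ?_⟩
      rw [pow_succ, pow_succ, Module.End.mul_apply, Module.End.mul_apply, ← hy']
      congr 1
      simp only [LieModule.toEnd_apply_apply, lie_add, h.lie_ii, h.lie_ij, map_sub]
      abel
  ext z
  obtain ⟨y', hy'⟩ := key n 0 z
  rw [hn] at hy'
  have := (h.inj y' ((A x ^ n) z) (by rw [← hy']; simp)).2
  simpa using this

end IsPencil

/-! ### Nilpotent maps and linear algebra in dimension three. -/

section Nilpotent

variable {V : Type*} [AddCommGroup V] [Module ℝ V]

theorem eigenvalue_eq_zero_of_isNilpotent {f : V →ₗ[ℝ] V} (hf : IsNilpotent f) {x : V} {c : ℝ}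
    (hx : x ≠ 0) (h : f x = c • x) : c = 0 := by
  obtain ⟨n, hn⟩ := hf
  have key : ∀ m : ℕ, (f ^ m) x = c ^ m • x := by
    intro m
    induction m with
    | zero => simp
    | succ m ih => rw [pow_succ', Module.End.mul_apply, ih, map_smul, h, smul_smul, pow_succ]
  have h0 := key n
  rw [hn, LinearMap.zero_apply, eq_comm, smul_eq_zero] at h0
  exact eq_zero_of_pow_eq_zero (h0.resolve_right hx)

/-- A nilpotent endomorphism has eigenvalue zero on every quotient of a line by its kernel. -/
theorem coeff_eq_zero_of_isNilpotent {f : V →ₗ[ℝ] V} (hf : IsNilpotent f) {x u : V} {c : ℝ}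
    (hu : f u = 0) (hx : f x = c • x + u) (hne : x ∉ Submodule.span ℝ {u}) : c = 0 := by
  by_contra hc
  -- Not x but its image f x is the eigenvector; it is non-zero because x is not a multiple of u.
  have h1 : f (f x) = c • f x := by rw [hx, map_add, hu, map_smul, add_zero, hx]
  have h2 : f x ≠ 0 := by
    intro h0
    apply hne
    rw [h0] at hx
    refine Submodule.mem_span_singleton.mpr ⟨-c⁻¹, ?_⟩
    have : u = -(c • x) := by rw [eq_neg_iff_add_eq_zero, add_comm, ← hx]
    rw [this]
    simp [smul_smul, hc]
  exact hc (eigenvalue_eq_zero_of_isNilpotent hf h2 h1)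

theorem trace_three_of_isNilpotent {f : V →ₗ[ℝ] V} (hf : IsNilpotent f)
    (b : Module.Basis (Fin 3) ℝ V) :
    b.repr (f (b 0)) 0 + b.repr (f (b 1)) 1 + b.repr (f (b 2)) 2 = 0 := by
  have : Module.Finite ℝ V := Module.Finite.of_basis b
  have : Module.Free ℝ V := Module.Free.of_basis b
  have h := (LinearMap.isNilpotent_trace_of_isNilpotent hf).eq_zero
  rw [LinearMap.trace_eq_matrix_trace ℝ b, Matrix.trace, Fin.sum_univ_three] at h
  simpa [LinearMap.toMatrix_apply] using h

theorem trace_sq_three_of_isNilpotent {f : V →ₗ[ℝ] V} (hf : IsNilpotent f)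
    (b : Module.Basis (Fin 3) ℝ V) :
    b.repr (f (f (b 0))) 0 + b.repr (f (f (b 1))) 1 + b.repr (f (f (b 2))) 2 = 0 := by
  have h2 : IsNilpotent (f ^ 2) := hf.pow_succ 1
  have := trace_three_of_isNilpotent h2 b
  simpa [pow_two] using this

end Nilpotent

section BasisThree

variable {V : Type*} [AddCommGroup V] [Module ℝ V]

theorem exists_basis_three (hV : Module.finrank ℝ V = 3) {x y z : V}
    (h : LinearIndependent ℝ ![x, y, z]) :
    ∃ b : Module.Basis (Fin 3) ℝ V, b 0 = x ∧ b 1 = y ∧ b 2 = z := by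
  refine ⟨basisOfLinearIndependentOfCardEqFinrank h (by simp [hV]), ?_, ?_, ?_⟩ <;> simp

theorem exists_basis_three_of_pair (hV : Module.finrank ℝ V = 3) {x y : V}
    (h : LinearIndependent ℝ ![x, y]) :
    ∃ b : Module.Basis (Fin 3) ℝ V, b 0 = x ∧ b 1 = y := by
  have : Module.Finite ℝ V := Module.finite_of_finrank_eq_succ hV
  obtain ⟨z, hz⟩ := exists_linearIndependent_snoc_of_lt_finrank h (by rw [hV]; norm_num)
  have e : Fin.snoc ![x, y] z = ![x, y, z] := by
    ext k
    fin_cases k <;> rfl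
  obtain ⟨b, h0, h1, -⟩ := exists_basis_three hV (x := x) (y := y) (z := z) (by rw [← e]; exact hz)
  exact ⟨b, h0, h1⟩

theorem Module.Basis.three_expand (b : Module.Basis (Fin 3) ℝ V) (x : V) :
    x = b.repr x 0 • b 0 + b.repr x 1 • b 1 + b.repr x 2 • b 2 := by
  conv_lhs => rw [← b.sum_repr x, Fin.sum_univ_three]

theorem Module.Basis.three_replace (b : Module.Basis (Fin 3) ℝ V) {z : V} (hz : b.repr z 2 ≠ 0) :
    ∃ b' : Module.Basis (Fin 3) ℝ V, b' 0 = b 0 ∧ b' 1 = b 1 ∧ b' 2 = z := by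
  have hV : Module.finrank ℝ V = 3 := by simp [Module.finrank_eq_card_basis b]
  apply exists_basis_three hV
  rw [Fintype.linearIndependent_iff]
  intro c hc
  have hc' : c 0 • b 0 + c 1 • b 1 + c 2 • z = 0 := by simpa [Fin.sum_univ_three] using hc
  have h2 : c 2 = 0 := by
    have := congrArg (fun x => b.repr x 2) hc'
    simpa [Finsupp.single_apply, hz] using this
  rw [h2] at hc'
  have h0 := congrArg (fun x => b.repr x 0) hc'
  have h1 := congrArg (fun x => b.repr x 1) hc'
  simp at h0 h1
  intro k
  fin_cases k
  exacts [h0, h1, h2]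

/-- If a product of linear forms vanishes identically, then so does one of the factors. -/
theorem linearForm_mul_eq_zero {f g : V →ₗ[ℝ] ℝ} (h : ∀ x, f x * g x = 0) : f = 0 ∨ g = 0 := by
  by_contra! hne
  obtain ⟨x, hx⟩ : ∃ x, f x ≠ 0 := by
    by_contra! h0
    exact hne.1 (LinearMap.ext h0)
  obtain ⟨y, hy⟩ : ∃ y, g y ≠ 0 := by
    by_contra! h0
    exact hne.2 (LinearMap.ext h0)
  have hgx : g x = 0 := (mul_eq_zero.mp (h x)).resolve_left hx
  have hfy : f y = 0 := (mul_eq_zero.mp (h y)).resolve_right hy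
  have := h (x + y)
  rw [map_add, map_add, hgx, hfy, add_zero, zero_add] at this
  exact (mul_ne_zero hx hy) this

/-- A linear form vanishing on the kernel of another one is a multiple of it. -/
theorem linearForm_eq_smul {f g : V →ₗ[ℝ] ℝ} (h : ∀ x, g x = 0 → f x = 0) {x₀ : V}
    (hx₀ : g x₀ ≠ 0) (x : V) : f x = g x / g x₀ * f x₀ := by
  have h1 := h (x - (g x / g x₀) • x₀) (by
    rw [map_sub, map_smul, smul_eq_mul, div_mul_cancel₀ _ hx₀, sub_self])
  rw [map_sub, map_smul, smul_eq_mul, sub_eq_zero] at h1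
  exact h1

end BasisThree

/-! ### A vector killed by all left multiplications. -/

namespace IsPencil

variable {V g : Type*} [AddCommGroup V] [Module ℝ V] [LieRing g] [LieAlgebra ℝ g]
  {i j : V →ₗ[ℝ] g} {A B : V →ₗ[ℝ] V →ₗ[ℝ] V}

/-- A nilpotent g has a non-zero central element i v + j w; the relations are the components of its
brackets with i y and j y. -/
theorem exists_central_element (h : IsPencil i j A B) [LieRing.IsNilpotent g] [Nontrivial V] :
    ∃ v w : V, (v ≠ 0 ∨ w ≠ 0) ∧ ∀ y, A y w = 0 ∧ B y v = 0 ∧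
      A y v = A v y + B w y ∧ B y w = A v y + B w y := by
  have : Nontrivial g := h.injective_left.nontrivial
  obtain ⟨X, hX⟩ := @exists_ne _ (LieAlgebra.non_trivial_center_of_isNilpotent (R := ℝ) (L := g)) 0
  obtain ⟨v, w, hvw⟩ := h.surj (X : g)
  have hc : ∀ z : g, ⁅z, i v + j w⁆ = 0 := by
    rw [hvw]
    exact (LieModule.mem_maxTrivSubmodule ℝ g g _).mp X.2
  refine ⟨v, w, ?_, fun y => ?_⟩
  · by_contra! h0
    apply hX
    rw [h0.1, h0.2, map_zero, map_zero, add_zero] at hvw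
    exact Subtype.ext hvw.symm
  · have h1 : i (A y v - A v y - B w y) + j (A y w) = 0 := by
      rw [← hc (i y), lie_add, h.lie_ii, h.lie_ij, map_sub i _ (B w y)]
      abel
    have h2 : i (B y v) + j (B y w - B w y - A v y) = 0 := by
      rw [← hc (j y), lie_add, h.lie_jj, h.lie_ji, map_sub j _ (A v y)]
      abel
    obtain ⟨h3, h4⟩ := h.inj _ _ h1
    obtain ⟨h5, h6⟩ := h.inj _ _ h2
    refine ⟨h4, h5, ?_, ?_⟩
    · linear_combination (norm := module) h3
    · linear_combination (norm := module) h6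

/-- Since f kills b 1, it acts on V / ⟨b 1⟩ by a nilpotent 2 × 2 block, which has trace and
determinant zero. -/
theorem coord_mul_of_nilpotent {f : V →ₗ[ℝ] V} (hf : IsNilpotent f)
    (b : Module.Basis (Fin 3) ℝ V) (h1 : f (b 1) = 0) :
    b.repr (f (b 2)) 2 = -b.repr (f (b 0)) 0 ∧
    b.repr (f (b 0)) 0 ^ 2 + b.repr (f (b 0)) 2 * b.repr (f (b 2)) 0 = 0 := by
  have t1 := trace_three_of_isNilpotent hf b
  have t2 := trace_sq_three_of_isNilpotent hf b
  rw [b.three_expand (f (b 0)), b.three_expand (f (b 2))] at t2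
  simp only [h1, map_add, map_smul, map_zero, smul_zero, add_zero, Finsupp.add_apply,
    Finsupp.smul_apply, smul_eq_mul, Finsupp.zero_apply] at t1 t2
  have h3 : b.repr (f (b 2)) 2 = -b.repr (f (b 0)) 0 := by linarith
  refine ⟨h3, ?_⟩
  rw [h3] at t2
  linarith

/-- Take a central element i v + j w. If v and w are dependent, one of them works. Otherwise A y v =
B y w for all y; either this vanishes and v works, or it has the form φ(y) z with v, w, z a basis,
and then z works. -/
theorem exists_parallel (h : IsPencil i j A B) [LieRing.IsNilpotent g]
    (hV : Module.finrank ℝ V = 3) : ∃ u : V, u ≠ 0 ∧ ∀ y, A y u = 0 ∧ B y u = 0 := by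
  have : Nontrivial V := Module.nontrivial_of_finrank_pos (R := ℝ) (by rw [hV]; norm_num)
  obtain ⟨v, w, hvw, hc⟩ := h.exists_central_element
  by_cases hw : w = 0
  · refine ⟨v, hvw.resolve_right (not_not.mpr hw), fun y => ?_⟩
    obtain ⟨-, h2, h3, h4⟩ := hc y
    rw [hw, map_zero] at h4
    rw [hw] at h3
    exact ⟨h3.trans h4.symm, h2⟩
  by_cases hli : LinearIndependent ℝ ![v, w]
  swap
  · refine ⟨w, hw, fun y => ?_⟩
    rw [LinearIndependent.pair_iff] at hli
    push Not at hli
    obtain ⟨s, t, hst, hne⟩ := hli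
    obtain ⟨h1, h2, h3, h4⟩ := hc y
    refine ⟨h1, ?_⟩
    have hs : s ≠ 0 := by
      intro h0
      rw [h0, zero_smul, zero_add, smul_eq_zero] at hst
      exact hne h0 (hst.resolve_right hw)
    by_cases ht : t = 0
    · have hv : v = 0 := by
        rw [ht, zero_smul, add_zero, smul_eq_zero] at hst
        exact hst.resolve_left hs
      rw [h4, ← h3, hv, map_zero]
    · have := congrArg (B y) hst
      rw [map_add, map_smul, map_smul, h2, smul_zero, zero_add, map_zero, smul_eq_zero] at this
      exact this.resolve_left ht
  obtain ⟨b, hb0, hb1⟩ := exists_basis_three_of_pair hV hli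
  have hN : ∀ y, A y v = B y w := fun y => (hc y).2.2.1.trans (hc y).2.2.2.symm
  have sqA : ∀ (b : Module.Basis (Fin 3) ℝ V), b 0 = v → b 1 = w → ∀ y,
      b.repr (A y (b 2)) 2 = -b.repr (A y v) 0 ∧
      b.repr (A y v) 0 ^ 2 + b.repr (A y v) 2 * b.repr (A y (b 2)) 0 = 0 := by
    intro b hb0 hb1 y
    have := coord_mul_of_nilpotent (h.nilpotent_left y) b (by rw [hb1]; exact (hc y).1)
    rwa [hb0] at this
  -- B y kills v instead of w, so the first two basis vectors trade places.
  have sqB : ∀ (b : Module.Basis (Fin 3) ℝ V), b 0 = v → b 1 = w → ∀ y,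
      b.repr (B y (b 2)) 2 = -b.repr (A y v) 1 ∧
      b.repr (A y v) 1 ^ 2 + b.repr (A y v) 2 * b.repr (B y (b 2)) 1 = 0 := by
    intro b hb0 hb1 y
    have := coord_mul_of_nilpotent (h.swap.nilpotent_left y) (b.reindex (Equiv.swap 0 1))
      (by simp [hb0, (hc y).2.1])
    simpa [hb1, ← hN, Equiv.swap_apply_of_ne_of_ne] using this
  let n : Fin 3 → V →ₗ[ℝ] ℝ := fun k => b.coord k ∘ₗ A.flip v
  have hn : ∀ k y, n k y = b.repr (A y v) k := fun k y => rfl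
  have hA := sqA b hb0 hb1
  have hB := sqB b hb0 hb1
  by_cases h20 : n 2 = 0
  · have hz : ∀ y, A y v = 0 := by
      intro y
      have e2 : b.repr (A y v) 2 = 0 := by rw [← hn, h20]; rfl
      have e0 := (hA y).2
      have e1 := (hB y).2
      rw [e2, zero_mul, add_zero] at e0 e1
      rw [b.three_expand (A y v), e2, pow_eq_zero_iff two_ne_zero |>.mp e0,
        pow_eq_zero_iff two_ne_zero |>.mp e1]
      simp
    exact ⟨v, by rw [← hb0]; exact b.ne_zero 0, fun y => ⟨hz y, (hc y).2.1⟩⟩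
  obtain ⟨y₀, hy₀⟩ : ∃ y, n 2 y ≠ 0 := by
    by_contra! h0
    exact h20 (LinearMap.ext h0)
  have hz2 : b.repr (A y₀ v) 2 ≠ 0 := hy₀
  obtain ⟨b', hb0', hb1', hb2'⟩ := b.three_replace hz2
  set z := A y₀ v with hzdef
  let φ : V →ₗ[ℝ] ℝ := (n 2 y₀)⁻¹ • n 2
  have hφ0 : φ ≠ 0 := by
    intro h0
    have := congrArg (fun f => f y₀) h0
    simp [φ, hy₀] at this
  -- The determinant conditions make the coordinates `n 0` and `n 1` vanish wherever `n 2` does, so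
  -- they are multiples of it and y ↦ A y v has rank one.
  have hφ : ∀ y, A y v = φ y • z := by
    intro y
    have e0 := linearForm_eq_smul (f := n 0) (g := n 2) (fun x hx => by
      have e := (hA x).2
      rw [← hn 2, hx, zero_mul, add_zero] at e
      exact pow_eq_zero_iff two_ne_zero |>.mp e) hy₀ y
    have e1 := linearForm_eq_smul (f := n 1) (g := n 2) (fun x hx => by
      have e := (hB x).2
      rw [← hn 2, hx, zero_mul, add_zero] at e
      exact pow_eq_zero_iff two_ne_zero |>.mp e) hy₀ y
    have e2 : n 2 y = n 2 y / n 2 y₀ * n 2 y₀ := by field_simp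
    have hφy : φ y = n 2 y / n 2 y₀ := by simp [φ, div_eq_inv_mul]
    apply b.ext_elem
    intro k
    rw [map_smul, Finsupp.smul_apply, ← hn, hzdef, ← hn, hφy]
    fin_cases k
    exacts [e0, e1, e2]
  have r0 : ∀ y, b'.repr (A y v) 0 = 0 ∧ b'.repr (A y v) 1 = 0 ∧ b'.repr (A y v) 2 = φ y := by
    intro y
    rw [hφ y, ← hb2']
    simp
  have hb0v : b' 0 = v := hb0'.trans hb0
  have hb1w : b' 1 = w := hb1'.trans hb1
  have rv : b'.repr v = Finsupp.single 0 1 := by rw [← hb0v, b'.repr_self]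
  have rw' : b'.repr w = Finsupp.single 1 1 := by rw [← hb1w, b'.repr_self]
  have rz : b'.repr z = Finsupp.single 2 1 := by rw [← hb2', b'.repr_self]
  have hA' := sqA b' hb0v hb1w
  have hB' := sqB b' hb0v hb1w
  rw [hb2'] at hA' hB'
  let α : V →ₗ[ℝ] ℝ := b'.coord 1 ∘ₗ A.flip z
  let β : V →ₗ[ℝ] ℝ := b'.coord 0 ∘ₗ B.flip z
  have hα : ∀ y, A y z = α y • w := by
    -- In the basis v, w, z the determinant condition becomes φ(y) times this coordinate, and φ is
    -- not zero.
    have e : b'.coord 0 ∘ₗ A.flip z = 0 := by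
      refine (linearForm_mul_eq_zero (f := φ) (g := b'.coord 0 ∘ₗ A.flip z) fun y => ?_).resolve_left
        hφ0
      have e := (hA' y).2
      rw [(r0 y).1, (r0 y).2.2] at e
      simpa using e
    intro y
    have e2 := (hA' y).1
    rw [(r0 y).1, neg_zero] at e2
    have e0 : b'.repr (A y z) 0 = 0 := congrArg (fun f => f y) e
    rw [b'.three_expand (A y z), e2, e0, hb1w]
    simp [α]
  have hβ : ∀ y, B y z = β y • v := by
    have e : b'.coord 1 ∘ₗ B.flip z = 0 := by
      refine (linearForm_mul_eq_zero (f := φ) (g := b'.coord 1 ∘ₗ B.flip z) fun y => ?_).resolve_left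
        hφ0
      have e := (hB' y).2
      rw [(r0 y).2.1, (r0 y).2.2] at e
      simpa using e
    intro y
    have e2 := (hB' y).1
    rw [(r0 y).2.1, neg_zero] at e2
    have e0 : b'.repr (B y z) 1 = 0 := congrArg (fun f => f y) e
    rw [b'.three_expand (B y z), e2, e0, hb0v]
    simp [β]
  have hv0 : v ≠ 0 := by rw [← hb0]; exact b.ne_zero 0
  have hz0 : z ≠ 0 := by rw [← hb2']; exact b'.ne_zero 2
  have hφz : φ z = 0 := by
    have e := (hc z).2.2.1
    -- The central relation at z reads φ(z) z = α(v) w + β(w) v. Its three coordinates give φ(z) = 0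
    -- here, and α(v) = 0 and β(w) = 0 below.
    rw [hφ z, hα v, hβ w] at e
    have := congrArg (fun x => b'.repr x 2) e
    simpa [rv, rw', rz] using this
  have hαw : α w = 0 := by
    have := eigenvalue_eq_zero_of_isNilpotent (h.nilpotent_ad z) hw (c := -α w) (by
      simp [(hc z).1, hα w])
    linarith
  have hβv : β v = 0 := by
    have := eigenvalue_eq_zero_of_isNilpotent (h.swap.nilpotent_ad z) hv0 (c := -β v) (by
      simp [(hc z).2.1, hβ v])
    linarith
  have hαv : α v = 0 := by
    have e := (hc z).2.2.1
    rw [hφ z, hα v, hβ w, hφz] at e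
    have := congrArg (fun x => b'.repr x 1) e
    simpa [rv, rw', rz] using this.symm
  have hβw : β w = 0 := by
    have e := (hc z).2.2.1
    rw [hφ z, hα v, hβ w, hφz] at e
    have := congrArg (fun x => b'.repr x 0) e
    simpa [rv, rw', rz] using this.symm
  -- Left-symmetry applied to v: the left side is a multiple of z, so the w-coordinate of the right
  -- side vanishes.
  have hlsaA : ∀ x y, φ y * α x = φ x * α y := by
    intro x y
    have e := h.left_symm x y v
    rw [hφ y, hφ x, map_smul, map_smul, hα, hα, hφ] at e
    have := congrArg (fun x => b'.repr x 1) e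
    rw [← hb1w, ← hb2'] at this
    simp at this
    linarith
  have hlsaB : ∀ x y, φ y * β x = φ x * β y := by
    intro x y
    have e := h.swap.left_symm x y w
    rw [← hN, ← hN, ← hN, hφ y, hφ x, map_smul, map_smul, hβ, hβ, hφ] at e
    have := congrArg (fun x => b'.repr x 0) e
    rw [← hb0v, ← hb2'] at this
    simp at this
    linarith
  -- If γ(z) were non-zero, the relation with φ(z) = 0 would force φ to vanish on the whole basis.
  have key : ∀ γ : V →ₗ[ℝ] ℝ, γ v = 0 → γ w = 0 → (∀ x y, φ y * γ x = φ x * γ y) → γ = 0 := by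
    intro γ gv gw hγ
    have gz : γ z = 0 := by
      by_contra hne
      apply hφ0
      apply b'.ext
      have h1 := hγ v z
      have h2 := hγ w z
      rw [hφz, zero_mul, eq_comm, mul_eq_zero] at h1 h2
      intro k
      fin_cases k
      · simpa [hb0v] using h1.resolve_right hne
      · simpa [hb1w] using h2.resolve_right hne
      · simpa [hb2'] using hφz
    apply b'.ext
    intro k
    fin_cases k
    · simpa [hb0v] using gv
    · simpa [hb1w] using gw
    · simpa [hb2'] using gz
  have hα0 := key α hαv hαw hlsaA
  have hβ0 := key β hβv hβw hlsaB
  refine ⟨z, hz0, fun y => ⟨?_, ?_⟩⟩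
  · rw [hα, hα0]; simp
  · rw [hβ, hβ0]; simp

end IsPencil

/-! ### From a parallel vector to a two-sided annihilator. -/

section FlagBasis

variable {V : Type*} [AddCommGroup V] [Module ℝ V]

/-- On the plane V / ⟨u⟩ the map S is nilpotent and non-zero, so e and S e lift a Jordan basis of
it, and S² e falls into ⟨u⟩. -/
theorem exists_flag_basis (hV : Module.finrank ℝ V = 3) {S : V →ₗ[ℝ] V} (hS : IsNilpotent S)
    {u e : V} (hu : u ≠ 0) (hSu : S u = 0) (he : S e ∉ Submodule.span ℝ {u}) :
    ∃ b : Module.Basis (Fin 3) ℝ V, b 0 = u ∧ b 1 = S e ∧ b 2 = e ∧ ∃ c : ℝ, S (S e) = c • u := by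
  have hSe : S e ≠ 0 := fun h0 => he (by rw [h0]; exact Submodule.zero_mem _)
  have hli : LinearIndependent ℝ ![u, S e, e] := by
    rw [Fintype.linearIndependent_iff]
    intro c hc
    have hc' : c 0 • u + c 1 • S e + c 2 • e = 0 := by simpa [Fin.sum_univ_three] using hc
    have h2 : c 2 = 0 := by
      by_contra hne
      have h1 := congrArg S hc'
      simp only [map_add, map_smul, hSu, smul_zero, zero_add, map_zero] at h1
      by_cases hc1 : c 1 = 0
      · rw [hc1, zero_smul, zero_add, smul_eq_zero] at h1
        exact h1.elim hne hSe
      · have h3 : S (S e) = (-(c 1)⁻¹ * c 2) • S e := by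
          have h5 : c 1 • S (S e) = -(c 2 • S e) := eq_neg_of_add_eq_zero_left h1
          rw [← inv_smul_smul₀ hc1 (S (S e)), h5]
          module
        have := eigenvalue_eq_zero_of_isNilpotent hS hSe h3
        simp [hc1, hne] at this
    rw [h2, zero_smul, add_zero] at hc'
    have h1 : c 1 = 0 := by
      by_contra hne
      apply he
      refine Submodule.mem_span_singleton.mpr ⟨-(c 1)⁻¹ * c 0, ?_⟩
      have h5 : c 1 • S e = -(c 0 • u) := by
        rw [eq_neg_iff_add_eq_zero, add_comm]; exact hc'
      rw [← inv_smul_smul₀ hne (S e), h5]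
      module
    rw [h1, zero_smul, add_zero, smul_eq_zero] at hc'
    intro k
    fin_cases k
    exacts [hc'.resolve_right hu, h1, h2]
  obtain ⟨b, hb0, hb1, hb2⟩ := exists_basis_three hV hli
  refine ⟨b, hb0, hb1, hb2, b.repr (S (S e)) 0, ?_⟩
  have r0 : b.repr u = Finsupp.single 0 1 := by rw [← hb0, b.repr_self]
  have r1 : b.repr (S e) = Finsupp.single 1 1 := by rw [← hb1, b.repr_self]
  have r2 : b.repr e = Finsupp.single 2 1 := by rw [← hb2, b.repr_self]
  have t1 := trace_three_of_isNilpotent hS b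
  have t2 := trace_sq_three_of_isNilpotent hS b
  rw [hb0, hb1, hb2, b.three_expand (S (S e)), hb0, hb1, hb2] at t2
  rw [hb0, hb1, hb2] at t1
  simp only [hSu, map_zero, r0, r1, r2, map_add, map_smul, Finsupp.add_apply, Finsupp.smul_apply,
    Finsupp.zero_apply, smul_eq_mul] at t1 t2
  simp at t1 t2
  rw [t1] at t2
  have h2 : b.repr (S (S e)) 2 = 0 := by linarith
  conv_lhs => rw [b.three_expand (S (S e)), t1, h2, hb0]
  simp

theorem Module.Basis.notMem_span_smul (b : Module.Basis (Fin 3) ℝ V) {k l : Fin 3} (hkl : k ≠ l)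
    (c : ℝ) : b k ∉ Submodule.span ℝ {c • b l} := by
  intro hm
  obtain ⟨d, hd⟩ := Submodule.mem_span_singleton.mp hm
  have := congrArg (fun x => b.repr x k) hd
  simp [hkl.symm] at this

/-- The products of a basis adapted to a derivation `D` of square zero. -/
theorem products_of_derivation {C : V →ₗ[ℝ] V →ₗ[ℝ] V} {D : V →ₗ[ℝ] V}
    (b : Module.Basis (Fin 3) ℝ V) (h0 : D (b 0) = 0) (h1 : D (b 1) = 0) (h2 : D (b 2) = b 1)
    (hder : ∀ y z, D (C y z) = C (D y) z + C y (D z)) (hpar : ∀ y, C y (b 0) = 0)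
    (hnil : ∀ y, IsNilpotent (C y)) (had : ∀ y, IsNilpotent (C y - C.flip y)) :
    ∃ m f : ℝ, C (b 2) (b 1) = m • b 0 ∧ C (b 1) (b 2) = -m • b 0 ∧ C (b 1) (b 1) = 0 ∧
      C (b 0) (b 2) = f • b 1 ∧ C (b 0) (b 1) = 0 ∧ m * f = 0 := by
  have hD : ∀ x, D x = b.repr x 2 • b 1 := by
    intro x
    conv_lhs => rw [b.three_expand x]
    simp [h0, h1, h2]
  have hker : ∀ x, D x = 0 → b.repr x 2 = 0 := by
    intro x hx
    rw [hD, smul_eq_zero] at hx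
    exact hx.resolve_right (b.ne_zero 1)
  -- Here b₁b₁ = D(b₂b₁) lies in the image ⟨b₁⟩ of D, so b₁ is an eigenvector of the nilpotent map
  -- `C (b 1)`.
  have e11 : C (b 1) (b 1) = 0 := by
    have e := hder (b 2) (b 1)
    rw [h1, h2, map_zero, add_zero, hD] at e
    have c0 := eigenvalue_eq_zero_of_isNilpotent (hnil (b 1)) (b.ne_zero 1) e.symm
    rw [← e, c0, zero_smul]
  have e21 : C (b 2) (b 1) = b.repr (C (b 2) (b 1)) 0 • b 0 := by
    have k2 := hker (C (b 2) (b 1)) (by rw [hder, h1, h2, e11, map_zero, add_zero])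
    have k : C (b 2) (b 1) = b.repr (C (b 2) (b 1)) 1 • b 1 + b.repr (C (b 2) (b 1)) 0 • b 0 := by
      conv_lhs => rw [b.three_expand (C (b 2) (b 1)), k2]
      module
    have c0 := coeff_eq_zero_of_isNilpotent (hnil (b 2)) (by rw [map_smul, hpar, smul_zero]) k
      (b.notMem_span_smul (by decide) _)
    conv_lhs => rw [k, c0]
    simp
  have e12 : C (b 1) (b 2) =
      b.repr (C (b 1) (b 2)) 0 • b 0 + b.repr (C (b 1) (b 2)) 1 • b 1 := by
    have k2 := hker (C (b 1) (b 2)) (by rw [hder, h1, h2, e11, map_zero, LinearMap.zero_apply,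
      add_zero])
    conv_lhs => rw [b.three_expand (C (b 1) (b 2)), k2]
    simp
  -- D(b₂b₂) = b₁b₂ + b₂b₁. The trace of `C (b 2)` shows that b₂b₂ has no b₂-component, so the left
  -- side is zero and b₁b₂ = -b₂b₁.
  have e22 := hder (b 2) (b 2)
  rw [h2, e12, e21, hD] at e22
  have t := trace_three_of_isNilpotent (hnil (b 2)) b
  rw [hpar, e21] at t
  simp at t
  rw [t] at e22
  have q0 := congrArg (fun x => b.repr x 0) e22
  have q1 := congrArg (fun x => b.repr x 1) e22
  simp at q0 q1
  have e02' := hder (b 0) (b 2)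
  rw [h0, h2, LinearMap.map_zero, LinearMap.zero_apply, zero_add, hD] at e02'
  have c2 := eigenvalue_eq_zero_of_isNilpotent (hnil (b 0)) (b.ne_zero 1) e02'.symm
  have e01 : C (b 0) (b 1) = 0 := by rw [← e02', c2, zero_smul]
  have e02 : C (b 0) (b 2) =
      b.repr (C (b 0) (b 2)) 0 • b 0 + b.repr (C (b 0) (b 2)) 1 • b 1 := by
    conv_lhs => rw [b.three_expand (C (b 0) (b 2)), c2]
    simp
  have a0 : (C (b 2) - C.flip (b 2)) (b 0) =
      -(b.repr (C (b 0) (b 2)) 0 • b 0 + b.repr (C (b 0) (b 2)) 1 • b 1) := by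
    rw [← e02]; simp [hpar]
  have a1 : (C (b 2) - C.flip (b 2)) (b 1) = (2 * b.repr (C (b 2) (b 1)) 0) • b 0 := by
    have : C (b 1) (b 2) = -(b.repr (C (b 2) (b 1)) 0) • b 0 := by
      rw [e12, ← q1, zero_smul, add_zero]
      congr 1
      linarith
    rw [LinearMap.sub_apply, LinearMap.flip_apply, this]
    conv_lhs => rw [e21]
    simp
    module
  have a2 : (C (b 2) - C.flip (b 2)) (b 2) = 0 := by simp
  -- The commutator map of b₂ sends b₀ to -f b₁, once its trace is used, and b₁ to 2m b₀. The trace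
  -- of its square is -4mf.
  have s1 := trace_three_of_isNilpotent (had (b 2)) b
  have s2 := trace_sq_three_of_isNilpotent (had (b 2)) b
  rw [a0, a1, a2] at s1 s2
  simp only [map_neg, map_add, map_smul, a0, a1, map_zero] at s1 s2
  simp at s1
  rw [s1] at s2 e02
  simp at s2
  refine ⟨b.repr (C (b 2) (b 1)) 0, b.repr (C (b 0) (b 2)) 1, e21, ?_, e11, ?_, e01, ?_⟩
  · rw [e12, ← q1, zero_smul, add_zero]
    congr 1
    linarith
  · conv_lhs => rw [e02]
    simp
  · linarith

end FlagBasis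

namespace IsPencil

variable {V g : Type*} [AddCommGroup V] [Module ℝ V] [LieRing g] [LieAlgebra ℝ g]
  {i j : V →ₗ[ℝ] g} {A B : V →ₗ[ℝ] V →ₗ[ℝ] V}

/-- With right multiplication by u zero, left-symmetry collapses to the Leibniz rule. The mixed
Jacobi identity does the same for B in the next lemma. -/
theorem derivation_left (h : IsPencil i j A B) {u : V} (hu : ∀ y, A y u = 0 ∧ B y u = 0)
    (y z : V) : A u (A y z) = A (A u y) z + A y (A u z) := by
  have := h.left_symm u y z
  rw [(hu y).1, sub_zero] at this
  rw [this]; abel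

theorem derivation_right (h : IsPencil i j A B) {u : V} (hu : ∀ y, A y u = 0 ∧ B y u = 0)
    (y z : V) : A u (B y z) = B (A u y) z + B y (A u z) := by
  have := h.mixed_symm u z y
  simp only [(hu _).1, (hu _).2, map_zero, sub_zero, add_zero, LinearMap.zero_apply] at this
  rw [this]; abel

/-- `u` is annihilated by both products, from both sides. -/
def IsCentral (A B : V →ₗ[ℝ] V →ₗ[ℝ] V) (u : V) : Prop :=
  ∀ y, A y u = 0 ∧ B y u = 0 ∧ A u y = 0 ∧ B u y = 0

/-- D = A u is a non-zero derivation of both products. In a basis u, D e, e the product lemma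
applies to A, B and A + B; the vector annihilated from both sides is D e, not u. -/
theorem exists_isCentral_of_parallel (h : IsPencil i j A B) [LieRing.IsNilpotent g]
    (hV : Module.finrank ℝ V = 3) {u : V} (hu0 : u ≠ 0) (hu : ∀ y, A y u = 0 ∧ B y u = 0)
    {e : V} (he : A u e ≠ 0) : ∃ v : V, v ≠ 0 ∧ IsCentral A B v := by
  have hspan : ∀ y, A u y ∈ Submodule.span ℝ {u} → A u y = 0 := by
    intro y hy
    obtain ⟨c, hc⟩ := Submodule.mem_span_singleton.mp hy
    have := eigenvalue_eq_zero_of_isNilpotent (h.nilpotent_ad y) hu0 (c := -c) (by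
      simp [(hu y).1, ← hc])
    rw [← hc, neg_eq_zero.mp this, zero_smul]
  obtain ⟨b, hb0, hb1, hb2, c, hc⟩ := exists_flag_basis hV (h.nilpotent_left u) hu0 (hu u).1
    (fun hm => he (hspan e hm))
  have hD0 : A u (b 0) = 0 := by rw [hb0]; exact (hu u).1
  have hD1 : A u (b 1) = 0 := by
    rw [hb1]
    exact hspan _ (by rw [hc]; exact Submodule.mem_span_singleton.mpr ⟨c, rfl⟩)
  have hD2 : A u (b 2) = b 1 := by rw [hb2, hb1]
  -- For B alone one gets only m'f' = 0. Since f = 1 and m = 0 for A, the sum A + B adds m'(1 + f')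
  -- = 0, and so m' = 0.
  have hm := h.mix (s := 1) (t := 1) (s' := 0) (t' := 1) (by norm_num)
  obtain ⟨m, f, hA1, hA2, hA3, hA4, hA5, hA6⟩ := products_of_derivation (C := A) b hD0 hD1 hD2
    (h.derivation_left hu) (fun y => by rw [hb0]; exact (hu y).1) h.nilpotent_left h.nilpotent_ad
  obtain ⟨m', f', hB1, hB2, hB3, hB4, hB5, hB6⟩ := products_of_derivation (C := B) b hD0 hD1 hD2
    (h.derivation_right hu) (fun y => by rw [hb0]; exact (hu y).2) h.swap.nilpotent_left
    h.swap.nilpotent_ad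
  obtain ⟨m'', f'', hC1, -, -, hC4, -, hC6⟩ := products_of_derivation
    (C := (1 : ℝ) • A + (1 : ℝ) • B) b hD0 hD1 hD2
    (fun y z => by
      simp only [one_smul, LinearMap.add_apply, map_add, h.derivation_left hu,
        h.derivation_right hu]
      abel) (fun y => by simp [hb0, (hu y).1, (hu y).2]) hm.nilpotent_left hm.nilpotent_ad
  have f1 : f = 1 := by
    rw [hb0, hD2] at hA4
    have := congrArg (fun x => b.repr x 1) hA4
    simpa using this.symm
  have m0 : m = 0 := by rw [f1, mul_one] at hA6; exact hA6
  have m1 : m'' = m' := by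
    have := congrArg (fun x => b.repr x 0) hC1
    simp [hA1, hB1, m0] at this
    exact this.symm
  have f2 : f'' = 1 + f' := by
    have := congrArg (fun x => b.repr x 1) hC4
    simp [hA4, hB4, f1] at this
    exact this.symm
  have m2 : m' = 0 := by
    rw [m1, f2] at hC6
    linarith
  rw [m0] at hA1 hA2
  rw [m2] at hB1 hB2
  simp only [neg_zero, zero_smul] at hA1 hA2 hB1 hB2
  have kA : A.flip (b 1) = 0 := b.ext fun k => by
    fin_cases k
    exacts [hA5, hA3, hA1]
  have kB : B.flip (b 1) = 0 := b.ext fun k => by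
    fin_cases k
    exacts [hB5, hB3, hB1]
  have kA' : A (b 1) = 0 := b.ext fun k => by
    fin_cases k
    exacts [(congrArg (A (b 1)) hb0).trans (hu _).1, hA3, hA2]
  have kB' : B (b 1) = 0 := b.ext fun k => by
    fin_cases k
    exacts [(congrArg (B (b 1)) hb0).trans (hu _).2, hB3, hB2]
  exact ⟨b 1, b.ne_zero 1, fun y => ⟨congrArg (fun f => f y) kA, congrArg (fun f => f y) kB,
    congrArg (fun f => f y) kA', congrArg (fun f => f y) kB'⟩⟩

theorem exists_isCentral (h : IsPencil i j A B) [LieRing.IsNilpotent g]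
    (hV : Module.finrank ℝ V = 3) : ∃ v : V, v ≠ 0 ∧ IsCentral A B v := by
  obtain ⟨u, hu0, hu⟩ := h.exists_parallel hV
  by_cases hA : ∀ y, A u y = 0
  · by_cases hB : ∀ y, B u y = 0
    · exact ⟨u, hu0, fun y => ⟨(hu y).1, (hu y).2, hA y, hB y⟩⟩
    · push Not at hB
      obtain ⟨e, he⟩ := hB
      obtain ⟨v, hv0, hv⟩ := h.swap.exists_isCentral_of_parallel hV hu0 (fun y => (hu y).symm) he
      exact ⟨v, hv0, fun y => ⟨(hv y).2.1, (hv y).1, (hv y).2.2.2, (hv y).2.2.1⟩⟩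
  · push Not at hA
    obtain ⟨e, he⟩ := hA
    exact h.exists_isCentral_of_parallel hV hu0 hu he

end IsPencil

/-! ### A common flag and simultaneous triangular form. -/

/-- The multiplication table, in the basis `e`, of a product `A` that is strictly triangular with
respect to the flag `⟨e 2⟩ ⊂ ⟨e 1, e 2⟩ ⊂ V`. -/
structure IsTriangular {V : Type*} [AddCommGroup V] [Module ℝ V] (e : Module.Basis (Fin 3) ℝ V)
    (A : V →ₗ[ℝ] V →ₗ[ℝ] V) (s t p q r : ℝ) : Prop where
  h00 : A (e 0) (e 0) = s • e 1 + t • e 2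
  h01 : A (e 0) (e 1) = p • e 2
  h10 : A (e 1) (e 0) = q • e 2
  h11 : A (e 1) (e 1) = r • e 2
  right : ∀ x, A x (e 2) = 0
  left : ∀ x, A (e 2) x = 0

theorem IsTriangular.mix {V : Type*} [AddCommGroup V] [Module ℝ V]
    {e : Module.Basis (Fin 3) ℝ V} {A B : V →ₗ[ℝ] V →ₗ[ℝ] V} {s t p q r s' t' p' q' r' : ℝ}
    (hA : IsTriangular e A s t p q r) (hB : IsTriangular e B s' t' p' q' r') (a b : ℝ) :
    IsTriangular e (a • A + b • B) (a * s + b * s') (a * t + b * t') (a * p + b * p')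
      (a * q + b * q') (a * r + b * r') where
  h00 := by
    simp only [LinearMap.add_apply, LinearMap.smul_apply, hA.h00, hB.h00]
    module
  h01 := by
    simp only [LinearMap.add_apply, LinearMap.smul_apply, hA.h01, hB.h01]
    module
  h10 := by
    simp only [LinearMap.add_apply, LinearMap.smul_apply, hA.h10, hB.h10]
    module
  h11 := by
    simp only [LinearMap.add_apply, LinearMap.smul_apply, hA.h11, hB.h11]
    module
  right x := by simp [hA.right, hB.right]
  left x := by simp [hA.left, hB.left]

section Flag

variable {V : Type*} [AddCommGroup V] [Module ℝ V]

/-- `T` is strictly triangular with respect to the flag `⟨b 0⟩ ⊂ ⟨b 0, b 1⟩ ⊂ V`, given that it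
kills `b 0`. -/
def PreservesFlag (b : Module.Basis (Fin 3) ℝ V) (T : V →ₗ[ℝ] V) : Prop :=
  b.repr (T (b 1)) 1 = 0 ∧ b.repr (T (b 1)) 2 = 0 ∧ b.repr (T (b 2)) 2 = 0

theorem PreservesFlag.sub {b : Module.Basis (Fin 3) ℝ V} {S T : V →ₗ[ℝ] V}
    (hS : PreservesFlag b S) (hT : PreservesFlag b T) : PreservesFlag b (S - T) := by
  obtain ⟨h1, h2, h3⟩ := hS
  obtain ⟨h4, h5, h6⟩ := hT
  exact ⟨by simp [h1, h4], by simp [h2, h5], by simp [h3, h6]⟩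

/-- On V / ⟨b 0⟩ the map S is a single non-zero off-diagonal entry. Comparing tr T² = 0 with tr (S +
T)² = 0 gives tr (ST) = 0, which kills the opposite entry of T; then tr T = 0 and tr T² = 0 kill the
diagonal. -/
theorem PreservesFlag.of_nilpotent {b : Module.Basis (Fin 3) ℝ V} {S T : V →ₗ[ℝ] V}
    (hS : PreservesFlag b S) (hS0 : S (b 0) = 0) (hT0 : T (b 0) = 0)
    (h21 : b.repr (S (b 2)) 1 ≠ 0) (hT : IsNilpotent T) (hST : IsNilpotent (S + T)) :
    PreservesFlag b T := by
  obtain ⟨h1, h2, h3⟩ := hS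
  have t1 := trace_three_of_isNilpotent hT b
  have t2 := trace_sq_three_of_isNilpotent hT b
  have t3 := trace_sq_three_of_isNilpotent hST b
  simp only [LinearMap.add_apply, hS0, hT0, add_zero, map_add, map_zero] at t1 t2 t3
  have eS1 := b.three_expand (S (b 1))
  have eS2 := b.three_expand (S (b 2))
  have eT1 := b.three_expand (T (b 1))
  have eT2 := b.three_expand (T (b 2))
  rw [h1, h2] at eS1
  rw [h3] at eS2
  simp only [zero_smul, add_zero] at eS1 eS2
  rw [eT1, eT2] at t2
  rw [eT1, eT2, eS1, eS2] at t3
  simp only [map_add, map_smul, hS0, hT0, smul_zero, zero_add, Finsupp.add_apply,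
    Finsupp.smul_apply, smul_eq_mul, map_zero, Finsupp.zero_apply, h1, h2, h3] at t1 t2 t3
  set x := b.repr (T (b 1)) 1 with hxd
  set y := b.repr (T (b 1)) 2 with hyd
  set z := b.repr (T (b 2)) 1
  set w := b.repr (T (b 2)) 2 with hwd
  have hy : y = 0 := by
    have : b.repr (S (b 2)) 1 * y = 0 := by linarith
    exact (mul_eq_zero.mp this).resolve_left h21
  have hx : x = 0 := by
    have hw : w = -x := by linarith
    rw [hy, hw] at t2
    have : x ^ 2 = 0 := by linarith
    exact pow_eq_zero_iff two_ne_zero |>.mp this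
  exact ⟨hx, hy, by linarith⟩

end Flag

namespace IsPencil

variable {V g : Type*} [AddCommGroup V] [Module ℝ V] [LieRing g] [LieAlgebra ℝ g]
  {i j : V →ₗ[ℝ] g} {A B : V →ₗ[ℝ] V →ₗ[ℝ] V}

theorem nilpotent_comb (h : IsPencil i j A B) [LieRing.IsNilpotent g] (s t : ℝ) (x : V) :
    IsNilpotent (s • A x + t • B x) := by
  by_cases hs : s = 0
  · by_cases ht : t = 0
    · rw [hs, ht]; simp
    · have := (h.mix (s := 0) (t := t) (s' := 1) (t' := 1) (by simpa using ht)).nilpotent_left x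
      simpa [hs] using this
  · have := (h.mix (s := s) (t := t) (s' := 0) (t' := 1) (by simpa using hs)).nilpotent_left x
    simpa using this

/-- A left multiplication that is non-zero on V / ⟨u⟩ determines the flag. The others preserve it
because sums within the pencil are again nilpotent. -/
theorem preservesFlag_of_not_mem_span (h : IsPencil i j A B) [LieRing.IsNilpotent g]
    (hV : Module.finrank ℝ V = 3) {u : V} (hu0 : u ≠ 0) (hu : IsCentral A B u) {x₀ e : V}
    (he : A x₀ e ∉ Submodule.span ℝ {u}) :
    ∃ b : Module.Basis (Fin 3) ℝ V, b 0 = u ∧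
      ∀ x, PreservesFlag b (A x) ∧ PreservesFlag b (B x) := by
  obtain ⟨b, hb0, hb1, hb2, c, hc⟩ := exists_flag_basis hV (h.nilpotent_left x₀) hu0 (hu x₀).1 he
  have h0 : PreservesFlag b (A x₀) := by
    refine ⟨?_, ?_, ?_⟩
    · rw [hb1, hc, ← hb0]; simp
    · rw [hb1, hc, ← hb0]; simp
    · rw [hb2, ← hb1]; simp
  have h021 : b.repr (A x₀ (b 2)) 1 ≠ 0 := by rw [hb2, ← hb1]; simp
  have kA : ∀ x, A x (b 0) = 0 := fun x => by rw [hb0]; exact (hu x).1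
  have kB : ∀ x, B x (b 0) = 0 := fun x => by rw [hb0]; exact (hu x).2.1
  have hA : ∀ x, PreservesFlag b (A x) := fun x =>
    h0.of_nilpotent (kA _) (kA _) h021 (h.nilpotent_left x) (by
      rw [← map_add]; exact h.nilpotent_left _)
  have hB' : ∀ x, b.repr (A x (b 2)) 1 ≠ 0 → PreservesFlag b (B x) := fun x hx =>
    (hA x).of_nilpotent (kA _) (kB _) hx (h.swap.nilpotent_left x) (by
      simpa using h.nilpotent_comb 1 1 x)
  refine ⟨b, hb0, fun x => ⟨hA x, ?_⟩⟩
  -- When A x cannot serve as the comparison map, write B x = B (x + x₀) - B x₀, where both terms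
  -- are covered.
  by_cases hx : b.repr (A x (b 2)) 1 = 0
  · have h1 := (hB' (x + x₀) (by simpa [hx] using h021)).sub (hB' x₀ h021)
    simpa using h1
  · exact hB' x hx

theorem exists_preservesFlag (h : IsPencil i j A B) [LieRing.IsNilpotent g]
    (hV : Module.finrank ℝ V = 3) {u : V} (hu0 : u ≠ 0) (hu : IsCentral A B u) :
    ∃ b : Module.Basis (Fin 3) ℝ V, b 0 = u ∧
      ∀ x, PreservesFlag b (A x) ∧ PreservesFlag b (B x) := by
  by_cases hA : ∃ x e, A x e ∉ Submodule.span ℝ {u}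
  · obtain ⟨x₀, e, he⟩ := hA
    exact h.preservesFlag_of_not_mem_span hV hu0 hu he
  by_cases hB : ∃ x e, B x e ∉ Submodule.span ℝ {u}
  · obtain ⟨x₀, e, he⟩ := hB
    obtain ⟨b, hb0, hb⟩ := h.swap.preservesFlag_of_not_mem_span hV hu0
      (fun y => ⟨(hu y).2.1, (hu y).1, (hu y).2.2.2, (hu y).2.2.1⟩) he
    exact ⟨b, hb0, fun x => (hb x).symm⟩
  push Not at hA hB
  have : Module.Finite ℝ V := Module.finite_of_finrank_eq_succ hV
  have h1 : LinearIndependent ℝ ![u] := by rw [linearIndependent_unique_iff]; exact hu0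
  obtain ⟨w, hw⟩ := exists_linearIndependent_cons_of_lt_finrank h1 (by rw [hV]; norm_num)
  have hli : LinearIndependent ℝ ![w, u] := hw
  obtain ⟨b, hb0, hb1⟩ := exists_basis_three_of_pair hV (LinearIndependent.pair_symm_iff.mp hli)
  have key : ∀ y k, k ≠ 0 → y ∈ Submodule.span ℝ {u} → b.repr y k = 0 := by
    intro y k hk hy
    obtain ⟨c, rfl⟩ := Submodule.mem_span_singleton.mp hy
    rw [← hb0]
    simp [hk.symm]
  refine ⟨b, hb0, fun x => ⟨⟨?_, ?_, ?_⟩, ⟨?_, ?_, ?_⟩⟩⟩ <;> apply key _ _ (by decide) <;>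
    first | apply hA | apply hB

/-- The flag makes left multiplications triangular. What remains is that the product of the middle
vector with the top one stays in the bottom line, and this follows from nilpotency of the commutator
map of the top vector. -/
theorem exists_isTriangular (h : IsPencil i j A B) [LieRing.IsNilpotent g]
    (hV : Module.finrank ℝ V = 3) :
    ∃ (e : Module.Basis (Fin 3) ℝ V) (s t p q r s' t' p' q' r' : ℝ),
      IsTriangular e A s t p q r ∧ IsTriangular e B s' t' p' q' r' := by
  obtain ⟨u, hu0, hu⟩ := h.exists_isCentral hV
  obtain ⟨b, hb0, hb⟩ := h.exists_preservesFlag hV hu0 hu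
  have key : ∀ C : V →ₗ[ℝ] V →ₗ[ℝ] V, (∀ x, PreservesFlag b (C x)) → (∀ x, C x u = 0) →
      (∀ x, C u x = 0) → (∀ x, IsNilpotent (C x - C.flip x)) →
      -- The flag basis starts at the central vector, the triangular basis ends there.
      ∃ s t p q r : ℝ, IsTriangular (b.reindex Fin.revPerm) C s t p q r := by
    intro C hC h1 h2 hn
    have e1 : ∀ x, C x (b 1) = b.repr (C x (b 1)) 0 • b 0 := by
      intro x
      conv_lhs => rw [b.three_expand (C x (b 1)), (hC x).1, (hC x).2.1]
      simp
    have e2 : ∀ x, C x (b 2) = b.repr (C x (b 2)) 1 • b 1 + b.repr (C x (b 2)) 0 • b 0 := by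
      intro x
      conv_lhs => rw [b.three_expand (C x (b 2)), (hC x).2.2]
      module
    have e3 : (C (b 2) - C.flip (b 2)) (b 1) = (-b.repr (C (b 1) (b 2)) 1) • b 1 +
        (b.repr (C (b 2) (b 1)) 0 - b.repr (C (b 1) (b 2)) 0) • b 0 := by
      rw [LinearMap.sub_apply, LinearMap.flip_apply]
      conv_lhs => rw [e1 (b 2), e2 (b 1)]
      module
    have e4 := coeff_eq_zero_of_isNilpotent (hn (b 2)) (by simp [hb0, h1, h2]) e3
      (b.notMem_span_smul (by decide) _)
    have e5 : C (b 1) (b 2) = b.repr (C (b 1) (b 2)) 0 • b 0 := by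
      conv_lhs => rw [e2 (b 1), neg_eq_zero.mp e4]
      simp
    refine ⟨b.repr (C (b 2) (b 2)) 1, b.repr (C (b 2) (b 2)) 0, b.repr (C (b 2) (b 1)) 0,
      b.repr (C (b 1) (b 2)) 0, b.repr (C (b 1) (b 1)) 0, ?_, ?_, ?_, ?_, ?_, ?_⟩
    · simpa [Fin.rev] using e2 (b 2)
    · simpa [Fin.rev] using e1 (b 2)
    · simpa [Fin.rev] using e5
    · simpa [Fin.rev] using e1 (b 1)
    · intro x; simpa [Fin.rev, hb0] using h1 x
    · intro x; simpa [Fin.rev, hb0] using h2 x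
  obtain ⟨s, t, p, q, r, hA⟩ := key A (fun x => (hb x).1) (fun x => (hu x).1)
    (fun x => (hu x).2.2.1) h.nilpotent_ad
  obtain ⟨s', t', p', q', r', hB⟩ := key B (fun x => (hb x).2) (fun x => (hu x).2.1)
    (fun x => (hu x).2.2.2) h.swap.nilpotent_ad
  exact ⟨_, s, t, p, q, r, s', t', p', q', r', hA, hB⟩

/-- Left-symmetry at e₀, e₁, e₀ has only one surviving term, A e₁ (A e₀ e₀) = s r e₂. -/
theorem mul_eq_zero_of_isTriangular (h : IsPencil i j A B) {e : Module.Basis (Fin 3) ℝ V}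
    {s t p q r : ℝ} (hA : IsTriangular e A s t p q r) : s * r = 0 := by
  have h1 := h.left_symm (e 0) (e 1) (e 0)
  simp only [hA.h00, hA.h01, hA.h10, hA.h11, map_sub, map_smul, map_add, hA.right,
    LinearMap.sub_apply, LinearMap.smul_apply, hA.left] at h1
  have := congrArg (fun x => e.repr x 2) h1
  simpa using this

/-- The relation s r = 0 for A, B and A + B says that two linear forms on ℝ² have product zero,
hence one of them is zero. -/
theorem forms_eq_zero_of_isTriangular (h : IsPencil i j A B) {e : Module.Basis (Fin 3) ℝ V}
    {s t p q r s' t' p' q' r' : ℝ} (hA : IsTriangular e A s t p q r)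
    (hB : IsTriangular e B s' t' p' q' r') : (s = 0 ∧ s' = 0) ∨ (r = 0 ∧ r' = 0) := by
  have h1 := h.mul_eq_zero_of_isTriangular hA
  have h2 := h.swap.mul_eq_zero_of_isTriangular hB
  have h3 := (h.mix (s := 1) (t := 1) (s' := 0) (t' := 1)
    (by norm_num)).mul_eq_zero_of_isTriangular (hA.mix hB 1 1)
  grind

end IsPencil

/-! ### The two subalgebras, and the complex product structure of a pencil. -/

theorem not_isAbelianThree_of_isHeisenbergThree {k : Type*} [LieRing k] [LieAlgebra ℝ k]
    (h : IsHeisenbergThree k) : ¬ IsAbelianThree k := by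
  rintro ⟨-, hab⟩
  obtain ⟨e, he, -, -⟩ := h
  rw [hab] at he
  exact e.ne_zero 2 he.symm

namespace IsPencil

variable {V g : Type*} [AddCommGroup V] [Module ℝ V] [LieRing g] [LieAlgebra ℝ g]
  {i j : V →ₗ[ℝ] g} {A B : V →ₗ[ℝ] V →ₗ[ℝ] V}

section Types

variable {K : LieSubalgebra ℝ g}

/-- The identification of `V` with the subalgebra `i V`. -/
noncomputable def equivRange (h : IsPencil i j A B) (hK : ∀ z, z ∈ K ↔ ∃ x, i x = z) : V ≃ₗ[ℝ] K :=
  LinearEquiv.ofBijective (i.codRestrict K.toSubmodule fun x => (hK _).mpr ⟨x, rfl⟩)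
    ⟨fun _ _ hxy => h.injective_left (congrArg Subtype.val hxy), fun z => by
      obtain ⟨x, hx⟩ := (hK z).mp z.2
      exact ⟨x, Subtype.ext hx⟩⟩

theorem coe_equivRange (h : IsPencil i j A B) (hK : ∀ z, z ∈ K ↔ ∃ x, i x = z) (x : V) :
    (h.equivRange hK x : g) = i x := rfl

theorem lie_equivRange (h : IsPencil i j A B) (hK : ∀ z, z ∈ K ↔ ∃ x, i x = z) (x y : V) :
    ⁅h.equivRange hK x, h.equivRange hK y⁆ = h.equivRange hK (A x y - A y x) := by
  apply Subtype.ext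
  rw [LieSubalgebra.coe_bracket, coe_equivRange, coe_equivRange, coe_equivRange, h.lie_ii]

theorem isAbelianThree_iff (h : IsPencil i j A B) (hV : Module.finrank ℝ V = 3)
    (hK : ∀ z, z ∈ K ↔ ∃ x, i x = z) : IsAbelianThree K ↔ ∀ x y, A x y = A y x := by
  constructor
  · rintro ⟨-, hab⟩ x y
    have h1 := h.lie_equivRange hK x y
    rw [hab, eq_comm, LinearEquiv.map_eq_zero_iff, sub_eq_zero] at h1
    exact h1
  · intro hs
    refine ⟨(h.equivRange hK).finrank_eq.symm.trans hV, fun x y => ?_⟩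
    obtain ⟨x, rfl⟩ := (h.equivRange hK).surjective x
    obtain ⟨y, rfl⟩ := (h.equivRange hK).surjective y
    rw [h.lie_equivRange, hs x y, sub_self, map_zero]

theorem isHeisenbergThree (h : IsPencil i j A B) (hK : ∀ z, z ∈ K ↔ ∃ x, i x = z)
    {e : Module.Basis (Fin 3) ℝ V} {s t p q r : ℝ} (hA : IsTriangular e A s t p q r)
    (hpq : p ≠ q) : IsHeisenbergThree K := by
  -- The bracket [e₀, e₁] is (p - q) e₂, so only the last basis vector is rescaled.
  have hu : ∀ k, IsUnit ((![1, 1, p - q] : Fin 3 → ℝ) k) := by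
    intro k
    fin_cases k
    · simp
    · simp
    · simpa [sub_eq_zero] using hpq
  refine ⟨(e.isUnitSMul hu).map (h.equivRange hK), ?_, ?_, ?_⟩
  · simp only [Module.Basis.map_apply, Module.Basis.isUnitSMul_apply, h.lie_equivRange]
    simp [hA.h01, hA.h10, ← sub_smul]
  · simp only [Module.Basis.map_apply, Module.Basis.isUnitSMul_apply, h.lie_equivRange]
    simp [hA.right, hA.left]
  · simp only [Module.Basis.map_apply, Module.Basis.isUnitSMul_apply, h.lie_equivRange]
    simp [hA.right, hA.left]

end Types

theorem mem_plus_iff (h : IsPencil i j A B) {E : g →ₗ[ℝ] g} (hE : IsProductStructure E)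
    (hi : ∀ x, E (i x) = i x) (hj : ∀ x, E (j x) = -j x) (z : g) :
    z ∈ hE.plus ↔ ∃ x, i x = z := by
  constructor
  · intro hz
    obtain ⟨x, y, rfl⟩ := h.surj z
    have hz : E (i x + j y) = i x + j y := hz
    rw [map_add, hi, hj, add_right_inj] at hz
    have h2 : (2 : ℝ) • j y = 0 := by
      rw [two_smul]
      nth_rewrite 1 [← hz]
      exact neg_add_cancel _
    have h3 := (smul_eq_zero.mp h2).resolve_left two_ne_zero
    exact ⟨x, by rw [h3, add_zero]⟩
  · rintro ⟨x, rfl⟩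
    exact hi x

theorem mem_minus_iff (h : IsPencil i j A B) {E : g →ₗ[ℝ] g} (hE : IsProductStructure E)
    (hi : ∀ x, E (i x) = i x) (hj : ∀ x, E (j x) = -j x) (z : g) :
    z ∈ hE.minus ↔ ∃ x, j x = z := by
  constructor
  · intro hz
    obtain ⟨x, y, rfl⟩ := h.surj z
    have hz : E (i x + j y) = -(i x + j y) := hz
    rw [map_add, hi, hj, neg_add, add_left_inj] at hz
    have h2 : (2 : ℝ) • i x = 0 := by
      rw [two_smul]
      nth_rewrite 1 [hz]
      exact neg_add_cancel _
    have h3 := (smul_eq_zero.mp h2).resolve_left two_ne_zero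
    exact ⟨y, by rw [h3, zero_add]⟩
  · rintro ⟨x, rfl⟩
    exact hj x

/-- The complex structure `i x + j y ↦ j x - i y` of a pencil. -/
noncomputable def complexEnd (h : IsPencil i j A B) : g →ₗ[ℝ] g :=
  (j.coprod (-i)) ∘ₗ h.equiv.symm.toLinearMap

/-- The product structure `i x + j y ↦ i x - j y` of a pencil. -/
noncomputable def productEnd (h : IsPencil i j A B) : g →ₗ[ℝ] g :=
  (i.coprod (-j)) ∘ₗ h.equiv.symm.toLinearMap

theorem symm_apply (h : IsPencil i j A B) (x y : V) : h.equiv.symm (i x + j y) = (x, y) := by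
  rw [LinearEquiv.symm_apply_eq, h.equiv_apply]

theorem complexEnd_apply (h : IsPencil i j A B) (x y : V) :
    h.complexEnd (i x + j y) = j x - i y := by
  simp [complexEnd, h.symm_apply, sub_eq_add_neg]

theorem productEnd_apply (h : IsPencil i j A B) (x y : V) :
    h.productEnd (i x + j y) = i x - j y := by
  simp [productEnd, h.symm_apply, sub_eq_add_neg]

theorem complexEnd_left (h : IsPencil i j A B) (x : V) : h.complexEnd (i x) = j x := by
  simpa using h.complexEnd_apply x 0

theorem complexEnd_right (h : IsPencil i j A B) (x : V) : h.complexEnd (j x) = -i x := by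
  simpa using h.complexEnd_apply 0 x

theorem productEnd_left (h : IsPencil i j A B) (x : V) : h.productEnd (i x) = i x := by
  simpa using h.productEnd_apply x 0

theorem productEnd_right (h : IsPencil i j A B) (x : V) : h.productEnd (j x) = -j x := by
  simpa using h.productEnd_apply 0 x

theorem isComplexProductStructure (h : IsPencil i j A B) [Nontrivial V] :
    IsComplexProductStructure h.complexEnd h.productEnd where
  complex :=
    { sq := fun z => by
        obtain ⟨x, y, rfl⟩ := h.surj z
        simp only [map_add, map_neg, h.complexEnd_left, h.complexEnd_right]
        abel
      integrable := fun z z' => by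
        obtain ⟨x, y, rfl⟩ := h.surj z
        obtain ⟨x', y', rfl⟩ := h.surj z'
        simp only [map_add, map_neg, map_sub, h.complexEnd_left, h.complexEnd_right, add_lie,
          lie_add, neg_lie, lie_neg, h.lie_ii, h.lie_jj, h.lie_ij, h.lie_ji]
        abel }
  product :=
    { sq := fun z => by
        obtain ⟨x, y, rfl⟩ := h.surj z
        simp only [map_add, map_neg, h.productEnd_left, h.productEnd_right, neg_neg]
      ne_id := by
        intro he
        obtain ⟨x, hx⟩ := exists_ne (0 : V)
        have h1 := h.productEnd_right x
        rw [he, LinearMap.id_apply, eq_neg_iff_add_eq_zero, ← two_smul ℝ, smul_eq_zero] at h1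
        exact hx (h.swap.injective_left (by
          rw [h1.resolve_left two_ne_zero, map_zero]))
      ne_neg_id := by
        intro he
        obtain ⟨x, hx⟩ := exists_ne (0 : V)
        have h1 := h.productEnd_left x
        rw [he, LinearMap.neg_apply, LinearMap.id_apply, neg_eq_iff_add_eq_zero, ← two_smul ℝ,
          smul_eq_zero] at h1
        exact hx (h.injective_left (by rw [h1.resolve_left two_ne_zero, map_zero]))
      integrable := fun z z' => by
        obtain ⟨x, y, rfl⟩ := h.surj z
        obtain ⟨x', y', rfl⟩ := h.surj z'
        simp only [map_add, map_neg, map_sub, h.productEnd_left, h.productEnd_right, add_lie,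
          lie_add, neg_lie, lie_neg, h.lie_ii, h.lie_jj, h.lie_ij, h.lie_ji]
        abel }
  anticomm z := by
    obtain ⟨x, y, rfl⟩ := h.surj z
    simp only [map_add, map_neg, h.productEnd_left, h.productEnd_right, h.complexEnd_left,
      h.complexEnd_right]
    abel

theorem admitsCPSOfType_RR (h : IsPencil i j A B) (hV : Module.finrank ℝ V = 3)
    (hA : ∀ x y, A x y = A y x) (hB : ∀ x y, B x y = B y x) : AdmitsCPSOfType g .RR := by
  have : Nontrivial V := Module.nontrivial_of_finrank_pos (R := ℝ) (by rw [hV]; norm_num)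
  have hs := h.isComplexProductStructure
  exact ⟨_, _, hs,
    (h.isAbelianThree_iff hV (h.mem_plus_iff hs.product h.productEnd_left h.productEnd_right)).mpr
      hA,
    (h.swap.isAbelianThree_iff hV
      (h.mem_minus_iff hs.product h.productEnd_left h.productEnd_right)).mpr hB⟩

theorem admitsCPSOfType_HR (h : IsPencil i j A B) {e : Module.Basis (Fin 3) ℝ V}
    {s t p q r : ℝ} (hA : IsTriangular e A s t p q r) (hpq : p ≠ q)
    (hB : ∀ x y, B x y = B y x) : AdmitsCPSOfType g .HR := by
  have hV : Module.finrank ℝ V = 3 := by simp [Module.finrank_eq_card_basis e]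
  have : Nontrivial V := Module.nontrivial_of_finrank_pos (R := ℝ) (by rw [hV]; norm_num)
  have hs := h.isComplexProductStructure
  exact ⟨_, _, hs, Or.inl
    ⟨h.isHeisenbergThree (h.mem_plus_iff hs.product h.productEnd_left h.productEnd_right) hA hpq,
    (h.swap.isAbelianThree_iff hV
      (h.mem_minus_iff hs.product h.productEnd_left h.productEnd_right)).mpr hB⟩⟩

theorem admitsCPSOfType_HH (h : IsPencil i j A B) {e : Module.Basis (Fin 3) ℝ V}
    {s t p q r s' t' p' q' r' : ℝ} (hA : IsTriangular e A s t p q r) (hpq : p ≠ q)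
    (hB : IsTriangular e B s' t' p' q' r') (hpq' : p' ≠ q') : AdmitsCPSOfType g .HH := by
  have hV : Module.finrank ℝ V = 3 := by simp [Module.finrank_eq_card_basis e]
  have : Nontrivial V := Module.nontrivial_of_finrank_pos (R := ℝ) (by rw [hV]; norm_num)
  have hs := h.isComplexProductStructure
  exact ⟨_, _, hs,
    h.isHeisenbergThree (h.mem_plus_iff hs.product h.productEnd_left h.productEnd_right) hA hpq,
    h.swap.isHeisenbergThree (h.mem_minus_iff hs.product h.productEnd_left h.productEnd_right)
      hB hpq'⟩

end IsPencil

/-! ### The pencil of a complex product structure. -/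

namespace IsComplexProductStructure

variable {g : Type*} [LieRing g] [LieAlgebra ℝ g] {J E : g →ₗ[ℝ] g}

theorem proj_mem (h : IsComplexProductStructure J E) (z : g) :
    (1 / 2 : ℝ) • (z + E z) ∈ h.product.plus := by
  change E _ = _
  rw [map_smul, map_add, h.product.sq, add_comm]

/-- The projection onto `g₊` along `g₋`. -/
noncomputable def proj (h : IsComplexProductStructure J E) : g →ₗ[ℝ] h.product.plus :=
  LinearMap.codRestrict h.product.plus.toSubmodule ((1 / 2 : ℝ) • (LinearMap.id + E)) h.proj_mem

theorem coe_proj (h : IsComplexProductStructure J E) (z : g) :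
    (h.proj z : g) = (1 / 2 : ℝ) • (z + E z) := rfl

/-- The inclusion of `g₊` into `g`. -/
def incl (h : IsComplexProductStructure J E) : h.product.plus →ₗ[ℝ] g :=
  h.product.plus.toSubmodule.subtype

theorem E_incl (h : IsComplexProductStructure J E) (x : h.product.plus) :
    E (h.incl x) = h.incl x := x.2

theorem E_J_incl (h : IsComplexProductStructure J E) (x : h.product.plus) :
    E (J (h.incl x)) = -J (h.incl x) := by
  rw [← neg_eq_iff_eq_neg, ← h.anticomm, h.E_incl]

theorem decompose (h : IsComplexProductStructure J E) (z : g) :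
    h.incl (h.proj z) + J (h.incl (-h.proj (J z))) = z := by
  have h1 : ∀ z, h.incl (h.proj z) = (1 / 2 : ℝ) • (z + E z) := h.coe_proj
  have h2 : E (J z) = -J (E z) := by rw [h.anticomm, neg_neg]
  rw [map_neg, h1, h1, map_neg, map_smul, map_add, h.complex.sq, h2, map_neg, h.complex.sq]
  module

/-- The product `x, y ↦ ∇ₓ y` on `g₊`. -/
noncomputable def prodPlus (h : IsComplexProductStructure J E) :
    h.product.plus →ₗ[ℝ] h.product.plus →ₗ[ℝ] h.product.plus :=
  LinearMap.mk₂ ℝ (fun x y => -h.proj (J ⁅h.incl x, J (h.incl y)⁆))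
    (by intros; simp only [map_add, add_lie, neg_add])
    (by intros; simp only [map_smul, smul_lie, smul_neg])
    (by intros; simp only [map_add, lie_add, neg_add])
    (by intros; simp only [map_smul, lie_smul, smul_neg])

/-- The product `x, y ↦ ∇_{Jx} y` on `g₊`. -/
noncomputable def prodMinus (h : IsComplexProductStructure J E) :
    h.product.plus →ₗ[ℝ] h.product.plus →ₗ[ℝ] h.product.plus :=
  LinearMap.mk₂ ℝ (fun x y => -h.proj ⁅h.incl y, J (h.incl x)⁆)
    (by intros; simp only [map_add, lie_add, neg_add])
    (by intros; simp only [map_smul, lie_smul, smul_neg])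
    (by intros; simp only [map_add, add_lie, neg_add])
    (by intros; simp only [map_smul, smul_lie, smul_neg])

theorem proj_incl (h : IsComplexProductStructure J E) (x : h.product.plus) :
    h.proj (h.incl x) = x := by
  apply Subtype.ext
  rw [h.coe_proj, h.E_incl, ← two_smul ℝ, smul_smul]
  norm_num
  rfl

theorem proj_eq_zero (h : IsComplexProductStructure J E) {z : g} (hz : E z = -z) :
    h.proj z = 0 := by
  apply Subtype.ext
  rw [h.coe_proj, hz]
  simp

/-- The mixed bracket has the required form by the definition of the two products, as the two
components of [x, Jy]. Since g₊ and g₋ are subalgebras, the other two brackets are the two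
components of the integrability of J. -/
theorem isPencil (h : IsComplexProductStructure J E) :
    IsPencil h.incl (J ∘ₗ h.incl) h.prodPlus h.prodMinus := by
  have hb : ∀ x y : h.product.plus, ⁅h.incl x, h.incl y⁆ = h.incl ⁅x, y⁆ := fun x y => rfl
  have hm : ∀ x y : h.product.plus, E ⁅J (h.incl x), J (h.incl y)⁆ =
      -⁅J (h.incl x), J (h.incl y)⁆ := fun x y =>
    h.product.minus.lie_mem (h.E_J_incl x) (h.E_J_incl y)
  have hJm : ∀ z, E z = -z → h.incl (h.proj (J z)) = J z := by
    intro z hz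
    have h2 : E (J z) = J z := by rw [← neg_eq_iff_eq_neg.mpr (h.anticomm z), hz, map_neg, neg_neg]
    exact congrArg h.incl (h.proj_incl ⟨J z, h2⟩)
  have hskew : ∀ x y : h.product.plus, ⁅J (h.incl x), h.incl y⁆ = -⁅h.incl y, J (h.incl x)⁆ :=
    fun x y => (lie_skew _ _).symm
  refine ⟨fun x y hxy => ?_, fun z => ⟨_, _, h.decompose z⟩, fun x y => ?_, fun x y => ?_,
    fun x y => ?_⟩
  · have hx : x = 0 := by
      have h1 := congrArg h.proj hxy
      rw [map_add, h.proj_incl, LinearMap.comp_apply, h.proj_eq_zero (h.E_J_incl y), add_zero,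
        map_zero] at h1
      exact h1
    refine ⟨hx, ?_⟩
    rw [hx, map_zero, zero_add, LinearMap.comp_apply] at hxy
    have h1 := congrArg (fun z => -h.proj (J z)) hxy
    simp only [h.complex.sq, map_neg, h.proj_incl, neg_neg, map_zero, neg_zero] at h1
    exact h1
  · have h1 := congrArg (fun z => -h.proj (J z)) (h.complex.integrable (h.incl x) (h.incl y))
    simp only [map_add, h.complex.sq, map_neg, h.proj_eq_zero (hm x y), hskew, neg_neg] at h1
    rw [hb, h.proj_incl] at h1
    rw [hb, h1]
    simp only [prodPlus, LinearMap.mk₂_apply]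
    congr 1
    abel
  · have h1 := congrArg h.proj (h.complex.integrable (h.incl x) (h.incl y))
    rw [hb, h.proj_eq_zero (h.E_J_incl _)] at h1
    simp only [map_add, hskew, map_neg] at h1
    have h2 := congrArg (fun z => -J (h.incl z)) h1
    simp only [map_add, map_zero, neg_zero, map_neg, hJm _ (hm x y), h.complex.sq] at h2
    simp only [prodMinus, LinearMap.mk₂_apply, LinearMap.comp_apply, map_sub, map_neg]
    linear_combination (norm := module) -h2
  · simp only [prodPlus, prodMinus, LinearMap.mk₂_apply, LinearMap.comp_apply]
    conv_lhs => rw [← h.decompose ⁅h.incl x, J (h.incl y)⁆]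
    simp only [map_neg]
    abel

theorem finrank_plus (h : IsComplexProductStructure J E) (hg : Module.finrank ℝ g = 6) :
    Module.finrank ℝ h.product.plus = 3 := by
  have : Module.Finite ℝ g := Module.finite_of_finrank_eq_succ hg
  have : Module.Finite ℝ h.product.plus :=
    Module.Finite.of_injective h.incl h.isPencil.injective_left
  have h1 := h.isPencil.equiv.finrank_eq
  rw [Module.finrank_prod, hg] at h1
  omega

theorem mem_plus (h : IsComplexProductStructure J E) (z : g) :
    z ∈ h.product.plus ↔ ∃ x, h.incl x = z :=
  h.isPencil.mem_plus_iff h.product h.E_incl h.E_J_incl z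

theorem mem_minus (h : IsComplexProductStructure J E) (z : g) :
    z ∈ h.product.minus ↔ ∃ x, (J ∘ₗ h.incl) x = z :=
  h.isPencil.mem_minus_iff h.product h.E_incl h.E_J_incl z

/-- In a triangular basis the only bracket that can survive in iV is [e₀, e₁] = (p - q) e₂. This
dichotomy yields the three types. -/
theorem isAbelianThree_or_isHeisenbergThree {V : Type*} [AddCommGroup V] [Module ℝ V]
    {i j : V →ₗ[ℝ] g} {A B : V →ₗ[ℝ] V →ₗ[ℝ] V} (hp : IsPencil i j A B)
    {e : Module.Basis (Fin 3) ℝ V} {s t p q r : ℝ} (hA : IsTriangular e A s t p q r)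
    {K : LieSubalgebra ℝ g} (hK : ∀ z, z ∈ K ↔ ∃ x, i x = z) :
    (IsAbelianThree K ∧ p = q) ∨ (IsHeisenbergThree K ∧ p ≠ q) := by
  by_cases hpq : p = q
  · refine Or.inl ⟨(hp.isAbelianThree_iff (by simp [Module.finrank_eq_card_basis e]) hK).mpr ?_,
      hpq⟩
    suffices h : A = A.flip from fun x y => congrArg (fun f => f x y) h
    apply e.ext
    intro k
    apply e.ext
    intro l
    rw [LinearMap.flip_apply]
    fin_cases k <;> fin_cases l <;>
      simp [hA.h01, hA.h10, hA.right, hA.left, hpq]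
  · exact Or.inr ⟨hp.isHeisenbergThree hK hA hpq, hpq⟩

theorem exists_hasType (h : IsComplexProductStructure J E) [LieRing.IsNilpotent g]
    (hg : Module.finrank ℝ g = 6) : ∃ t : DoubleType, h.product.HasType t := by
  obtain ⟨e, s, t, p, q, r, s', t', p', q', r', hA, hB⟩ :=
    h.isPencil.exists_isTriangular (h.finrank_plus hg)
  rcases isAbelianThree_or_isHeisenbergThree h.isPencil hA h.mem_plus with ⟨h1, -⟩ | ⟨h1, -⟩ <;>
  rcases isAbelianThree_or_isHeisenbergThree h.isPencil.swap hB h.mem_minus with ⟨h2, -⟩ | ⟨h2, -⟩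
  · exact ⟨.RR, h1, h2⟩
  · exact ⟨.HR, Or.inr ⟨h1, h2⟩⟩
  · exact ⟨.HR, Or.inl ⟨h1, h2⟩⟩
  · exact ⟨.HH, h1, h2⟩

end IsComplexProductStructure

/-! ### Classification when s is not identically zero. -/

section Coordinates

variable {g : Type*} [LieRing g] [LieAlgebra ℝ g]

theorem ListedAlgebra.nonempty_lieEquiv {n : Fin 15} (Ψ : (Fin 6 → ℝ) ≃ₗ[ℝ] g)
    (h : ∀ X Y, ⁅Ψ X, Ψ Y⁆ = Ψ (fun k => -ListedAlgebra.dForm n k X Y)) :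
    Nonempty (g ≃ₗ⁅ℝ⁆ ListedAlgebra n) := by
  let f : ListedAlgebra n →ₗ[ℝ] g := Ψ.toLinearMap
  let F : ListedAlgebra n →ₗ⁅ℝ⁆ g := { f with map_lie' := fun {X Y} => (h X Y).symm }
  exact ⟨(LieEquiv.ofBijective F Ψ.bijective).symm⟩

/-- A Lie algebra with bracket `F` in the coordinates `Ψ` is isomorphic to the `n`-th listed
algebra if `F` takes the listed form after the change of coordinates `M`. -/
theorem ListedAlgebra.nonempty_lieEquiv_of_coord {n : Fin 15} {Ψ : (Fin 6 → ℝ) ≃ₗ[ℝ] g}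
    {F : (Fin 6 → ℝ) → (Fin 6 → ℝ) → Fin 6 → ℝ} (hΨ : ∀ X Y, ⁅Ψ X, Ψ Y⁆ = Ψ (F X Y))
    (M : Matrix (Fin 6) (Fin 6) ℝ) (hinj : ∀ X, M.mulVec X = 0 → X = 0)
    (hM : ∀ X Y k, M.mulVec (F X Y) k = -ListedAlgebra.dForm n k (M.mulVec X) (M.mulVec Y)) :
    Nonempty (g ≃ₗ⁅ℝ⁆ ListedAlgebra n) := by
  have hi : Function.Injective M.mulVecLin := by
    rw [← LinearMap.ker_eq_bot, LinearMap.ker_eq_bot']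
    exact hinj
  let S : (Fin 6 → ℝ) ≃ₗ[ℝ] (Fin 6 → ℝ) := LinearEquiv.ofInjectiveEndo M.mulVecLin hi
  have hS : ∀ X, S X = M.mulVec X := fun X => rfl
  apply ListedAlgebra.nonempty_lieEquiv (S.symm.trans Ψ)
  intro X Y
  obtain ⟨X, rfl⟩ := S.surjective X
  obtain ⟨Y, rfl⟩ := S.surjective Y
  simp only [LinearEquiv.trans_apply, LinearEquiv.symm_apply_apply]
  rw [hΨ]
  congr 1
  rw [LinearEquiv.eq_symm_apply]
  funext k
  rw [hS, hS, hS, hM]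

theorem eq_zero_of_det_ne_zero {a b c d x y : ℝ} (hd : a * d - b * c ≠ 0) (h1 : a * x + b * y = 0)
    (h2 : c * x + d * y = 0) : x = 0 ∧ y = 0 := by
  constructor
  · have : (a * d - b * c) * x = 0 := by linear_combination d * h1 - b * h2
    exact (mul_eq_zero.mp this).resolve_left hd
  · have : (a * d - b * c) * y = 0 := by linear_combination a * h2 - c * h1
    exact (mul_eq_zero.mp this).resolve_left hd

theorem sq_add_sq_ne_zero {a b : ℝ} (h : ¬ (a = 0 ∧ b = 0)) : a * a + b * b ≠ 0 := by
  intro h0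
  exact h (mul_self_add_mul_self_eq_zero.mp h0)

/-- The bracket, in coordinates, of an algebra with quotient `h₃ × ℝ`. -/
def extBracket (pa pb qa qb : ℝ) (X Y : Fin 6 → ℝ) : Fin 6 → ℝ :=
  ![0, 0, 0, -(X 0 * Y 1 - X 1 * Y 0),
    -(qb * (X 0 * Y 2 - X 2 * Y 0) - (pa - qa) * (X 0 * Y 3 - X 3 * Y 0)
      - pb * (X 1 * Y 3 - X 3 * Y 1)),
    -(-pa * (X 0 * Y 2 - X 2 * Y 0) - (pb - qb) * (X 1 * Y 2 - X 2 * Y 1)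
      + qa * (X 1 * Y 3 - X 3 * Y 1))]

theorem eq_zero_of_six {X : Fin 6 → ℝ} (h0 : X 0 = 0) (h1 : X 1 = 0) (h2 : X 2 = 0) (h3 : X 3 = 0)
    (h4 : X 4 = 0) (h5 : X 5 = 0) : X = 0 := by
  funext k
  fin_cases k
  exacts [h0, h1, h2, h3, h4, h5]

theorem six_eqns {f : Fin 6 → ℝ} (h : f = 0) :
    f 0 = 0 ∧ f 1 = 0 ∧ f 2 = 0 ∧ f 3 = 0 ∧ f 4 = 0 ∧ f 5 = 0 := by
  simp [h]

theorem forall_six {P : Fin 6 → Prop} (h0 : P 0) (h1 : P 1) (h2 : P 2) (h3 : P 3) (h4 : P 4)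
    (h5 : P 5) (k : Fin 6) : P k := by
  fin_cases k
  exacts [h0, h1, h2, h3, h4, h5]

/-- Equal pairs p and q. If they are non-zero, the fifth and sixth coordinates are rotated along
(pa, pb), and one of the two new coordinates becomes closed. -/
theorem classify_ext_of_eq {Ψ : (Fin 6 → ℝ) ≃ₗ[ℝ] g} {pa pb : ℝ}
    (hΨ : ∀ X Y, ⁅Ψ X, Ψ Y⁆ = Ψ (extBracket pa pb pa pb X Y)) :
    ∃ n, Nonempty (g ≃ₗ⁅ℝ⁆ ListedAlgebra n) := by
  by_cases hp : pa = 0 ∧ pb = 0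
  · obtain ⟨rfl, rfl⟩ := hp
    refine ⟨1, ListedAlgebra.nonempty_lieEquiv_of_coord hΨ
      !![1, 0, 0, 0, 0, 0; 0, 1, 0, 0, 0, 0; 0, 0, 1, 0, 0, 0; 0, 0, 0, 0, 1, 0;
        0, 0, 0, 0, 0, 1; 0, 0, 0, 1, 0, 0] (fun X hX => ?_) fun X Y => ?_⟩
    · obtain ⟨h0, h1, h2, h3, h4, h5⟩ := six_eqns hX
      simp [Matrix.mulVec, dotProduct, Fin.sum_univ_six] at h0 h1 h2 h3 h4 h5
      exact eq_zero_of_six h0 h1 h2 h5 h3 h4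
    · apply forall_six <;>
      simp [ListedAlgebra.dForm, differentials, wedge, label, extBracket, Matrix.mulVec, dotProduct,
        Fin.sum_univ_six]
  · have hn := sq_add_sq_ne_zero hp
    refine ⟨3, ListedAlgebra.nonempty_lieEquiv_of_coord hΨ
      !![pa * pa + pb * pb, 0, 0, 0, 0, 0; 0, 1, 0, 0, 0, 0; 0, 0, 0, 0, pa, pb;
        0, 0, -1, 0, 0, 0; 0, 0, 0, pa * pa + pb * pb, 0, 0; 0, 0, 0, 0, -pb, pa]
      (fun X hX => ?_) fun X Y => ?_⟩
    · obtain ⟨h0, h1, h2, h3, h4, h5⟩ := six_eqns hX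
      simp [Matrix.mulVec, dotProduct, Fin.sum_univ_six, hn] at h0 h1 h2 h3 h4 h5
      obtain ⟨h6, h7⟩ := eq_zero_of_det_ne_zero (by simpa using hn) h2
        (show -pb * X 4 + pa * X 5 = 0 by linarith)
      exact eq_zero_of_six h0 h1 h3 h4 h6 h7
    · apply forall_six <;>
      simp [ListedAlgebra.dForm, differentials, wedge, label, extBracket, Matrix.mulVec, dotProduct,
        Fin.sum_univ_six] <;> ring

end Coordinates

section Coordinates

variable {g : Type*} [LieRing g] [LieAlgebra ℝ g]

/-- Here and in the next lemmas the rows of the matrix are the new dual basis e¹, …, e⁶ in the old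
coordinates, chosen to satisfy the listed structure equations. -/
theorem ext_iso_nine {Ψ : (Fin 6 → ℝ) ≃ₗ[ℝ] g} {qb : ℝ} (hq : qb ≠ 0)
    (hΨ : ∀ X Y, ⁅Ψ X, Ψ Y⁆ = Ψ (extBracket 0 0 0 qb X Y)) :
    Nonempty (g ≃ₗ⁅ℝ⁆ ListedAlgebra 9) := by
  refine ListedAlgebra.nonempty_lieEquiv_of_coord hΨ
    !![1,0,0,0,0,0;
      0,1,0,0,0,0;
      0,0,qb,0,0,0;
      0,0,0,1,0,0;
      0,0,0,0,1,0;
      0,0,0,0,0,1]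
    (fun X hX => ?_) fun X Y => ?_
  · obtain ⟨h0, h1, h2, h3, h4, h5⟩ := six_eqns hX
    simp [Matrix.mulVec, dotProduct, Fin.sum_univ_six] at h0 h1 h2 h3 h4 h5
    exact eq_zero_of_six h0 h1 (h2.resolve_left hq) h3 h4 h5
  · apply forall_six <;>
    simp [ListedAlgebra.dForm, differentials, wedge, label, extBracket, Matrix.mulVec, dotProduct,
      Fin.sum_univ_six] <;> ring

theorem ext_iso_ten {Ψ : (Fin 6 → ℝ) ≃ₗ[ℝ] g} {qa qb : ℝ} (hq : qa ≠ 0)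
    (hΨ : ∀ X Y, ⁅Ψ X, Ψ Y⁆ = Ψ (extBracket 0 0 qa qb X Y)) :
    Nonempty (g ≃ₗ⁅ℝ⁆ ListedAlgebra 10) := by
  refine ListedAlgebra.nonempty_lieEquiv_of_coord hΨ
    !![qa,0,0,0,0,0;
      0,1,0,0,0,0;
      0,0,1,0,0,0;
      0,0,qb,qa,0,0;
      0,0,0,0,qa,0;
      0,0,0,0,0,1]
    (fun X hX => ?_) fun X Y => ?_
  · obtain ⟨h0, h1, h2, h3, h4, h5⟩ := six_eqns hX
    simp [Matrix.mulVec, dotProduct, Fin.sum_univ_six] at h0 h1 h2 h3 h4 h5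
    have h3' : X 3 = 0 := by simpa [h2, hq] using h3
    exact eq_zero_of_six (h0.resolve_left hq) h1 h2 h3' (h4.resolve_left hq) h5
  · apply forall_six <;>
    simp [ListedAlgebra.dForm, differentials, wedge, label, extBracket, Matrix.mulVec, dotProduct,
      Fin.sum_univ_six] <;> ring

theorem ext_iso_eight {Ψ : (Fin 6 → ℝ) ≃ₗ[ℝ] g} {pa pb : ℝ} (hp : ¬ (pa = 0 ∧ pb = 0))
    (hΨ : ∀ X Y, ⁅Ψ X, Ψ Y⁆ = Ψ (extBracket pa pb 0 0 X Y)) :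
    Nonempty (g ≃ₗ⁅ℝ⁆ ListedAlgebra 8) := by
  refine ListedAlgebra.nonempty_lieEquiv_of_coord hΨ
    !![pa,pb,0,0,0,0;
      -pb,pa,0,0,0,0;
      0,0,1,0,0,0;
      0,0,0,pa * pa + pb * pb,0,0;
      0,0,0,0,0,-1;
      0,0,0,0,-(pa * pa + pb * pb),0]
    (fun X hX => ?_) fun X Y => ?_
  · obtain ⟨h0, h1, h2, h3, h4, h5⟩ := six_eqns hX
    simp [Matrix.mulVec, dotProduct, Fin.sum_univ_six] at h0 h1 h2 h3 h4 h5
    have hn := sq_add_sq_ne_zero hp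
    obtain ⟨h6, h7⟩ := eq_zero_of_det_ne_zero (by simpa using hn) h0
      (show -pb * X 0 + pa * X 1 = 0 by linarith)
    exact eq_zero_of_six h6 h7 h2 (h3.resolve_left hn) (h5.resolve_left fun h => hn (by linarith)) h4
  · apply forall_six <;>
    simp [ListedAlgebra.dForm, differentials, wedge, label, extBracket, Matrix.mulVec, dotProduct,
      Fin.sum_univ_six] <;> ring

theorem ext_iso_thirteen {Ψ : (Fin 6 → ℝ) ≃ₗ[ℝ] g} {pb qb : ℝ} (hp : pb ≠ 0) (hq : qb ≠ 0)
    (hd : pb - qb ≠ 0)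
    (hΨ : ∀ X Y, ⁅Ψ X, Ψ Y⁆ = Ψ (extBracket 0 pb 0 qb X Y)) :
    Nonempty (g ≃ₗ⁅ℝ⁆ ListedAlgebra 13) := by
  refine ListedAlgebra.nonempty_lieEquiv_of_coord hΨ
    !![0,pb,0,0,0,0;
      1,0,0,0,0,0;
      0,0,pb * qb,0,0,0;
      0,0,0,-pb,0,0;
      0,0,0,0,0,-(pb ^ 2 * qb / (pb - qb));
      0,0,0,0,pb,0]
    (fun X hX => ?_) fun X Y => ?_
  · obtain ⟨h0, h1, h2, h3, h4, h5⟩ := six_eqns hX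
    simp [Matrix.mulVec, dotProduct, Fin.sum_univ_six] at h0 h1 h2 h3 h4 h5
    simp [hp, hq, hd] at h0 h1 h2 h3 h4 h5
    exact eq_zero_of_six h1 h0 h2 h3 h5 h4
  · apply forall_six <;>
    simp [ListedAlgebra.dForm, differentials, wedge, label, extBracket, Matrix.mulVec, dotProduct,
      Fin.sum_univ_six] <;> (try field_simp) <;> ring

theorem ext_iso_fourteen {Ψ : (Fin 6 → ℝ) ≃ₗ[ℝ] g} {pa pb m : ℝ} (hp : pa ≠ 0) (hm : m ≠ 0)
    (hd : 1 - m ≠ 0)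
    (hΨ : ∀ X Y, ⁅Ψ X, Ψ Y⁆ = Ψ (extBracket pa pb (m * pa) (m * pb) X Y)) :
    Nonempty (g ≃ₗ⁅ℝ⁆ ListedAlgebra 14) := by
  refine ListedAlgebra.nonempty_lieEquiv_of_coord hΨ
    !![pa,pb,0,0,0,0;
      0,1,0,0,0,0;
      0,0,1 / m,0,0,0;
      0,0,pb,pa,0,0;
      0,0,0,0,-(pa / (1 - m)),-(pb / (1 - m));
      0,0,0,0,0,-(1 / m)]
    (fun X hX => ?_) fun X Y => ?_
  · obtain ⟨h0, h1, h2, h3, h4, h5⟩ := six_eqns hX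
    simp [Matrix.mulVec, dotProduct, Fin.sum_univ_six] at h0 h1 h2 h3 h4 h5
    simp [hm] at h1 h2 h5
    have h0' : X 0 = 0 := by simpa [h1, hp] using h0
    have h3' : X 3 = 0 := by simpa [h2, hp] using h3
    have h4' : X 4 = 0 := by simpa [h5, hp, hd] using h4
    exact eq_zero_of_six h0' h1 h2 h3' h4' h5
  · apply forall_six <;>
    simp [ListedAlgebra.dForm, differentials, wedge, label, extBracket, Matrix.mulVec, dotProduct,
      Fin.sum_univ_six] <;> (try field_simp) <;> ring

theorem ext_iso_eleven {Ψ : (Fin 6 → ℝ) ≃ₗ[ℝ] g} {pa pb qb : ℝ} (hp : pa ≠ 0) (hq : qb ≠ 0)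
    (hΨ : ∀ X Y, ⁅Ψ X, Ψ Y⁆ = Ψ (extBracket pa pb 0 qb X Y)) :
    Nonempty (g ≃ₗ⁅ℝ⁆ ListedAlgebra 11) := by
  refine ListedAlgebra.nonempty_lieEquiv_of_coord hΨ
    !![pa,pb - qb,0,0,0,0;
      pa,pb,0,0,0,0;
      0,0,qb,0,0,0;
      0,0,qb * (pb - qb),qb * pa,0,0;
      0,0,0,0,0,-qb;
      0,0,0,0,-(qb * pa),-(qb * pb)]
    (fun X hX => ?_) fun X Y => ?_
  · obtain ⟨h0, h1, h2, h3, h4, h5⟩ := six_eqns hX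
    simp [Matrix.mulVec, dotProduct, Fin.sum_univ_six] at h0 h1 h2 h3 h4 h5
    simp [hq] at h2 h4
    obtain ⟨h6, h7⟩ := eq_zero_of_det_ne_zero (show pa * pb - (pb - qb) * pa ≠ 0 by
      ring_nf; exact mul_ne_zero hp hq) h0 h1
    have h3' : X 3 = 0 := by simpa [h2, hp, hq] using h3
    have h5' : X 4 = 0 := by simpa [h4, hp, hq] using h5
    exact eq_zero_of_six h6 h7 h2 h3' h5' h4
  · apply forall_six <;>
    simp [ListedAlgebra.dForm, differentials, wedge, label, extBracket, Matrix.mulVec, dotProduct,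
      Fin.sum_univ_six] <;> ring

theorem ext_iso_eleven' {Ψ : (Fin 6 → ℝ) ≃ₗ[ℝ] g} {pa pb qb : ℝ} (hp : pa ≠ 0) (hd : pb - qb ≠ 0)
    (hΨ : ∀ X Y, ⁅Ψ X, Ψ Y⁆ = Ψ (extBracket pa pb pa qb X Y)) :
    Nonempty (g ≃ₗ⁅ℝ⁆ ListedAlgebra 11) := by
  refine ListedAlgebra.nonempty_lieEquiv_of_coord hΨ
    !![pa,pb,0,0,0,0;
      0,pb - qb,0,0,0,0;
      0,0,pb - qb,0,0,0;
      0,0,(pb - qb) * qb,(pb - qb) * pa,0,0;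
      0,0,0,0,-pa,-pb;
      0,0,0,0,-((pb - qb) * pa),-((pb - qb) * qb)]
    (fun X hX => ?_) fun X Y => ?_
  · obtain ⟨h0, h1, h2, h3, h4, h5⟩ := six_eqns hX
    simp [Matrix.mulVec, dotProduct, Fin.sum_univ_six] at h0 h1 h2 h3 h4 h5
    simp [hd] at h1 h2
    have h0' : X 0 = 0 := by simpa [h1, hp] using h0
    have h3' : X 3 = 0 := by simpa [h2, hp, hd] using h3
    have h5' : (pb - qb) * (pa * X 4 + qb * X 5) = 0 := by linarith
    have h5'' := (mul_eq_zero.mp h5').resolve_left hd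
    obtain ⟨h6, h7⟩ := eq_zero_of_det_ne_zero (show pa * qb - pb * pa ≠ 0 by
      rw [show pa * qb - pb * pa = -(pa * (pb - qb)) by ring]
      exact neg_ne_zero.mpr (mul_ne_zero hp hd)) (show pa * X 4 + pb * X 5 = 0 by linarith) h5''
    exact eq_zero_of_six h0' h1 h2 h3' h6 h7
  · apply forall_six <;>
    simp [ListedAlgebra.dForm, differentials, wedge, label, extBracket, Matrix.mulVec, dotProduct,
      Fin.sum_univ_six] <;> ring

theorem ext_iso_twelve {Ψ : (Fin 6 → ℝ) ≃ₗ[ℝ] g} {pa pb qa qb : ℝ} (hq : qa ≠ 0) (hd : pa - qa ≠ 0)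
    (hD : pa * qb - qa * pb ≠ 0)
    (hΨ : ∀ X Y, ⁅Ψ X, Ψ Y⁆ = Ψ (extBracket pa pb qa qb X Y)) :
    Nonempty (g ≃ₗ⁅ℝ⁆ ListedAlgebra 12) := by
  refine ListedAlgebra.nonempty_lieEquiv_of_coord hΨ
    !![pa - qa,pb - qb,0,0,0,0;
      pa,pb,0,0,0,0;
      0,0,(pa * qb - qa * pb) ^ 2 / (qa * (pa - qa)),0,0,0;
      0,0,(pa * qb - qa * pb) / (pa - qa) * (pb - qb),(pa * qb - qa * pb),0,0;
      0,0,0,0,-(pa * qb - qa * pb),-((pa * qb - qa * pb) / qa * qb);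
      0,0,0,0,-((pa * qb - qa * pb) / (pa - qa) * pa),-((pa * qb - qa * pb) / (pa - qa) * pb)]
    (fun X hX => ?_) fun X Y => ?_
  · obtain ⟨h0, h1, h2, h3, h4, h5⟩ := six_eqns hX
    simp [Matrix.mulVec, dotProduct, Fin.sum_univ_six] at h0 h1 h2 h3 h4 h5
    simp [hq, hd, hD] at h2
    obtain ⟨h6, h7⟩ := eq_zero_of_det_ne_zero (show (pa - qa) * pb - (pb - qb) * pa ≠ 0 by
      ring_nf; ring_nf at hD; exact hD) h0 h1
    have h3' : X 3 = 0 := by simpa [h2, hD] using h3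
    obtain ⟨h8, h9⟩ := eq_zero_of_det_ne_zero (x := X 4) (y := X 5)
      (show pa * qb - pb * qa ≠ 0 by rw [mul_comm pb]; exact hD) (by
      field_simp at h5
      have h5' : (pa * qb - qa * pb) * (pa * X 4 + pb * X 5) = 0 := by linarith
      exact (mul_eq_zero.mp h5').resolve_left hD) (by
      field_simp at h4
      have h4' : (pa * qb - qa * pb) * (qa * X 4 + qb * X 5) = 0 := by linarith
      exact (mul_eq_zero.mp h4').resolve_left hD)
    exact eq_zero_of_six h6 h7 h2 h3' h8 h9
  · apply forall_six <;>
    simp [ListedAlgebra.dForm, differentials, wedge, label, extBracket, Matrix.mulVec, dotProduct,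
      Fin.sum_univ_six] <;> (try field_simp) <;> ring

/-- The parameters are two vectors P = (pa, pb) and Q = (qa, qb). The orbit depends on whether they
are dependent, on the ratio m when Q = mP (with m = 0 and m = 1 special), and on which of the first
coordinates of P, Q and P - Q vanish; these are values on the line of the pencil where s is zero. -/
theorem classify_ext {Ψ : (Fin 6 → ℝ) ≃ₗ[ℝ] g} {pa pb qa qb : ℝ}
    (hΨ : ∀ X Y, ⁅Ψ X, Ψ Y⁆ = Ψ (extBracket pa pb qa qb X Y)) :
    ∃ n, Nonempty (g ≃ₗ⁅ℝ⁆ ListedAlgebra n) := by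
  by_cases hD : pa * qb - qa * pb = 0
  · by_cases hp : pa = 0 ∧ pb = 0
    · obtain ⟨rfl, rfl⟩ := hp
      by_cases hqa : qa = 0
      · subst hqa
        by_cases hqb : qb = 0
        · subst hqb
          exact classify_ext_of_eq hΨ
        · exact ⟨_, ext_iso_nine hqb hΨ⟩
      · exact ⟨_, ext_iso_ten hqa hΨ⟩
    obtain ⟨m, rfl, rfl⟩ : ∃ m, qa = m * pa ∧ qb = m * pb := by
      by_cases hpa : pa = 0
      · have hpb : pb ≠ 0 := fun h => hp ⟨hpa, h⟩
        refine ⟨qb / pb, ?_, by field_simp⟩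
        rw [hpa] at hD ⊢
        have : qa * pb = 0 := by linarith
        rw [(mul_eq_zero.mp this).resolve_right hpb, mul_zero]
      · refine ⟨qa / pa, by field_simp, ?_⟩
        field_simp
        linarith
    by_cases hm1 : 1 - m = 0
    · obtain rfl : m = 1 := by linarith
      rw [one_mul, one_mul] at hΨ
      exact classify_ext_of_eq hΨ
    by_cases hm : m = 0
    · rw [hm, zero_mul, zero_mul] at hΨ
      exact ⟨_, ext_iso_eight hp hΨ⟩
    by_cases hpa : pa = 0
    · have hpb : pb ≠ 0 := fun h => hp ⟨hpa, h⟩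
      rw [hpa, mul_zero] at hΨ
      refine ⟨_, ext_iso_thirteen hpb (mul_ne_zero hm hpb) ?_ hΨ⟩
      rw [show pb - m * pb = (1 - m) * pb by ring]
      exact mul_ne_zero hm1 hpb
    · exact ⟨_, ext_iso_fourteen hpa hm hm1 hΨ⟩
  · by_cases hqa : qa = 0
    · subst hqa
      rw [zero_mul, sub_zero] at hD
      exact ⟨_, ext_iso_eleven (left_ne_zero_of_mul hD) (right_ne_zero_of_mul hD) hΨ⟩
    by_cases hda : pa - qa = 0
    · obtain rfl : pa = qa := by linarith
      refine ⟨_, ext_iso_eleven' hqa ?_ hΨ⟩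
      intro h0
      apply hD
      linear_combination -pa * h0
    · exact ⟨_, ext_iso_twelve hqa hda hD hΨ⟩

end Coordinates

/-! ### Normalising a pencil with s not identically zero. -/

section Coordinates

variable {g : Type*} [LieRing g] [LieAlgebra ℝ g]

theorem exists_coord (hg : Module.finrank ℝ g = 6) (v : Fin 6 → g)
    (hv : ∀ c : Fin 6 → ℝ, c 0 • v 0 + c 1 • v 1 + c 2 • v 2 + c 3 • v 3 + c 4 • v 4 + c 5 • v 5 = 0
      → c = 0) :
    ∃ Ψ : (Fin 6 → ℝ) ≃ₗ[ℝ] g, ∀ c, Ψ c =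
      c 0 • v 0 + c 1 • v 1 + c 2 • v 2 + c 3 • v 3 + c 4 • v 4 + c 5 • v 5 := by
  have : Module.Finite ℝ g := Module.finite_of_finrank_eq_succ hg
  have hf : ∀ c, Fintype.linearCombination ℝ v c =
      c 0 • v 0 + c 1 • v 1 + c 2 • v 2 + c 3 • v 3 + c 4 • v 4 + c 5 • v 5 := fun c => by
    rw [Fintype.linearCombination_apply, Fin.sum_univ_six]
  have hi : Function.Injective (Fintype.linearCombination ℝ v) := by
    rw [← LinearMap.ker_eq_bot, LinearMap.ker_eq_bot']
    intro c hc
    rw [hf] at hc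
    exact hv c hc
  exact ⟨LinearEquiv.ofInjectiveOfFinrankEq _ hi (by simp [hg]), hf⟩

theorem Module.Basis.three_indep {V : Type*} [AddCommGroup V] [Module ℝ V]
    (e : Module.Basis (Fin 3) ℝ V) {a b c : ℝ} (h : a • e 0 + b • e 1 + c • e 2 = 0) :
    a = 0 ∧ b = 0 ∧ c = 0 := by
  refine ⟨?_, ?_, ?_⟩
  · simpa using congrArg (fun x => e.repr x 0) h
  · simpa using congrArg (fun x => e.repr x 1) h
  · simpa using congrArg (fun x => e.repr x 2) h

namespace IsPencil

variable {V : Type*} [AddCommGroup V] [Module ℝ V]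
  {i j : V →ₗ[ℝ] g} {A B : V →ₗ[ℝ] V →ₗ[ℝ] V}

theorem exists_extBracket (h : IsPencil i j A B) (hg : Module.finrank ℝ g = 6)
    {e : Module.Basis (Fin 3) ℝ V} {t p q t' p' q' : ℝ} (hA : IsTriangular e A 0 t p q 0)
    (hB : IsTriangular e B 1 t' p' q' 0) :
    ∃ Ψ : (Fin 6 → ℝ) ≃ₗ[ℝ] g, ∀ X Y, ⁅Ψ X, Ψ Y⁆ = Ψ (extBracket p p' q q' X Y) := by
  -- The fourth vector is -[i e₀, j e₀], which absorbs the parameters t and t'.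
  obtain ⟨Ψ, hΨ⟩ := exists_coord hg ![i (e 0), j (e 0), j (e 1),
    i (e 1 + t' • e 2) - t • j (e 2), i (e 2), j (e 2)] (fun c hc => by
      have h1 : i (c 0 • e 0 + c 3 • e 1 + (c 4 + t' * c 3) • e 2) +
          j (c 1 • e 0 + c 2 • e 1 + (c 5 - t * c 3) • e 2) = 0 := by
        rw [← hc]
        simp
        module
      obtain ⟨h2, h3⟩ := h.inj _ _ h1
      obtain ⟨c0, c3, c4⟩ := e.three_indep h2
      obtain ⟨c1, c2, c5⟩ := e.three_indep h3
      rw [c3] at c4 c5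
      exact eq_zero_of_six c0 c1 c2 c3 (by linarith) (by linarith))
  refine ⟨Ψ, fun X Y => ?_⟩
  rw [hΨ, hΨ, hΨ]
  simp [extBracket, h.lie_ii, h.lie_jj, h.lie_ij, h.lie_ji, hA.h00, hA.h01, hA.h10, hA.h11,
    hA.right, hA.left, hB.h00, hB.h01, hB.h10, hB.h11, hB.right, hB.left]
  module

theorem classify_of_ne_zero (h : IsPencil i j A B) (hg : Module.finrank ℝ g = 6)
    {e : Module.Basis (Fin 3) ℝ V} {s t p q s' t' p' q' : ℝ} (hA : IsTriangular e A s t p q 0)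
    (hB : IsTriangular e B s' t' p' q' 0) (hs : ¬ (s = 0 ∧ s' = 0)) :
    ∃ n, Nonempty (g ≃ₗ⁅ℝ⁆ ListedAlgebra n) := by
  have hn := sq_add_sq_ne_zero hs
  set m := s * s + s' * s' with hm
  -- The new first product has s-value s's - ss' = 0, the new second one has s-value (s² + s'²)/m =
  -- 1, and the base change has determinant one.
  have h1 := h.mix (s := s') (t := -s) (s' := s / m) (t' := s' / m) (by
    have : s' * (s' / m) - -s * (s / m) = 1 := by
      field_simp
      linarith
    rw [this]
    exact one_ne_zero)
  have hA' := hA.mix hB s' (-s)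
  have hB' := hA.mix hB (s / m) (s' / m)
  have e1 : s' * s + -s * s' = 0 := by ring
  have e2 : s / m * s + s' / m * s' = 1 := by
    field_simp
    linarith
  rw [e1, mul_zero, mul_zero, add_zero] at hA'
  rw [e2, mul_zero, mul_zero, add_zero] at hB'
  obtain ⟨Ψ, hΨ⟩ := h1.exists_extBracket hg hA' hB'
  exact classify_ext hΨ

end IsPencil

end Coordinates

/-! ### Two-step algebras and pairs of alternating forms on a four-space. -/

section BasisFour

variable {W : Type*} [AddCommGroup W] [Module ℝ W]

theorem Module.Basis.four_indep (e : Module.Basis (Fin 4) ℝ W) {a b c d : ℝ}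
    (h : a • e 0 + b • e 1 + c • e 2 + d • e 3 = 0) : a = 0 ∧ b = 0 ∧ c = 0 ∧ d = 0 := by
  refine ⟨?_, ?_, ?_, ?_⟩
  · simpa using congrArg (fun x => e.repr x 0) h
  · simpa using congrArg (fun x => e.repr x 1) h
  · simpa using congrArg (fun x => e.repr x 2) h
  · simpa using congrArg (fun x => e.repr x 3) h

theorem exists_basis_four (hW : Module.finrank ℝ W = 4) {x y z w : W}
    (h : ∀ a b c d : ℝ, a • x + b • y + c • z + d • w = 0 → a = 0 ∧ b = 0 ∧ c = 0 ∧ d = 0) :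
    ∃ b : Module.Basis (Fin 4) ℝ W, b 0 = x ∧ b 1 = y ∧ b 2 = z ∧ b 3 = w := by
  have hli : LinearIndependent ℝ ![x, y, z, w] := by
    rw [Fintype.linearIndependent_iff]
    intro c hc
    obtain ⟨h0, h1, h2, h3⟩ := h (c 0) (c 1) (c 2) (c 3) (by
      simpa [Fin.sum_univ_four] using hc)
    intro k
    fin_cases k
    exacts [h0, h1, h2, h3]
  refine ⟨basisOfLinearIndependentOfCardEqFinrank hli (by simp [hW]), ?_, ?_, ?_, ?_⟩ <;> simp

theorem exists_basis_four_of_pair (hW : Module.finrank ℝ W = 4) {x y : W}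
    (h : LinearIndependent ℝ ![x, y]) :
    ∃ b : Module.Basis (Fin 4) ℝ W, b 0 = x ∧ b 1 = y := by
  have : Module.Finite ℝ W := Module.finite_of_finrank_eq_succ hW
  obtain ⟨z, hz⟩ := exists_linearIndependent_snoc_of_lt_finrank h (by rw [hW]; norm_num)
  obtain ⟨w, hw⟩ := exists_linearIndependent_snoc_of_lt_finrank hz (by rw [hW]; norm_num)
  have e : Fin.snoc (Fin.snoc ![x, y] z) w = ![x, y, z, w] := by
    ext k
    fin_cases k <;> rfl
  have hw' : LinearIndependent ℝ ![x, y, z, w] := by rw [← e]; exact hw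
  refine ⟨basisOfLinearIndependentOfCardEqFinrank hw' (by simp [hW]), ?_, ?_⟩ <;> simp

theorem Module.Basis.four_expand (b : Module.Basis (Fin 4) ℝ W) (x : W) :
    x = b.repr x 0 • b 0 + b.repr x 1 • b 1 + b.repr x 2 • b 2 + b.repr x 3 • b 3 := by
  conv_lhs => rw [← b.sum_repr x, Fin.sum_univ_four]

end BasisFour

section AlternatingForms

variable {W : Type*} [AddCommGroup W] [Module ℝ W]

theorem alternating_neg {ω : W →ₗ[ℝ] W →ₗ[ℝ] ℝ} (hω : ∀ x, ω x x = 0) (x y : W) :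
    ω y x = -ω x y := by
  have h := hω (x + y)
  simp only [map_add, LinearMap.add_apply, hω] at h
  linarith

theorem linearIndependent_of_form {ω : W →ₗ[ℝ] W →ₗ[ℝ] ℝ} (hω : ∀ x, ω x x = 0) {x y : W}
    (h : ω x y = 1) : LinearIndependent ℝ ![x, y] := by
  rw [LinearIndependent.pair_iff]
  intro a b hab
  have h1 := congrArg (ω x) hab
  have h2 := congrArg (fun z => ω z y) hab
  simp [hω, h] at h1 h2
  exact ⟨h2, h1⟩

/-- A hyperbolic pair splits off. -/
theorem exists_basis_of_form (hW : Module.finrank ℝ W = 4) {ω : W →ₗ[ℝ] W →ₗ[ℝ] ℝ}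
    (hω : ∀ x, ω x x = 0) (h0 : ω ≠ 0) :
    ∃ w : Module.Basis (Fin 4) ℝ W, ω (w 0) (w 1) = 1 ∧ ω (w 0) (w 2) = 0 ∧ ω (w 0) (w 3) = 0 ∧
      ω (w 1) (w 2) = 0 ∧ ω (w 1) (w 3) = 0 := by
  obtain ⟨x, y, hxy⟩ : ∃ x y, ω x y ≠ 0 := by
    by_contra! hne
    exact h0 (LinearMap.ext fun x => LinearMap.ext fun y => hne x y)
  obtain ⟨y', hy'⟩ : ∃ y', ω x y' = 1 := ⟨(ω x y)⁻¹ • y, by simp [hxy]⟩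
  obtain ⟨b, hb0, hb1⟩ := exists_basis_four_of_pair hW (linearIndependent_of_form hω hy')
  have h10 : ω (b 1) (b 0) = -1 := by rw [hb0, hb1, alternating_neg hω, hy']
  have h01 : ω (b 0) (b 1) = 1 := by rw [hb0, hb1, hy']
  obtain ⟨w, hw0, hw1, hw2, hw3⟩ := exists_basis_four hW (x := b 0) (y := b 1)
    (z := b 2 - ω (b 0) (b 2) • b 1 + ω (b 1) (b 2) • b 0)
    (w := b 3 - ω (b 0) (b 3) • b 1 + ω (b 1) (b 3) • b 0) (fun p q r s h => by
      obtain ⟨k0, k1, k2, k3⟩ := b.four_indep (a := p + r * ω (b 1) (b 2) + s * ω (b 1) (b 3))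
        (b := q - r * ω (b 0) (b 2) - s * ω (b 0) (b 3)) (c := r) (d := s) (by
          rw [← h]; module)
      subst k2 k3
      exact ⟨by linarith, by linarith, rfl, rfl⟩)
  refine ⟨w, ?_, ?_, ?_, ?_, ?_⟩ <;> simp [hw0, hw1, hw2, hw3, h01, h10, hω]

/-- The value of the alternating form `ω` on the vectors with coordinates `X` and `Y`. -/
def formValue (ω : W →ₗ[ℝ] W →ₗ[ℝ] ℝ) (w : Fin 4 → W) (X Y : Fin 6 → ℝ) : ℝ :=
  ω (w 0) (w 1) * (X 0 * Y 1 - X 1 * Y 0) + ω (w 0) (w 2) * (X 0 * Y 2 - X 2 * Y 0)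
    + ω (w 0) (w 3) * (X 0 * Y 3 - X 3 * Y 0) + ω (w 1) (w 2) * (X 1 * Y 2 - X 2 * Y 1)
    + ω (w 1) (w 3) * (X 1 * Y 3 - X 3 * Y 1) + ω (w 2) (w 3) * (X 2 * Y 3 - X 3 * Y 2)

theorem formValue_eq {ω : W →ₗ[ℝ] W →ₗ[ℝ] ℝ} (hω : ∀ x, ω x x = 0) (w : Fin 4 → W)
    (X Y : Fin 6 → ℝ) :
    ω (X 0 • w 0 + X 1 • w 1 + X 2 • w 2 + X 3 • w 3)
      (Y 0 • w 0 + Y 1 • w 1 + Y 2 • w 2 + Y 3 • w 3) = formValue ω w X Y := by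
  simp only [formValue, map_add, map_smul, LinearMap.add_apply, LinearMap.smul_apply, smul_eq_mul,
    hω, alternating_neg hω (w 0) (w 1), alternating_neg hω (w 0) (w 2),
    alternating_neg hω (w 0) (w 3), alternating_neg hω (w 1) (w 2), alternating_neg hω (w 1) (w 3),
    alternating_neg hω (w 2) (w 3)]
  ring

end AlternatingForms

/-- The two-step Lie algebra with bracket given by the pair `ω₁, ω₂` of alternating forms. -/
structure IsTwoStep {W g : Type*} [AddCommGroup W] [Module ℝ W] [LieRing g] [LieAlgebra ℝ g]
    (ι : W →ₗ[ℝ] g) (z₁ z₂ : g) (ω₁ ω₂ : W →ₗ[ℝ] W →ₗ[ℝ] ℝ) : Prop where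
  alt₁ : ∀ x, ω₁ x x = 0
  alt₂ : ∀ x, ω₂ x x = 0
  inj : ∀ x (a b : ℝ), ι x + a • z₁ + b • z₂ = 0 → x = 0 ∧ a = 0 ∧ b = 0
  central₁ : ∀ y : g, ⁅z₁, y⁆ = 0
  central₂ : ∀ y : g, ⁅z₂, y⁆ = 0
  lie : ∀ x y, ⁅ι x, ι y⁆ = -(ω₁ x y • z₁ + ω₂ x y • z₂)

namespace IsTwoStep

variable {W g : Type*} [AddCommGroup W] [Module ℝ W] [LieRing g] [LieAlgebra ℝ g]
  {ι : W →ₗ[ℝ] g} {z₁ z₂ : g} {ω₁ ω₂ : W →ₗ[ℝ] W →ₗ[ℝ] ℝ}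

/-- Replacing the forms by combinations requires the inverse transpose on z₁, z₂, so that ω₁ ⊗ z₁ +
ω₂ ⊗ z₂ is unchanged. -/
theorem mix (h : IsTwoStep ι z₁ z₂ ω₁ ω₂) {a b c d : ℝ} (hd : a * d - b * c ≠ 0) :
    IsTwoStep ι ((a * d - b * c)⁻¹ • (d • z₁ - c • z₂)) ((a * d - b * c)⁻¹ • (a • z₂ - b • z₁))
      (a • ω₁ + b • ω₂) (c • ω₁ + d • ω₂) where
  alt₁ x := by simp [h.alt₁, h.alt₂]
  alt₂ x := by simp [h.alt₁, h.alt₂]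
  inj x s t hst := by
    obtain ⟨h1, h2, h3⟩ := h.inj x ((a * d - b * c)⁻¹ * (d * s - b * t))
      ((a * d - b * c)⁻¹ * (a * t - c * s)) (by rw [← hst]; module)
    have h2' := (mul_eq_zero.mp h2).resolve_left (inv_ne_zero hd)
    have h3' := (mul_eq_zero.mp h3).resolve_left (inv_ne_zero hd)
    obtain ⟨h4, h5⟩ := eq_zero_of_det_ne_zero (a := d) (b := -b) (c := -c) (d := a) (x := s) (y := t)
      (by rw [show d * a - -b * -c = a * d - b * c by ring]; exact hd) (by linarith) (by linarith)
    exact ⟨h1, h4, h5⟩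
  central₁ y := by simp [sub_lie, h.central₁, h.central₂]
  central₂ y := by simp [sub_lie, h.central₁, h.central₂]
  lie x y := by
    have h1 : ⁅ι x, ι y⁆ = (a * d - b * c)⁻¹ • (a * d - b * c) • ⁅ι x, ι y⁆ :=
      (inv_smul_smul₀ hd _).symm
    rw [h1, h.lie]
    simp only [LinearMap.add_apply, LinearMap.smul_apply, smul_eq_mul]
    module

theorem nonempty_lieEquiv (h : IsTwoStep ι z₁ z₂ ω₁ ω₂) (hg : Module.finrank ℝ g = 6)
    (w : Module.Basis (Fin 4) ℝ W) (n : Fin 15)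
    (hn : ∀ X Y k, ListedAlgebra.dForm n k X Y =
      (![0, 0, 0, 0, formValue ω₁ w X Y, formValue ω₂ w X Y] : Fin 6 → ℝ) k) :
    Nonempty (g ≃ₗ⁅ℝ⁆ ListedAlgebra n) := by
  obtain ⟨Ψ, hΨ⟩ := exists_coord hg ![ι (w 0), ι (w 1), ι (w 2), ι (w 3), z₁, z₂] (fun c hc => by
    obtain ⟨h1, h2, h3⟩ := h.inj (c 0 • w 0 + c 1 • w 1 + c 2 • w 2 + c 3 • w 3) (c 4) (c 5) (by
      rw [← hc]
      simp)
    obtain ⟨c0, c1, c2, c3⟩ := w.four_indep h1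
    exact eq_zero_of_six c0 c1 c2 c3 h2 h3)
  have hΨ' : ∀ c, Ψ c = ι (c 0 • w 0 + c 1 • w 1 + c 2 • w 2 + c 3 • w 3) + c 4 • z₁ + c 5 • z₂ := by
    intro c
    rw [hΨ]
    simp
  apply ListedAlgebra.nonempty_lieEquiv Ψ
  intro X Y
  have h1 : ∀ y : g, ⁅y, z₁⁆ = 0 := fun y => by rw [← lie_skew, h.central₁, neg_zero]
  have h2 : ∀ y : g, ⁅y, z₂⁆ = 0 := fun y => by rw [← lie_skew, h.central₂, neg_zero]
  rw [hΨ', hΨ', hΨ']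
  simp only [lie_add, add_lie, lie_smul, smul_lie, h.central₁, h.central₂, h1, h2, smul_zero,
    add_zero, h.lie, formValue_eq h.alt₁, formValue_eq h.alt₂, hn]
  simp
  module

end IsTwoStep

namespace IsTwoStep

variable {W g : Type*} [AddCommGroup W] [Module ℝ W] [LieRing g] [LieAlgebra ℝ g]
  {ι : W →ₗ[ℝ] g} {z₁ z₂ : g} {ω₁ ω₂ : W →ₗ[ℝ] W →ₗ[ℝ] ℝ}

/-- A single alternating form in dimension four has rank 0, 2 or 4, giving the first three algebras.
-/
theorem classify_of_eq_zero (h : IsTwoStep ι z₁ z₂ ω₁ ω₂) (hg : Module.finrank ℝ g = 6)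
    (hW : Module.finrank ℝ W = 4) (h1 : ω₁ = 0) :
    ∃ n, Nonempty (g ≃ₗ⁅ℝ⁆ ListedAlgebra n) := by
  subst h1
  by_cases h2 : ω₂ = 0
  · subst h2
    have : Module.Finite ℝ W := Module.finite_of_finrank_eq_succ hW
    refine ⟨0, h.nonempty_lieEquiv hg (Module.finBasisOfFinrankEq ℝ W hW) 0 fun X Y => ?_⟩
    apply forall_six <;> simp [ListedAlgebra.dForm, differentials, formValue]
  obtain ⟨w, w01, w02, w03, w12, w13⟩ := exists_basis_of_form hW h.alt₂ h2
  by_cases h23 : ω₂ (w 2) (w 3) = 0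
  · refine ⟨1, h.nonempty_lieEquiv hg w 1 fun X Y => ?_⟩
    apply forall_six <;>
      simp [ListedAlgebra.dForm, differentials, wedge, label, formValue, w01, w02, w03, w12, w13,
        h23]
  · obtain ⟨v, v0, v1, v2, v3⟩ := exists_basis_four hW (x := w 0) (y := w 1)
      (z := (ω₂ (w 2) (w 3))⁻¹ • w 2) (w := w 3) (fun a b c d hs => by
        obtain ⟨k0, k1, k2, k3⟩ := w.four_indep (a := a) (b := b) (c := c * (ω₂ (w 2) (w 3))⁻¹)
          (d := d) (by rw [← hs]; module)
        exact ⟨k0, k1, (mul_eq_zero.mp k2).resolve_right (inv_ne_zero h23), k3⟩)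
    refine ⟨2, h.nonempty_lieEquiv hg v 2 fun X Y => ?_⟩
    apply forall_six <;>
      simp [ListedAlgebra.dForm, differentials, wedge, label, formValue, v0, v1, v2, v3, w01, w02,
        w03, w12, w13, h23]

/-- The first form is `e¹ ∧ e²` in the basis `w`. -/
structure IsDecomposed (ω : W →ₗ[ℝ] W →ₗ[ℝ] ℝ) (w : Fin 4 → W) : Prop where
  h01 : ω (w 0) (w 1) = 1
  h02 : ω (w 0) (w 2) = 0
  h03 : ω (w 0) (w 3) = 0
  h12 : ω (w 1) (w 2) = 0
  h13 : ω (w 1) (w 3) = 0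
  h23 : ω (w 2) (w 3) = 0

/-- The radical ⟨w 2, w 3⟩ of ω₁ is a hyperbolic plane for ω₂; w 0 and w 1 are corrected to be
ω₂-orthogonal to it. The remaining term of ω₂ is a multiple of ω₁ and is subtracted by the final
`mix`, as in the next two lemmas. -/
theorem classify_seven (h : IsTwoStep ι z₁ z₂ ω₁ ω₂) (hg : Module.finrank ℝ g = 6)
    (hW : Module.finrank ℝ W = 4) (w : Module.Basis (Fin 4) ℝ W) (hw : IsDecomposed ω₁ w)
    (h23 : ω₂ (w 2) (w 3) ≠ 0) : Nonempty (g ≃ₗ⁅ℝ⁆ ListedAlgebra 7) := by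
  set k := ω₂ (w 2) (w 3) with hk
  have h32 : ω₂ (w 3) (w 2) = -k := by rw [alternating_neg h.alt₂, hk]
  have h32' : ω₁ (w 3) (w 2) = 0 := by rw [alternating_neg h.alt₁, hw.h23, neg_zero]
  have h21 : ω₁ (w 2) (w 1) = 0 := by rw [alternating_neg h.alt₁, hw.h12, neg_zero]
  have h31 : ω₁ (w 3) (w 1) = 0 := by rw [alternating_neg h.alt₁, hw.h13, neg_zero]
  obtain ⟨v, v0, v1, v2, v3⟩ := exists_basis_four hW
    (x := w 0 - (ω₂ (w 0) (w 3) / k) • w 2 + (ω₂ (w 0) (w 2) / k) • w 3)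
    (y := w 1 - (ω₂ (w 1) (w 3) / k) • w 2 + (ω₂ (w 1) (w 2) / k) • w 3)
    (z := k⁻¹ • w 2) (w := w 3) (fun a b c d hs => by
      obtain ⟨k0, k1, k2, k3⟩ := w.four_indep (a := a) (b := b)
        (c := c * k⁻¹ - a * (ω₂ (w 0) (w 3) / k) - b * (ω₂ (w 1) (w 3) / k))
        (d := d + a * (ω₂ (w 0) (w 2) / k) + b * (ω₂ (w 1) (w 2) / k)) (by rw [← hs]; module)
      rw [k0, k1] at k2 k3
      refine ⟨k0, k1, ?_, by linarith⟩
      exact (mul_eq_zero.mp (show c * k⁻¹ = 0 by linarith)).resolve_right (inv_ne_zero h23))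
  have e01 : ω₁ (v 0) (v 1) = 1 := by
    simp [v0, v1, hw.h01, hw.h02, hw.h03, h21, h31, h32', hw.h23, h.alt₁]
  have e02 : ω₁ (v 0) (v 2) = 0 := by
    simp [v0, v2, hw.h02, h32', h.alt₁]
  have e03 : ω₁ (v 0) (v 3) = 0 := by
    simp [v0, v3, hw.h03, hw.h23, h.alt₁]
  have e12 : ω₁ (v 1) (v 2) = 0 := by
    simp [v1, v2, hw.h12, h32', h.alt₁]
  have e13 : ω₁ (v 1) (v 3) = 0 := by
    simp [v1, v3, hw.h13, hw.h23, h.alt₁]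
  have e23 : ω₁ (v 2) (v 3) = 0 := by
    simp [v2, v3, hw.h23]
  have f02 : ω₂ (v 0) (v 2) = 0 := by
    simp only [v0, v2, map_add, map_sub, map_smul, LinearMap.add_apply, LinearMap.sub_apply,
      LinearMap.smul_apply, smul_eq_mul, h32, h.alt₂]
    field_simp
    ring
  have f03 : ω₂ (v 0) (v 3) = 0 := by
    simp [v0, v3, ← hk, h.alt₂]
    field_simp
    ring
  have f12 : ω₂ (v 1) (v 2) = 0 := by
    simp only [v1, v2, map_add, map_sub, map_smul, LinearMap.add_apply, LinearMap.sub_apply,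
      LinearMap.smul_apply, smul_eq_mul, h32, h.alt₂]
    field_simp
    ring
  have f13 : ω₂ (v 1) (v 3) = 0 := by
    simp [v1, v3, ← hk, h.alt₂]
    field_simp
    ring
  have f23 : ω₂ (v 2) (v 3) = 1 := by
    simp [v2, v3, ← hk, h23]
  refine (h.mix (a := 1) (b := 0) (c := -ω₂ (v 0) (v 1)) (d := 1) (by norm_num)).nonempty_lieEquiv
    hg v 7 fun X Y => ?_
  apply forall_six <;>
    simp [ListedAlgebra.dForm, differentials, wedge, label, formValue, e01, e02, e03, e12, e13, e23,
      f02, f03, f12, f13, f23]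

/-- The radical of ω₁ is isotropic for ω₂ but pairs perfectly with ⟨w 0, w 1⟩; the new basis of the
radical is dual for this pairing. -/
theorem classify_six (h : IsTwoStep ι z₁ z₂ ω₁ ω₂) (hg : Module.finrank ℝ g = 6)
    (hW : Module.finrank ℝ W = 4) (w : Module.Basis (Fin 4) ℝ W) (hw : IsDecomposed ω₁ w)
    (h23 : ω₂ (w 2) (w 3) = 0)
    (hD : ω₂ (w 0) (w 2) * ω₂ (w 1) (w 3) - ω₂ (w 0) (w 3) * ω₂ (w 1) (w 2) ≠ 0) :
    Nonempty (g ≃ₗ⁅ℝ⁆ ListedAlgebra 6) := by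
  set D := ω₂ (w 0) (w 2) * ω₂ (w 1) (w 3) - ω₂ (w 0) (w 3) * ω₂ (w 1) (w 2) with hDd
  obtain ⟨v, v0, v1, v2, v3⟩ := exists_basis_four hW (x := w 0) (y := w 1)
    (z := (-ω₂ (w 0) (w 3) / D) • w 2 + (ω₂ (w 0) (w 2) / D) • w 3)
    (w := (ω₂ (w 1) (w 3) / D) • w 2 + (-ω₂ (w 1) (w 2) / D) • w 3) (fun a b c d hs => by
      obtain ⟨k0, k1, k2, k3⟩ := w.four_indep (a := a) (b := b)
        (c := (-ω₂ (w 0) (w 3) / D) * c + (ω₂ (w 1) (w 3) / D) * d)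
        (d := (ω₂ (w 0) (w 2) / D) * c + (-ω₂ (w 1) (w 2) / D) * d) (by rw [← hs]; module)
      obtain ⟨k4, k5⟩ := eq_zero_of_det_ne_zero (by
        have : -ω₂ (w 0) (w 3) / D * (-ω₂ (w 1) (w 2) / D) -
            ω₂ (w 1) (w 3) / D * (ω₂ (w 0) (w 2) / D) = -(1 / D) := by
          field_simp
          rw [hDd]
          ring
        rw [this]
        exact neg_ne_zero.mpr (one_div_ne_zero hD)) k2 k3
      exact ⟨k0, k1, k4, k5⟩)
  have h32 : ω₂ (w 3) (w 2) = 0 := by rw [alternating_neg h.alt₂, h23, neg_zero]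
  have h32' : ω₁ (w 3) (w 2) = 0 := by rw [alternating_neg h.alt₁, hw.h23, neg_zero]
  have e01 : ω₁ (v 0) (v 1) = 1 := by rw [v0, v1, hw.h01]
  have e02 : ω₁ (v 0) (v 2) = 0 := by simp [v0, v2, hw.h02, hw.h03]
  have e03 : ω₁ (v 0) (v 3) = 0 := by simp [v0, v3, hw.h02, hw.h03]
  have e12 : ω₁ (v 1) (v 2) = 0 := by simp [v1, v2, hw.h12, hw.h13]
  have e13 : ω₁ (v 1) (v 3) = 0 := by simp [v1, v3, hw.h12, hw.h13]
  have e23 : ω₁ (v 2) (v 3) = 0 := by simp [v2, v3, hw.h23, h32', h.alt₁]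
  have f02 : ω₂ (v 0) (v 2) = 0 := by
    simp [v0, v2]
    ring
  have f03 : ω₂ (v 0) (v 3) = 1 := by
    simp [v0, v3]
    field_simp
    rw [hDd]
    ring
  have f12 : ω₂ (v 1) (v 2) = 1 := by
    simp [v1, v2]
    field_simp
    rw [hDd]
    ring
  have f13 : ω₂ (v 1) (v 3) = 0 := by
    simp [v1, v3]
    ring
  have f23 : ω₂ (v 2) (v 3) = 0 := by simp [v2, v3, h23, h32, h.alt₂]
  refine (h.mix (a := 1) (b := 0) (c := -ω₂ (v 0) (v 1)) (d := 1) (by norm_num)).nonempty_lieEquiv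
    hg v 6 fun X Y => ?_
  apply forall_six <;>
    simp [ListedAlgebra.dForm, differentials, wedge, label, formValue, e01, e02, e03, e12, e13, e23,
      f02, f03, f12, f13, f23]

/-- The pairing of ⟨w 0, w 1⟩ with the radical has rank one: w 1 is corrected into its kernel, and
the radical is split into a vector dual to w 0 and one orthogonal to it. -/
theorem classify_four (h : IsTwoStep ι z₁ z₂ ω₁ ω₂) (hg : Module.finrank ℝ g = 6)
    (hW : Module.finrank ℝ W = 4) (w : Module.Basis (Fin 4) ℝ W) (hw : IsDecomposed ω₁ w)
    (h23 : ω₂ (w 2) (w 3) = 0)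
    (hD : ω₂ (w 0) (w 2) * ω₂ (w 1) (w 3) - ω₂ (w 0) (w 3) * ω₂ (w 1) (w 2) = 0)
    (hne : ¬ (ω₂ (w 0) (w 2) = 0 ∧ ω₂ (w 0) (w 3) = 0)) :
    Nonempty (g ≃ₗ⁅ℝ⁆ ListedAlgebra 4) := by
  have hn := sq_add_sq_ne_zero hne
  set m := ω₂ (w 0) (w 2) * ω₂ (w 0) (w 2) + ω₂ (w 0) (w 3) * ω₂ (w 0) (w 3) with hm
  -- The ratio of the two rows of the pairing, obtained by projecting onto the first row so that no
  -- entry need be singled out as non-zero.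
  set l := (ω₂ (w 0) (w 2) * ω₂ (w 1) (w 2) + ω₂ (w 0) (w 3) * ω₂ (w 1) (w 3)) / m with hl
  have l2 : ω₂ (w 1) (w 2) = l * ω₂ (w 0) (w 2) := by
    rw [hl]
    field_simp
    rw [hm]
    linear_combination -ω₂ (w 0) (w 3) * hD
  have l3 : ω₂ (w 1) (w 3) = l * ω₂ (w 0) (w 3) := by
    rw [hl]
    field_simp
    rw [hm]
    linear_combination ω₂ (w 0) (w 2) * hD
  obtain ⟨v, v0, v1, v2, v3⟩ := exists_basis_four hW (x := w 0) (y := w 1 - l • w 0)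
    (z := (ω₂ (w 0) (w 2) / m) • w 2 + (ω₂ (w 0) (w 3) / m) • w 3)
    (w := (-ω₂ (w 0) (w 3)) • w 2 + ω₂ (w 0) (w 2) • w 3) (fun a b c d hs => by
      obtain ⟨k0, k1, k2, k3⟩ := w.four_indep (a := a - b * l) (b := b)
        (c := (ω₂ (w 0) (w 2) / m) * c + (-ω₂ (w 0) (w 3)) * d)
        (d := (ω₂ (w 0) (w 3) / m) * c + ω₂ (w 0) (w 2) * d) (by rw [← hs]; module)
      obtain ⟨k4, k5⟩ := eq_zero_of_det_ne_zero (by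
        have : ω₂ (w 0) (w 2) / m * ω₂ (w 0) (w 2) -
            -ω₂ (w 0) (w 3) * (ω₂ (w 0) (w 3) / m) = 1 := by
          field_simp
          rw [hm]
          ring
        rw [this]
        exact one_ne_zero) k2 k3
      rw [k1] at k0
      exact ⟨by linarith, k1, k4, k5⟩)
  have h32 : ω₂ (w 3) (w 2) = 0 := by rw [alternating_neg h.alt₂, h23, neg_zero]
  have h32' : ω₁ (w 3) (w 2) = 0 := by rw [alternating_neg h.alt₁, hw.h23, neg_zero]
  have e01 : ω₁ (v 0) (v 1) = 1 := by simp [v0, v1, hw.h01, h.alt₁]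
  have e02 : ω₁ (v 0) (v 2) = 0 := by simp [v0, v2, hw.h02, hw.h03]
  have e03 : ω₁ (v 0) (v 3) = 0 := by simp [v0, v3, hw.h02, hw.h03]
  have e12 : ω₁ (v 1) (v 2) = 0 := by simp [v1, v2, hw.h02, hw.h03, hw.h12, hw.h13]
  have e13 : ω₁ (v 1) (v 3) = 0 := by simp [v1, v3, hw.h02, hw.h03, hw.h12, hw.h13]
  have e23 : ω₁ (v 2) (v 3) = 0 := by simp [v2, v3, hw.h23, h32', h.alt₁]
  have f02 : ω₂ (v 0) (v 2) = 1 := by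
    simp [v0, v2]
    field_simp
    rw [hm]
    ring
  have f03 : ω₂ (v 0) (v 3) = 0 := by
    simp [v0, v3]
    ring
  have f12 : ω₂ (v 1) (v 2) = 0 := by
    simp [v1, v2, l2, l3]
    ring
  have f13 : ω₂ (v 1) (v 3) = 0 := by
    simp [v1, v3, l2, l3]
    ring
  have f23 : ω₂ (v 2) (v 3) = 0 := by simp [v2, v3, h23, h32, h.alt₂]
  refine (h.mix (a := 1) (b := 0) (c := -ω₂ (v 0) (v 1)) (d := 1) (by norm_num)).nonempty_lieEquiv
    hg v 4 fun X Y => ?_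
  apply forall_six <;>
    simp [ListedAlgebra.dForm, differentials, wedge, label, formValue, e01, e02, e03, e12, e13, e23,
      f02, f03, f12, f13, f23]

theorem classify_of_decomposed (h : IsTwoStep ι z₁ z₂ ω₁ ω₂) (hg : Module.finrank ℝ g = 6)
    (hW : Module.finrank ℝ W = 4) (w : Module.Basis (Fin 4) ℝ W) (hw : IsDecomposed ω₁ w) :
    ∃ n, Nonempty (g ≃ₗ⁅ℝ⁆ ListedAlgebra n) := by
  by_cases h23 : ω₂ (w 2) (w 3) = 0
  swap
  · exact ⟨7, h.classify_seven hg hW w hw h23⟩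
  by_cases hD : ω₂ (w 0) (w 2) * ω₂ (w 1) (w 3) - ω₂ (w 0) (w 3) * ω₂ (w 1) (w 2) = 0
  swap
  · exact ⟨6, h.classify_six hg hW w hw h23 hD⟩
  by_cases h0 : ω₂ (w 0) (w 2) = 0 ∧ ω₂ (w 0) (w 3) = 0
  swap
  · exact ⟨4, h.classify_four hg hW w hw h23 hD h0⟩
  by_cases h1 : ω₂ (w 1) (w 2) = 0 ∧ ω₂ (w 1) (w 3) = 0
  · refine ⟨1, (h.mix (a := -ω₂ (w 0) (w 1)) (b := 1) (c := 1) (d := 0)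
      (by norm_num)).nonempty_lieEquiv hg w 1 fun X Y => ?_⟩
    apply forall_six <;>
      simp [ListedAlgebra.dForm, differentials, wedge, label, formValue, hw.h01, hw.h02, hw.h03,
        hw.h12, hw.h13, hw.h23, h0.1, h0.2, h1.1, h1.2, h23]
  -- Exchange w 0 and w 1; the sign keeps the value of ω₁ on them equal to 1.
  · obtain ⟨v, v0, v1, v2, v3⟩ := exists_basis_four hW (x := w 1) (y := -w 0) (z := w 2) (w := w 3)
      (fun a b c d hs => by
        obtain ⟨k0, k1, k2, k3⟩ := w.four_indep (a := -b) (b := a) (c := c) (d := d) (by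
          rw [← hs]; module)
        exact ⟨k1, by linarith, k2, k3⟩)
    refine ⟨4, h.classify_four hg hW v ⟨?_, ?_, ?_, ?_, ?_, ?_⟩ ?_ ?_ ?_⟩
    · simp [v0, v1, alternating_neg h.alt₁ (w 0), hw.h01]
    · simp [v0, v2, hw.h12]
    · simp [v0, v3, hw.h13]
    · simp [v1, v2, hw.h02]
    · simp [v1, v3, hw.h03]
    · simp [v2, v3, hw.h23]
    · simp [v2, v3, h23]
    · simp [v0, v1, v2, v3, h0.1, h0.2]
    · simpa [v0, v2, v3] using h1

/-- Once a hyperbolic pair splits off, a non-zero radical forces ω₁ to have rank two, so it is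
decomposable. -/
theorem classify_of_degenerate (h : IsTwoStep ι z₁ z₂ ω₁ ω₂) (hg : Module.finrank ℝ g = 6)
    (hW : Module.finrank ℝ W = 4) {x : W} (hx0 : x ≠ 0) (hx : ∀ y, ω₁ x y = 0) :
    ∃ n, Nonempty (g ≃ₗ⁅ℝ⁆ ListedAlgebra n) := by
  by_cases h1 : ω₁ = 0
  · exact h.classify_of_eq_zero hg hW h1
  obtain ⟨w, w01, w02, w03, w12, w13⟩ := exists_basis_of_form hW h.alt₁ h1
  refine h.classify_of_decomposed hg hW w ⟨w01, w02, w03, w12, w13, ?_⟩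
  by_contra h23
  apply hx0
  have n := fun k l => alternating_neg h.alt₁ (w k) (w l)
  have q0 := hx (w 0)
  have q1 := hx (w 1)
  have q2 := hx (w 2)
  have q3 := hx (w 3)
  rw [w.four_expand x] at q0 q1 q2 q3
  simp [h.alt₁, n 0 1, n 0 2, n 0 3, n 1 2, n 1 3, n 2 3, w01, w02, w03, w12, w13, h23] at q0 q1 q2 q3
  rw [w.four_expand x, q0, q1, q2, q3]
  simp

end IsTwoStep

/-! ### Pairs of forms with no degenerate combination. -/

section DualPair

variable {W : Type*} [AddCommGroup W] [Module ℝ W]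

theorem exists_dual_pair {α β : W →ₗ[ℝ] ℝ}
    (h : ∀ a b : ℝ, (∀ y, a * α y + b * β y = 0) → a = 0 ∧ b = 0) :
    ∃ y₁ y₂, α y₁ = 1 ∧ β y₁ = 0 ∧ α y₂ = 0 ∧ β y₂ = 1 := by
  obtain ⟨y, hy⟩ : ∃ y, α y ≠ 0 := by
    by_contra! h0
    exact one_ne_zero (h 1 0 (fun y => by simp [h0])).1
  obtain ⟨y', hy'⟩ : ∃ y', α y * β y' - β y * α y' ≠ 0 := by
    by_contra! h0
    exact hy (h (-β y) (α y) (fun y' => by linarith [h0 y'])).2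
  set D := α y * β y' - β y * α y' with hD
  refine ⟨(β y' / D) • y - (β y / D) • y', (α y / D) • y' - (α y' / D) • y, ?_, ?_, ?_, ?_⟩ <;>
    simp only [map_sub, map_smul, smul_eq_mul] <;> field_simp <;> rw [hD] <;> ring

theorem exists_left_kernel {a b c d : ℝ} (h : a * d - b * c = 0) :
    ∃ s t : ℝ, ¬ (s = 0 ∧ t = 0) ∧ s * a + t * c = 0 ∧ s * b + t * d = 0 := by
  by_cases h1 : a = 0 ∧ c = 0
  · by_cases h2 : b = 0 ∧ d = 0
    · exact ⟨1, 0, by simp, by simp [h1.1], by simp [h2.1]⟩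
    · exact ⟨d, -b, fun h0 => h2 ⟨neg_eq_zero.mp h0.2, h0.1⟩, by simp [h1.1, h1.2], by ring⟩
  · exact ⟨c, -a, fun h0 => h1 ⟨neg_eq_zero.mp h0.2, h0.1⟩, by ring, by linarith⟩

end DualPair

namespace IsTwoStep

variable {W g : Type*} [AddCommGroup W] [Module ℝ W] [LieRing g] [LieAlgebra ℝ g]
  {ι : W →ₗ[ℝ] g} {z₁ z₂ : g} {ω₁ ω₂ : W →ₗ[ℝ] W →ₗ[ℝ] ℝ}

theorem exists_basis_of_dual_pair (h : IsTwoStep ι z₁ z₂ ω₁ ω₂) (hW : Module.finrank ℝ W = 4)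
    {x₁ x₂ y₁ y₂ : W} (hx : LinearIndependent ℝ ![x₁, x₂]) (h1 : ω₁ x₁ x₂ = 0)
    (h2 : ω₂ x₁ x₂ = 0) (h3 : ω₁ x₁ y₁ = 1) (h4 : ω₂ x₁ y₁ = 0) (h5 : ω₁ x₁ y₂ = 0)
    (h6 : ω₂ x₁ y₂ = 1) :
    ∃ v : Module.Basis (Fin 4) ℝ W, v 0 = x₁ ∧ v 1 = x₂ ∧ v 2 = y₁ ∧ v 3 = y₂ := by
  refine exists_basis_four hW fun a b c d hs => ?_
  have q1 := congrArg (ω₁ x₁) hs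
  have q2 := congrArg (ω₂ x₁) hs
  simp [h.alt₁, h.alt₂, h1, h2, h3, h4, h5, h6] at q1 q2
  rw [q1, q2, zero_smul, zero_smul, add_zero, add_zero] at hs
  obtain ⟨ha, hb⟩ := LinearIndependent.pair_iff.mp hx a b hs
  exact ⟨ha, hb, q1, q2⟩

/-- The hypotheses on x₂ say that it acts as a complex multiple of x₁: this is the complex
Heisenberg algebra. -/
theorem classify_five (h : IsTwoStep ι z₁ z₂ ω₁ ω₂) (hg : Module.finrank ℝ g = 6)
    (hW : Module.finrank ℝ W = 4)
    {x₁ x₂ y₁ y₂ : W} (hx : LinearIndependent ℝ ![x₁, x₂]) (h1 : ω₁ x₁ x₂ = 0)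
    (h2 : ω₂ x₁ x₂ = 0) (h3 : ω₁ x₁ y₁ = 1) (h4 : ω₂ x₁ y₁ = 0) (h5 : ω₁ x₁ y₂ = 0)
    (h6 : ω₂ x₁ y₂ = 1) (h7 : ∀ y, ω₁ x₂ y = -ω₂ x₁ y) (h8 : ∀ y, ω₂ x₂ y = ω₁ x₁ y) :
    Nonempty (g ≃ₗ⁅ℝ⁆ ListedAlgebra 5) := by
  -- Adding these multiples of x₁ and x₂ to y₁ cancels both forms on the pair y₁, y₂ and leaves
  -- their values on x₁, y₁ unchanged.
  have e3 : ω₁ x₁ (y₁ - ω₂ y₁ y₂ • x₁ + ω₁ y₁ y₂ • x₂) = 1 := by simp [h.alt₁, h1, h3]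
  have e4 : ω₂ x₁ (y₁ - ω₂ y₁ y₂ • x₁ + ω₁ y₁ y₂ • x₂) = 0 := by simp [h.alt₂, h2, h4]
  obtain ⟨v, v0, v1, v2, v3⟩ := h.exists_basis_of_dual_pair hW hx h1 h2 e3 e4 h5 h6
  have f1 : ω₁ (v 2) (v 3) = 0 := by simp [v2, v3, h5, h7, h6]
  have f2 : ω₂ (v 2) (v 3) = 0 := by simp [v2, v3, h5, h8, h6]
  have e3' : ω₁ (v 0) (v 2) = 1 := by rw [v0, v2, e3]
  have e4' : ω₂ (v 0) (v 2) = 0 := by rw [v0, v2, e4]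
  rw [v0] at e3' e4'
  rw [v3] at f1 f2
  clear v2
  refine h.nonempty_lieEquiv hg v 5 fun X Y => ?_
  apply forall_six <;>
    simp [ListedAlgebra.dForm, differentials, wedge, label, formValue, h1, h2, h5, h6, h7, h8, e3',
      e4', f1, f2, v0, v1, v3]

/-- A degenerate combination is rotated into first place. If there is none, comparing the forms at
two suitable vectors gives a real 2 × 2 matrix without real eigenvalues, which is normalised to a
complex structure. -/
theorem classify (h : IsTwoStep ι z₁ z₂ ω₁ ω₂) (hg : Module.finrank ℝ g = 6)
    (hW : Module.finrank ℝ W = 4) : ∃ n, Nonempty (g ≃ₗ⁅ℝ⁆ ListedAlgebra n) := by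
  by_cases hdeg : ∃ (a b : ℝ) (x : W), ¬ (a = 0 ∧ b = 0) ∧ x ≠ 0 ∧ ∀ y, a * ω₁ x y + b * ω₂ x y = 0
  · obtain ⟨a, b, x, hab, hx0, hx⟩ := hdeg
    exact (h.mix (a := a) (b := b) (c := -b) (d := a) (by
      have := sq_add_sq_ne_zero hab
      rwa [mul_neg, sub_neg_eq_add])).classify_of_degenerate hg hW hx0 (by simpa using hx)
  push Not at hdeg
  have hnd : ∀ a b x, x ≠ 0 → (∀ y, a * ω₁ x y + b * ω₂ x y = 0) → a = 0 ∧ b = 0 := by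
    intro a b x hx0 hx
    by_contra hab
    obtain ⟨y, hy⟩ := hdeg a b x (fun ha => fun hb => hab ⟨ha, hb⟩) hx0
    exact hy (hx y)
  have : Module.Finite ℝ W := Module.finite_of_finrank_eq_succ hW
  have : Nontrivial W := Module.nontrivial_of_finrank_pos (R := ℝ) (by rw [hW]; norm_num)
  obtain ⟨x₁, hx₁⟩ := exists_ne (0 : W)
  obtain ⟨x₂, hx, h1, h2⟩ : ∃ x₂, LinearIndependent ℝ ![x₁, x₂] ∧ ω₁ x₁ x₂ = 0 ∧ ω₂ x₁ x₂ = 0 := by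
    -- The common kernel of the two functionals of x₁ has dimension at least two and contains x₁; x₂
    -- is taken there.
    let f : W →ₗ[ℝ] ℝ × ℝ := (ω₁ x₁).prod (ω₂ x₁)
    have hr := LinearMap.finrank_range_add_finrank_ker f
    have hle : Module.finrank ℝ (LinearMap.range f) ≤ 2 := by
      have := Submodule.finrank_le (LinearMap.range f)
      simpa using this
    have hmem : x₁ ∈ LinearMap.ker f := by simp [f, h.alt₁, h.alt₂]
    obtain ⟨y, hy⟩ := exists_linearIndependent_pair_of_one_lt_finrank (R := ℝ)
      (M := LinearMap.ker f) (by omega) (x := ⟨x₁, hmem⟩) (by simpa using hx₁)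
    have hy2 := y.2
    simp only [LinearMap.mem_ker, f, LinearMap.prod_apply, Prod.mk_eq_zero, Function.prod_apply]
      at hy2
    refine ⟨y, ?_, hy2.1, hy2.2⟩
    rw [LinearIndependent.pair_iff] at hy ⊢
    intro s t hst
    exact hy s t (Subtype.ext hst)
  obtain ⟨y₁, y₂, h3, h4, h5, h6⟩ := exists_dual_pair (fun a b => hnd a b x₁ hx₁)
  obtain ⟨v, v0, v1, v2, v3⟩ := h.exists_basis_of_dual_pair hW hx h1 h2 h3 h4 h5 h6
  have n1 : ω₁ x₂ x₁ = 0 := by rw [alternating_neg h.alt₁, h1, neg_zero]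
  have n2 : ω₂ x₂ x₁ = 0 := by rw [alternating_neg h.alt₂, h2, neg_zero]
  have r1 : ω₁ x₂ = ω₁ x₂ y₁ • ω₁ x₁ + ω₁ x₂ y₂ • ω₂ x₁ := by
    apply v.ext
    intro k
    fin_cases k <;> simp [v0, v1, v2, v3, h1, h2, h3, h4, h5, h6, n1, h.alt₁, h.alt₂]
  have r2 : ω₂ x₂ = ω₂ x₂ y₁ • ω₁ x₁ + ω₂ x₂ y₂ • ω₂ x₁ := by
    apply v.ext
    intro k
    fin_cases k <;> simp [v0, v1, v2, v3, h1, h2, h3, h4, h5, h6, n2, h.alt₁, h.alt₂]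
  generalize ω₁ x₂ y₁ = a at r1
  generalize ω₁ x₂ y₂ = b at r1
  generalize ω₂ x₂ y₁ = c at r2
  generalize ω₂ x₂ y₂ = d at r2
  -- A real eigenvalue m would put x₂ - m x₁ in the radical of some combination of ω₁ and ω₂.
  have hT : ∀ m : ℝ, (a - m) * (d - m) - b * c ≠ 0 := by
    intro m hm
    obtain ⟨s, t, hst, e1, e2⟩ := exists_left_kernel hm
    refine hst (hnd s t (x₂ - m • x₁) ?_ fun y => ?_)
    · intro h0
      have := (LinearIndependent.pair_iff.mp hx (-m) 1 (by rw [← h0]; module)).2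
      exact one_ne_zero this
    · simp only [map_sub, map_smul, LinearMap.sub_apply, LinearMap.smul_apply, r1, r2,
        LinearMap.add_apply, smul_eq_mul]
      linear_combination ω₁ x₁ y * e1 + ω₂ x₁ y * e2
  have hneg : (a - d) ^ 2 / 4 + b * c < 0 := by
    by_contra! hge
    apply hT ((a + d) / 2 + √((a - d) ^ 2 / 4 + b * c))
    have := Real.sq_sqrt hge
    linear_combination this
  -- This factor scales the trace-free part of the matrix to have square -1.
  set k := (√(-((a - d) ^ 2 / 4 + b * c)))⁻¹ with hk
  have hk2 : k ^ 2 * ((a - d) ^ 2 / 4 + b * c) = -1 := by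
    rw [hk, inv_pow, Real.sq_sqrt (by linarith), inv_neg, neg_mul, inv_mul_cancel₀ hneg.ne]
  have hk0 : k ≠ 0 := by
    intro h0
    rw [h0] at hk2
    norm_num at hk2
  have hb : b ≠ 0 := by
    intro h0
    rw [h0, zero_mul, add_zero] at hneg
    linarith [sq_nonneg (a - d)]
  -- The new second form is chosen so that its functional at x₁ is minus that of ω₁ at k (x₂ - ((a +
  -- d)/2) x₁).
  have hm := h.mix (a := 1) (b := 0) (c := -(k * (a - d) / 2)) (d := -(k * b))
    (by simpa using ⟨hk0, hb⟩)
  obtain ⟨u₁, u₂, g3, g4, g5, g6⟩ := exists_dual_pair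
    (α := ((1 : ℝ) • ω₁ + (0 : ℝ) • ω₂) x₁)
    (β := (-(k * (a - d) / 2) • ω₁ + -(k * b) • ω₂) x₁) (fun s t hst => by
      obtain ⟨q1, q2⟩ := hnd (s - t * (k * (a - d) / 2)) (-(t * (k * b))) x₁ hx₁ fun y => by
        have := hst y
        simp at this
        linarith
      have ht : t = 0 := by simpa [hk0, hb] using q2
      rw [ht] at q1
      exact ⟨by linarith, ht⟩)
  refine ⟨5, hm.classify_five hg hW (x₁ := x₁) (x₂ := k • (x₂ - ((a + d) / 2) • x₁)) ?_ ?_ ?_ g3 g4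
    g5 g6 ?_ ?_⟩
  · rw [LinearIndependent.pair_iff] at hx ⊢
    intro s t hst
    obtain ⟨q1, q2⟩ := hx (s - t * k * ((a + d) / 2)) (t * k) (by rw [← hst]; module)
    have ht : t = 0 := (mul_eq_zero.mp q2).resolve_right hk0
    rw [ht] at q1
    exact ⟨by linarith, ht⟩
  · simp [h1, h.alt₁]
  · simp [h1, h2, h.alt₁, h.alt₂]
  · intro y
    simp [r1]
    ring
  · intro y
    simp [r1, r2]
    linear_combination ω₁ x₁ y * (-hk2)

end IsTwoStep

/-! ### Completing the classification of pencils. -/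

namespace IsPencil

variable {V g : Type*} [AddCommGroup V] [Module ℝ V] [LieRing g] [LieAlgebra ℝ g]
  {i j : V →ₗ[ℝ] g} {A B : V →ₗ[ℝ] V →ₗ[ℝ] V}

/-- With s = s' = 0 all brackets lie in the central plane ⟨i e₂, j e₂⟩; the two matrices are minus
the coordinates of the bracket of i e₀, i e₁, j e₀, j e₁. -/
theorem exists_isTwoStep (h : IsPencil i j A B)
    {e : Module.Basis (Fin 3) ℝ V} {t p q r t' p' q' r' : ℝ} (hA : IsTriangular e A 0 t p q r)
    (hB : IsTriangular e B 0 t' p' q' r') :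
    ∃ (ι : (Fin 4 → ℝ) →ₗ[ℝ] g) (ω₁ ω₂ : (Fin 4 → ℝ) →ₗ[ℝ] (Fin 4 → ℝ) →ₗ[ℝ] ℝ),
      IsTwoStep ι (i (e 2)) (j (e 2)) ω₁ ω₂ := by
  let M₁ : Matrix (Fin 4) (Fin 4) ℝ :=
    !![0, -(p - q), t', q'; p - q, 0, p', r'; -t', -p', 0, 0; -q', -r', 0, 0]
  let M₂ : Matrix (Fin 4) (Fin 4) ℝ :=
    !![0, 0, -t, -p; 0, 0, -q, -r; t, q, 0, -(p' - q'); p, r, p' - q', 0]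
  have hM : ∀ (M : Matrix (Fin 4) (Fin 4) ℝ) (x y : Fin 4 → ℝ), Matrix.toLinearMap₂' ℝ M x y =
      ∑ k, ∑ l, x k * M k l * y l := fun M x y => by
    rw [Matrix.toLinearMap₂'_apply]
    simp [mul_comm, mul_left_comm]
  have hι : ∀ c, Fintype.linearCombination ℝ ![i (e 0), i (e 1), j (e 0), j (e 1)] c =
      c 0 • i (e 0) + c 1 • i (e 1) + c 2 • j (e 0) + c 3 • j (e 1) := fun c => by
    rw [Fintype.linearCombination_apply, Fin.sum_univ_four]
    simp
  refine ⟨Fintype.linearCombination ℝ ![i (e 0), i (e 1), j (e 0), j (e 1)],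
    Matrix.toLinearMap₂' ℝ M₁, Matrix.toLinearMap₂' ℝ M₂, ?_, ?_, ?_, ?_, ?_, ?_⟩
  · intro x
    simp [hM, Fin.sum_univ_four, M₁]
    ring
  · intro x
    simp [hM, Fin.sum_univ_four, M₂]
    ring
  · intro c a b hc
    rw [hι] at hc
    obtain ⟨h1, h2⟩ := h.inj (c 0 • e 0 + c 1 • e 1 + a • e 2) (c 2 • e 0 + c 3 • e 1 + b • e 2) (by
      rw [← hc]
      simp only [map_add, map_smul]
      abel)
    obtain ⟨c0, c1, ha⟩ := e.three_indep h1
    obtain ⟨c2, c3, hb⟩ := e.three_indep h2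
    refine ⟨?_, ha, hb⟩
    funext k
    fin_cases k
    exacts [c0, c1, c2, c3]
  · intro z
    obtain ⟨x, y, rfl⟩ := h.surj z
    simp [h.lie_ii, h.lie_ij, hA.left, hA.right, hB.right]
  · intro z
    obtain ⟨x, y, rfl⟩ := h.surj z
    simp [h.lie_jj, h.lie_ji, hB.left, hB.right, hA.right]
  · intro x y
    rw [hι, hι, hM, hM]
    simp [Fin.sum_univ_four, M₁, M₂, h.lie_ii, h.lie_jj, h.lie_ij, h.lie_ji, hA.h00, hA.h01, hA.h10,
      hA.h11, hB.h00, hB.h01, hB.h10, hB.h11]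
    module

theorem classify (h : IsPencil i j A B) [LieRing.IsNilpotent g] (hg : Module.finrank ℝ g = 6)
    (hV : Module.finrank ℝ V = 3) : ∃ n, Nonempty (g ≃ₗ⁅ℝ⁆ ListedAlgebra n) := by
  obtain ⟨e, s, t, p, q, r, s', t', p', q', r', hA, hB⟩ := h.exists_isTriangular hV
  by_cases hs : s = 0 ∧ s' = 0
  · obtain ⟨rfl, rfl⟩ := hs
    obtain ⟨ι, ω₁, ω₂, h2⟩ := h.exists_isTwoStep hA hB
    exact h2.classify hg (by simp)
  · obtain ⟨rfl, rfl⟩ := (h.forms_eq_zero_of_isTriangular hA hB).resolve_left hs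
    exact h.classify_of_ne_zero hg hA hB hs

end IsPencil

/-! ### The listed algebras are nilpotent, of step at most three. -/

namespace ListedAlgebra

theorem finrank_eq (n : Fin 15) : Module.finrank ℝ (ListedAlgebra n) = 6 :=
  Module.finrank_fin_fun ℝ

theorem lie_lie_lie (n : Fin 15) (x y z w : ListedAlgebra n) : ⁅x, ⁅y, ⁅z, w⁆⁆⁆ = 0 := by
  apply ListedAlgebra.ext'
  intro k
  simp only [ListedAlgebra.lie_apply, ListedAlgebra.zero_apply]
  fin_cases n <;> fin_cases k <;>
    simp [ListedAlgebra.dForm, differentials, wedge, label, ListedAlgebra.lie_apply]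

theorem isNilpotent (n : Fin 15) : LieRing.IsNilpotent (ListedAlgebra n) := by
  refine (LieModule.isNilpotent_iff ℝ _ _).mpr ⟨3, ?_⟩
  have h1 : ∀ m ∈ LieModule.lowerCentralSeries ℝ (ListedAlgebra n) (ListedAlgebra n) 1,
      ∀ x y : ListedAlgebra n, ⁅x, ⁅y, m⁆⁆ = 0 := by
    intro m hm
    rw [LieModule.lowerCentralSeries_succ, ← LieSubmodule.mem_toSubmodule,
      LieSubmodule.lieIdeal_oper_eq_linear_span'] at hm
    induction hm using Submodule.span_induction with
    | mem m hm =>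
      obtain ⟨z, -, w, -, rfl⟩ := hm
      exact fun x y => lie_lie_lie n x y z w
    | zero => simp
    | add a b _ _ ha hb => intro x y; simp [ha, hb]
    | smul c a _ ha => intro x y; simp [ha]
  have h2 : ∀ m ∈ LieModule.lowerCentralSeries ℝ (ListedAlgebra n) (ListedAlgebra n) 2,
      ∀ x : ListedAlgebra n, ⁅x, m⁆ = 0 := by
    intro m hm
    rw [LieModule.lowerCentralSeries_succ, ← LieSubmodule.mem_toSubmodule,
      LieSubmodule.lieIdeal_oper_eq_linear_span'] at hm
    induction hm using Submodule.span_induction with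
    | mem m hm =>
      obtain ⟨z, -, w, hw, rfl⟩ := hm
      exact fun x => h1 w hw x z
    | zero => simp
    | add a b _ _ ha hb => intro x; simp [ha, hb]
    | smul c a _ ha => intro x; simp [ha]
  rw [LieModule.lowerCentralSeries_succ, eq_bot_iff, LieSubmodule.lieIdeal_oper_eq_span,
    LieSubmodule.lieSpan_le]
  rintro _ ⟨x, m, rfl⟩
  exact h2 _ m.2 x

end ListedAlgebra

/-! ### Existence: explicit pencils realising the table. -/

/-- The parameters of a pair of triangular products. -/
structure TriangularData where
  (s t p q r t' p' q' r' : ℝ)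
  left : s * r = 0
  right : s * r' = 0

/-- The Lie algebra on `ℝ⁶` defined by a pair of triangular products. -/
def TriangularAlgebra (_c : TriangularData) : Type := Fin 6 → ℝ

namespace TriangularAlgebra

variable (c : TriangularData)

noncomputable instance : AddCommGroup (TriangularAlgebra c) :=
  inferInstanceAs (AddCommGroup (Fin 6 → ℝ))

noncomputable instance : Module ℝ (TriangularAlgebra c) :=
  inferInstanceAs (Module ℝ (Fin 6 → ℝ))

/-- The bracket, in the basis `A₁, B₁, B₂, A₂, A₃, B₃`. -/
def bracket (X Y : Fin 6 → ℝ) : Fin 6 → ℝ :=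
  ![0, 0, 0, -c.s * (X 0 * Y 1 - X 1 * Y 0),
    (c.p - c.q) * (X 0 * Y 3 - X 3 * Y 0) - c.t' * (X 0 * Y 1 - X 1 * Y 0)
      - c.q' * (X 0 * Y 2 - X 2 * Y 0) + c.p' * (X 1 * Y 3 - X 3 * Y 1)
      + c.r' * (X 2 * Y 3 - X 3 * Y 2),
    (c.p' - c.q') * (X 1 * Y 2 - X 2 * Y 1) + c.t * (X 0 * Y 1 - X 1 * Y 0)
      + c.p * (X 0 * Y 2 - X 2 * Y 0) - c.q * (X 1 * Y 3 - X 3 * Y 1)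
      - c.r * (X 2 * Y 3 - X 3 * Y 2)]

instance : Bracket (TriangularAlgebra c) (TriangularAlgebra c) where
  bracket X Y := bracket c X Y

variable {c}

theorem lie_apply (X Y : TriangularAlgebra c) (k : Fin 6) : ⁅X, Y⁆ k = bracket c X Y k := rfl

theorem add_apply (x y : TriangularAlgebra c) (k : Fin 6) : (x + y) k = x k + y k := rfl

theorem smul_apply (a : ℝ) (x : TriangularAlgebra c) (k : Fin 6) : (a • x) k = a * x k := rfl

theorem zero_apply (k : Fin 6) : (0 : TriangularAlgebra c) k = 0 := rfl

theorem ext_six {x y : TriangularAlgebra c} (h0 : x 0 = y 0) (h1 : x 1 = y 1) (h2 : x 2 = y 2)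
    (h3 : x 3 = y 3) (h4 : x 4 = y 4) (h5 : x 5 = y 5) : x = y := by
  funext k
  fin_cases k
  exacts [h0, h1, h2, h3, h4, h5]

variable (c)

noncomputable instance : LieRing (TriangularAlgebra c) where
  add_lie x y z := by
    apply ext_six <;> simp [lie_apply, bracket, add_apply] <;> ring
  lie_add x y z := by
    apply ext_six <;> simp [lie_apply, bracket, add_apply] <;> ring
  lie_self x := by
    apply ext_six <;> simp [lie_apply, bracket, zero_apply, mul_comm]
  -- The Jacobi defect is a multiple of s r' in coordinate 4 and of s r in coordinate 5.
  leibniz_lie x y z := by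
    have h1 := c.left
    have h2 := c.right
    apply ext_six <;> simp [lie_apply, bracket, add_apply]
    · linear_combination (y 0 * z 1 * x 2 + x 0 * y 1 * z 2 + x 1 * y 2 * z 0 - x 0 * y 2 * z 1
        - x 1 * y 0 * z 2 - x 2 * y 1 * z 0) * -h2
    · linear_combination (y 0 * z 1 * x 2 + x 0 * y 1 * z 2 + x 1 * y 2 * z 0 - x 0 * y 2 * z 1
        - x 1 * y 0 * z 2 - x 2 * y 1 * z 0) * h1

noncomputable instance : LieAlgebra ℝ (TriangularAlgebra c) where
  lie_smul a x y := by
    apply ext_six <;> simp [lie_apply, bracket, smul_apply] <;> ring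

/-- The triangular product with the given parameters. -/
noncomputable def product (s t p q r : ℝ) : (Fin 3 → ℝ) →ₗ[ℝ] (Fin 3 → ℝ) →ₗ[ℝ] (Fin 3 → ℝ) :=
  LinearMap.mk₂ ℝ (fun x y => ![0, s * (x 0 * y 0),
      t * (x 0 * y 0) + p * (x 0 * y 1) + q * (x 1 * y 0) + r * (x 1 * y 1)])
    (fun x x' y => by ext k; fin_cases k <;> simp <;> ring)
    (fun a x y => by ext k; fin_cases k <;> simp <;> ring)
    (fun x y y' => by ext k; fin_cases k <;> simp <;> ring)
    (fun a x y => by ext k; fin_cases k <;> simp <;> ring)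

theorem product_apply (s t p q r : ℝ) (x y : Fin 3 → ℝ) : product s t p q r x y =
    ![0, s * (x 0 * y 0), t * (x 0 * y 0) + p * (x 0 * y 1) + q * (x 1 * y 0) + r * (x 1 * y 1)] :=
  rfl

theorem product_comm (s t p r : ℝ) (x y : Fin 3 → ℝ) :
    product s t p p r x y = product s t p p r y x := by
  simp only [product_apply]
  ext k
  fin_cases k <;> simp [mul_comm]
  ring

theorem isTriangular_product (s t p q r : ℝ) :
    IsTriangular (Pi.basisFun ℝ (Fin 3)) (product s t p q r) s t p q r where
  h00 := by ext k; fin_cases k <;> simp [product_apply]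
  h01 := by ext k; fin_cases k <;> simp [product_apply]
  h10 := by ext k; fin_cases k <;> simp [product_apply]
  h11 := by ext k; fin_cases k <;> simp [product_apply]
  right x := by ext k; fin_cases k <;> simp [product_apply]
  left x := by ext k; fin_cases k <;> simp [product_apply]

/-- The inclusion of the first subalgebra. -/
noncomputable def inclLeft : (Fin 3 → ℝ) →ₗ[ℝ] TriangularAlgebra c :=
  (Matrix.mulVecLin !![1, 0, 0; 0, 0, 0; 0, 0, 0; 0, 1, 0; 0, 0, 1; 0, 0, 0] :
    (Fin 3 → ℝ) →ₗ[ℝ] (Fin 6 → ℝ))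

/-- The inclusion of the second subalgebra. -/
noncomputable def inclRight : (Fin 3 → ℝ) →ₗ[ℝ] TriangularAlgebra c :=
  (Matrix.mulVecLin !![0, 0, 0; 1, 0, 0; 0, 1, 0; 0, 0, 0; 0, 0, 0; 0, 0, 1] :
    (Fin 3 → ℝ) →ₗ[ℝ] (Fin 6 → ℝ))

theorem inclLeft_apply (x : Fin 3 → ℝ) (k : Fin 6) :
    inclLeft c x k = ![x 0, 0, 0, x 1, x 2, 0] k := by
  change Matrix.mulVec !![1, 0, 0; 0, 0, 0; 0, 0, 0; 0, 1, 0; 0, 0, 1; 0, 0, 0] x k = _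
  fin_cases k <;> simp [Matrix.mulVec, dotProduct, Fin.sum_univ_three]

theorem inclRight_apply (x : Fin 3 → ℝ) (k : Fin 6) :
    inclRight c x k = ![0, x 0, x 1, 0, 0, x 2] k := by
  change Matrix.mulVec !![0, 0, 0; 1, 0, 0; 0, 1, 0; 0, 0, 0; 0, 0, 0; 0, 0, 1] x k = _
  fin_cases k <;> simp [Matrix.mulVec, dotProduct, Fin.sum_univ_three]

theorem sub_apply (x y : TriangularAlgebra c) (k : Fin 6) : (x - y) k = x k - y k := rfl

theorem isPencil : IsPencil (inclLeft c) (inclRight c) (product 0 c.t c.p c.q c.r)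
    (product c.s c.t' c.p' c.q' c.r') where
  inj x y h := by
    have hk : ∀ k, (inclLeft c x + inclRight c y) k = 0 := fun k => by rw [h, zero_apply]
    have h0 := hk 0
    have h1 := hk 1
    have h2 := hk 2
    have h3 := hk 3
    have h4 := hk 4
    have h5 := hk 5
    simp [add_apply, inclLeft_apply, inclRight_apply] at h0 h1 h2 h3 h4 h5
    constructor <;> ext k <;> fin_cases k <;> assumption
  surj z := ⟨![z 0, z 3, z 4], ![z 1, z 2, z 5], by
    apply ext_six <;> simp [add_apply, inclLeft_apply, inclRight_apply]⟩
  lie_ii x y := by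
    apply ext_six <;> simp [inclLeft_apply, product_apply, lie_apply, bracket]
    ring
  lie_jj x y := by
    apply ext_six <;> simp [inclRight_apply, product_apply, lie_apply, bracket] <;> grind
  lie_ij x y := by
    apply ext_six <;>
      simp [inclRight_apply, inclLeft_apply, sub_apply, product_apply, lie_apply, bracket] <;> grind

end TriangularAlgebra

theorem IsPencil.map {V g g' : Type*} [AddCommGroup V] [Module ℝ V] [LieRing g] [LieAlgebra ℝ g]
    [LieRing g'] [LieAlgebra ℝ g'] {i j : V →ₗ[ℝ] g} {A B : V →ₗ[ℝ] V →ₗ[ℝ] V}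
    (h : IsPencil i j A B) (f : g ≃ₗ⁅ℝ⁆ g') :
    IsPencil ((f : g →ₗ[ℝ] g') ∘ₗ i) ((f : g →ₗ[ℝ] g') ∘ₗ j) A B where
  inj x y hxy := h.inj x y (f.injective (by simpa using hxy))
  surj z := by
    obtain ⟨x, y, hxy⟩ := h.surj (f.symm z)
    exact ⟨x, y, by simpa using congrArg f hxy⟩
  lie_ii x y := by
    simpa [← LieEquiv.map_lie] using congrArg f (h.lie_ii x y)
  lie_jj x y := by
    simpa [← LieEquiv.map_lie] using congrArg f (h.lie_jj x y)
  lie_ij x y := by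
    simpa [← LieEquiv.map_lie] using congrArg f (h.lie_ij x y)

namespace TriangularAlgebra

variable {c : TriangularData} {g : Type*} [LieRing g] [LieAlgebra ℝ g]

theorem admits_RR (f : TriangularAlgebra c ≃ₗ⁅ℝ⁆ g) (h : c.p = c.q) (h' : c.p' = c.q') :
    AdmitsCPSOfType g .RR := by
  refine ((isPencil c).map f).admitsCPSOfType_RR (by simp) ?_ ?_
  · rw [h]
    exact product_comm _ _ _ _
  · rw [h']
    exact product_comm _ _ _ _

theorem admits_HR_left (f : TriangularAlgebra c ≃ₗ⁅ℝ⁆ g) (h : c.p ≠ c.q) (h' : c.p' = c.q') :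
    AdmitsCPSOfType g .HR := by
  refine ((isPencil c).map f).admitsCPSOfType_HR (isTriangular_product _ _ _ _ _) h ?_
  rw [h']
  exact product_comm _ _ _ _

theorem admits_HR_right (f : TriangularAlgebra c ≃ₗ⁅ℝ⁆ g) (h : c.p = c.q) (h' : c.p' ≠ c.q') :
    AdmitsCPSOfType g .HR := by
  refine ((isPencil c).map f).swap.admitsCPSOfType_HR (isTriangular_product _ _ _ _ _) h' ?_
  rw [h]
  exact product_comm _ _ _ _

/-- The pair A, A + B presents the same algebra, and both products then have the same non-zero value
of p - q. -/
theorem admits_HH_left (f : TriangularAlgebra c ≃ₗ⁅ℝ⁆ g) (h : c.p ≠ c.q) (h' : c.p' = c.q') :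
    AdmitsCPSOfType g .HH := by
  have hA := isTriangular_product 0 c.t c.p c.q c.r
  have hB := isTriangular_product c.s c.t' c.p' c.q' c.r'
  exact (((isPencil c).map f).mix (s := 1) (t := 0) (s' := 1) (t' := 1)
    (by norm_num)).admitsCPSOfType_HH (hA.mix hB 1 0) (by simpa using h) (hA.mix hB 1 1)
    (by simpa [h'] using h)

theorem admits_HH_right (f : TriangularAlgebra c ≃ₗ⁅ℝ⁆ g) (h : c.p = c.q) (h' : c.p' ≠ c.q') :
    AdmitsCPSOfType g .HH := by
  have hA := isTriangular_product 0 c.t c.p c.q c.r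
  have hB := isTriangular_product c.s c.t' c.p' c.q' c.r'
  exact (((isPencil c).map f).mix (s := 1) (t := 1) (s' := 0) (t' := 1)
    (by norm_num)).admitsCPSOfType_HH (hA.mix hB 1 1) (by simpa [h] using h') (hA.mix hB 0 1)
    (by simpa using h')

end TriangularAlgebra

namespace TriangularAlgebra

/-- The defining coordinates. -/
noncomputable def coord (c : TriangularData) : (Fin 6 → ℝ) ≃ₗ[ℝ] TriangularAlgebra c :=
  LinearEquiv.refl ℝ _

theorem lie_coord (c : TriangularData) (X Y : Fin 6 → ℝ) :
    ⁅coord c X, coord c Y⁆ = coord c (bracket c X Y) := rfl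

theorem nonempty_lieEquiv {c : TriangularData} {n : Fin 15} (M : Matrix (Fin 6) (Fin 6) ℝ)
    (hinj : ∀ X, M.mulVec X = 0 → X = 0)
    (hM : ∀ X Y k, M.mulVec (bracket c X Y) k =
      -ListedAlgebra.dForm n k (M.mulVec X) (M.mulVec Y)) :
    Nonempty (TriangularAlgebra c ≃ₗ⁅ℝ⁆ ListedAlgebra n) :=
  ListedAlgebra.nonempty_lieEquiv_of_coord (lie_coord c) M hinj hM

theorem lie_coord_ext {c : TriangularData} (hs : c.s = 1) (ht : c.t = 0) (hr : c.r = 0)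
    (ht' : c.t' = 0) (hr' : c.r' = 0) (X Y : Fin 6 → ℝ) :
    ⁅coord c X, coord c Y⁆ = coord c (extBracket c.p c.p' c.q c.q' X Y) := by
  rw [lie_coord]
  congr 1
  ext k
  fin_cases k <;> simp [bracket, extBracket, hs, ht, hr, ht', hr'] <;> ring

/-- In these realisations the parameters are listed as s, t, p, q, r, t', p', q', r', the value of s
for the first product being 0, and the rows of the matrix are the listed dual basis in the
coordinates of the triangular algebra. -/
theorem admits_RR_zero : AdmitsCPSOfType (ListedAlgebra 0) .RR := by
  obtain ⟨f⟩ := nonempty_lieEquiv (c := ⟨0, 0, 0, 0, 0, 0, 0, 0, 0, by norm_num, by norm_num⟩)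
    (n := 0)
    !![1,0,0,0,0,0; 0,1,0,0,0,0; 0,0,1,0,0,0; 0,0,0,1,0,0; 0,0,0,0,1,0; 0,0,0,0,0,1]
    (fun X hX => by
      obtain ⟨h0, h1, h2, h3, h4, h5⟩ := six_eqns hX
      simp [Matrix.mulVec, dotProduct, Fin.sum_univ_six] at h0 h1 h2 h3 h4 h5
      apply eq_zero_of_six <;> linarith)
    (fun X Y => by
      apply forall_six <;>
        simp [ListedAlgebra.dForm, differentials, wedge, label, bracket, Matrix.mulVec, dotProduct,
          Fin.sum_univ_six])
  exact admits_RR f rfl rfl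

theorem admits_RR_one : AdmitsCPSOfType (ListedAlgebra 1) .RR := by
  obtain ⟨f⟩ := nonempty_lieEquiv (c := ⟨0, 1, 0, 0, 0, 0, 0, 0, 0, by norm_num, by norm_num⟩)
    (n := 1)
    !![1,0,0,0,0,0; 0,1,0,0,0,0; 0,0,1,0,0,0; 0,0,0,1,0,0; 0,0,0,0,1,0; 0,0,0,0,0,-1]
    (fun X hX => by
      obtain ⟨h0, h1, h2, h3, h4, h5⟩ := six_eqns hX
      simp [Matrix.mulVec, dotProduct, Fin.sum_univ_six] at h0 h1 h2 h3 h4 h5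
      apply eq_zero_of_six <;> linarith)
    (fun X Y => by
      apply forall_six <;>
        simp [ListedAlgebra.dForm, differentials, wedge, label, bracket, Matrix.mulVec, dotProduct,
          Fin.sum_univ_six])
  exact admits_RR f rfl rfl

theorem admits_RR_two : AdmitsCPSOfType (ListedAlgebra 2) .RR := by
  obtain ⟨f⟩ := nonempty_lieEquiv (c := ⟨0, 1, 0, 0, 1, 0, 0, 0, 0, by norm_num, by norm_num⟩)
    (n := 2)
    !![1,0,0,0,0,0; 0,1,0,0,0,0; 0,0,1,0,0,0; 0,0,0,-1,0,0; 0,0,0,0,1,0; 0,0,0,0,0,-1]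
    (fun X hX => by
      obtain ⟨h0, h1, h2, h3, h4, h5⟩ := six_eqns hX
      simp [Matrix.mulVec, dotProduct, Fin.sum_univ_six] at h0 h1 h2 h3 h4 h5
      apply eq_zero_of_six <;> linarith)
    (fun X Y => by
      apply forall_six <;>
        simp [ListedAlgebra.dForm, differentials, wedge, label, bracket, Matrix.mulVec, dotProduct,
          Fin.sum_univ_six]
      ring)
  exact admits_RR f rfl rfl

theorem admits_RR_three : AdmitsCPSOfType (ListedAlgebra 3) .RR := by
  obtain ⟨f⟩ := nonempty_lieEquiv (c := ⟨1, 0, 0, 0, 0, 0, 1, 1, 0, by norm_num, by norm_num⟩)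
    (n := 3)
    !![1,0,0,0,0,0; 0,1,0,0,0,0; 0,0,0,0,0,1; 0,0,-1,0,0,0; 0,0,0,1,0,0; 0,0,0,0,-1,0]
    (fun X hX => by
      obtain ⟨h0, h1, h2, h3, h4, h5⟩ := six_eqns hX
      simp [Matrix.mulVec, dotProduct, Fin.sum_univ_six] at h0 h1 h2 h3 h4 h5
      apply eq_zero_of_six <;> linarith)
    (fun X Y => by
      apply forall_six <;>
        simp [ListedAlgebra.dForm, differentials, wedge, label, bracket, Matrix.mulVec, dotProduct,
          Fin.sum_univ_six]
      ring)
  exact admits_RR f rfl rfl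

theorem admits_RR_five : AdmitsCPSOfType (ListedAlgebra 5) .RR := by
  obtain ⟨f⟩ := nonempty_lieEquiv (c := ⟨0, 1, 0, 0, -1, 0, 1, 1, 0, by norm_num, by norm_num⟩)
    (n := 5)
    !![1,0,0,0,0,0; 0,0,0,1,0,0; 0,0,1,0,0,0; 0,-1,0,0,0,0; 0,0,0,0,1,0; 0,0,0,0,0,1]
    (fun X hX => by
      obtain ⟨h0, h1, h2, h3, h4, h5⟩ := six_eqns hX
      simp [Matrix.mulVec, dotProduct, Fin.sum_univ_six] at h0 h1 h2 h3 h4 h5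
      apply eq_zero_of_six <;> linarith)
    (fun X Y => by
      apply forall_six <;>
        simp [ListedAlgebra.dForm, differentials, wedge, label, bracket, Matrix.mulVec, dotProduct,
          Fin.sum_univ_six] <;> ring)
  exact admits_RR f rfl rfl

theorem admits_RR_six : AdmitsCPSOfType (ListedAlgebra 6) .RR := by
  obtain ⟨f⟩ := nonempty_lieEquiv (c := ⟨0, 1, 0, 0, 0, 0, 1, 1, 0, by norm_num, by norm_num⟩)
    (n := 6)
    !![1,0,0,0,0,0; 0,1,0,0,0,0; 0,0,0,-1,0,0; 0,0,1,0,0,0; 0,0,0,0,0,-1; 0,0,0,0,1,0]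
    (fun X hX => by
      obtain ⟨h0, h1, h2, h3, h4, h5⟩ := six_eqns hX
      simp [Matrix.mulVec, dotProduct, Fin.sum_univ_six] at h0 h1 h2 h3 h4 h5
      apply eq_zero_of_six <;> linarith)
    (fun X Y => by
      apply forall_six <;>
        simp [ListedAlgebra.dForm, differentials, wedge, label, bracket, Matrix.mulVec, dotProduct,
          Fin.sum_univ_six]
      ring)
  exact admits_RR f rfl rfl

theorem admits_RR_seven : AdmitsCPSOfType (ListedAlgebra 7) .RR := by
  obtain ⟨f⟩ := nonempty_lieEquiv (c := ⟨0, 1, 0, 0, 0, 0, 0, 0, -1, by norm_num, by norm_num⟩)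
    (n := 7)
    !![1,0,0,0,0,0; 0,1,0,0,0,0; 0,0,1,0,0,0; 0,0,0,1,0,0; 0,0,0,0,0,-1; 0,0,0,0,1,0]
    (fun X hX => by
      obtain ⟨h0, h1, h2, h3, h4, h5⟩ := six_eqns hX
      simp [Matrix.mulVec, dotProduct, Fin.sum_univ_six] at h0 h1 h2 h3 h4 h5
      apply eq_zero_of_six <;> linarith)
    (fun X Y => by
      apply forall_six <;>
        simp [ListedAlgebra.dForm, differentials, wedge, label, bracket, Matrix.mulVec, dotProduct,
          Fin.sum_univ_six])
  exact admits_RR f rfl rfl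

theorem admits_H_four : AdmitsCPSOfType (ListedAlgebra 4) .HR ∧
    AdmitsCPSOfType (ListedAlgebra 4) .HH := by
  obtain ⟨f⟩ := nonempty_lieEquiv (c := ⟨0, 0, 1, 0, 0, 0, 0, 0, 0, by norm_num, by norm_num⟩)
    (n := 4)
    !![1,0,0,0,0,0; 0,0,0,1,0,0; 0,0,1,0,0,0; 0,1,0,0,0,0; 0,0,0,0,-1,0; 0,0,0,0,0,-1]
    (fun X hX => by
      obtain ⟨h0, h1, h2, h3, h4, h5⟩ := six_eqns hX
      simp [Matrix.mulVec, dotProduct, Fin.sum_univ_six] at h0 h1 h2 h3 h4 h5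
      apply eq_zero_of_six <;> linarith)
    (fun X Y => by
      apply forall_six <;>
        simp [ListedAlgebra.dForm, differentials, wedge, label, bracket, Matrix.mulVec, dotProduct,
          Fin.sum_univ_six])
  exact ⟨admits_HR_left f (by norm_num) rfl, admits_HH_left f (by norm_num) rfl⟩

theorem admits_H_five : AdmitsCPSOfType (ListedAlgebra 5) .HR ∧
    AdmitsCPSOfType (ListedAlgebra 5) .HH := by
  obtain ⟨f⟩ := nonempty_lieEquiv (c := ⟨0, 1, 1, 0, -1, 0, 1, 1, 1, by norm_num, by norm_num⟩)
    (n := 5)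
    !![0,1,1,0,0,0; 0,0,1,-1,0,0; 0,0,0,1,0,0; -1,0,0,0,0,0; 0,0,0,0,-1,0; 0,0,0,0,0,-1]
    (fun X hX => by
      obtain ⟨h0, h1, h2, h3, h4, h5⟩ := six_eqns hX
      simp [Matrix.mulVec, dotProduct, Fin.sum_univ_six] at h0 h1 h2 h3 h4 h5
      apply eq_zero_of_six <;> linarith)
    (fun X Y => by
      apply forall_six <;>
        simp [ListedAlgebra.dForm, differentials, wedge, label, bracket, Matrix.mulVec, dotProduct,
          Fin.sum_univ_six] <;> ring)
  exact ⟨admits_HR_left f (by norm_num) rfl, admits_HH_left f (by norm_num) rfl⟩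

theorem admits_H_six : AdmitsCPSOfType (ListedAlgebra 6) .HR ∧
    AdmitsCPSOfType (ListedAlgebra 6) .HH := by
  obtain ⟨f⟩ := nonempty_lieEquiv (c := ⟨0, 1, 1, 0, 0, 0, 1, 1, 1, by norm_num, by norm_num⟩)
    (n := 6)
    !![1,0,0,0,0,0; 0,1,1,0,0,0; 0,0,0,1,0,0; 0,0,-1,1,0,0; 0,0,0,0,0,-1; 0,0,0,0,-1,0]
    (fun X hX => by
      obtain ⟨h0, h1, h2, h3, h4, h5⟩ := six_eqns hX
      simp [Matrix.mulVec, dotProduct, Fin.sum_univ_six] at h0 h1 h2 h3 h4 h5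
      apply eq_zero_of_six <;> linarith)
    (fun X Y => by
      apply forall_six <;>
        simp [ListedAlgebra.dForm, differentials, wedge, label, bracket, Matrix.mulVec, dotProduct,
          Fin.sum_univ_six] <;> ring)
  exact ⟨admits_HR_left f (by norm_num) rfl, admits_HH_left f (by norm_num) rfl⟩

theorem admits_H_seven : AdmitsCPSOfType (ListedAlgebra 7) .HR ∧
    AdmitsCPSOfType (ListedAlgebra 7) .HH := by
  obtain ⟨f⟩ := nonempty_lieEquiv (c := ⟨0, 0, 0, -1, 1, 1, 0, 0, 0, by norm_num, by norm_num⟩)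
    (n := 7)
    !![1,0,0,0,0,0; 0,-1,0,1,0,0; 0,1,-1,0,0,0; 0,0,0,1,0,0; 0,0,0,0,-1,0; 0,0,0,0,0,-1]
    (fun X hX => by
      obtain ⟨h0, h1, h2, h3, h4, h5⟩ := six_eqns hX
      simp [Matrix.mulVec, dotProduct, Fin.sum_univ_six] at h0 h1 h2 h3 h4 h5
      apply eq_zero_of_six <;> linarith)
    (fun X Y => by
      apply forall_six <;>
        simp [ListedAlgebra.dForm, differentials, wedge, label, bracket, Matrix.mulVec, dotProduct,
          Fin.sum_univ_six] <;> ring)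
  exact ⟨admits_HR_left f (by norm_num) rfl, admits_HH_left f (by norm_num) rfl⟩

theorem admits_H_eight : AdmitsCPSOfType (ListedAlgebra 8) .HR ∧
    AdmitsCPSOfType (ListedAlgebra 8) .HH := by
  let c : TriangularData := ⟨1, 0, -1, 0, 0, 0, 0, 0, 0, by norm_num, by norm_num⟩
  obtain ⟨f⟩ := ext_iso_eight (by norm_num) (Ψ := coord c)
    (lie_coord_ext rfl rfl rfl rfl rfl)
  exact ⟨admits_HR_left f (by norm_num [c]) rfl, admits_HH_left f (by norm_num [c]) rfl⟩

theorem admits_H_nine : AdmitsCPSOfType (ListedAlgebra 9) .HR ∧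
    AdmitsCPSOfType (ListedAlgebra 9) .HH := by
  let c : TriangularData := ⟨1, 0, 0, 0, 0, 0, 0, 1, 0, by norm_num, by norm_num⟩
  obtain ⟨f⟩ := ext_iso_nine one_ne_zero (Ψ := coord c)
    (lie_coord_ext rfl rfl rfl rfl rfl)
  exact ⟨admits_HR_right f rfl (by norm_num [c]), admits_HH_right f rfl (by norm_num [c])⟩

theorem admits_H_ten : AdmitsCPSOfType (ListedAlgebra 10) .HR ∧
    AdmitsCPSOfType (ListedAlgebra 10) .HH := by
  let c : TriangularData := ⟨1, 0, 0, 1, 0, 0, 0, 0, 0, by norm_num, by norm_num⟩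
  obtain ⟨f⟩ := ext_iso_ten one_ne_zero (Ψ := coord c)
    (lie_coord_ext rfl rfl rfl rfl rfl)
  exact ⟨admits_HR_left f (by norm_num [c]) rfl, admits_HH_left f (by norm_num [c]) rfl⟩

theorem admits_H_eleven : AdmitsCPSOfType (ListedAlgebra 11) .HR ∧
    AdmitsCPSOfType (ListedAlgebra 11) .HH := by
  let c : TriangularData := ⟨1, 0, 1, 0, 0, 0, 1, 1, 0, by norm_num, by norm_num⟩
  obtain ⟨f⟩ := ext_iso_eleven one_ne_zero one_ne_zero (Ψ := coord c)
    (lie_coord_ext rfl rfl rfl rfl rfl)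
  exact ⟨admits_HR_left f (by norm_num [c]) rfl, admits_HH_left f (by norm_num [c]) rfl⟩

theorem admits_H_twelve : AdmitsCPSOfType (ListedAlgebra 12) .HR ∧
    AdmitsCPSOfType (ListedAlgebra 12) .HH := by
  let c : TriangularData := ⟨1, 0, 2, 1, 0, 0, 1, 1, 0, by norm_num, by norm_num⟩
  obtain ⟨f⟩ := ext_iso_twelve one_ne_zero (by norm_num) (by norm_num) (Ψ := coord c)
    (lie_coord_ext rfl rfl rfl rfl rfl)
  exact ⟨admits_HR_left f (by norm_num [c]) rfl, admits_HH_left f (by norm_num [c]) rfl⟩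

theorem admits_H_thirteen : AdmitsCPSOfType (ListedAlgebra 13) .HR ∧
    AdmitsCPSOfType (ListedAlgebra 13) .HH := by
  let c : TriangularData := ⟨1, 0, 0, 0, 0, 0, -1, 1, 0, by norm_num, by norm_num⟩
  obtain ⟨f⟩ := ext_iso_thirteen (by norm_num) one_ne_zero (by norm_num) (Ψ := coord c)
    (lie_coord_ext rfl rfl rfl rfl rfl)
  exact ⟨admits_HR_right f rfl (by norm_num [c]), admits_HH_right f rfl (by norm_num [c])⟩

theorem admits_H_fourteen : AdmitsCPSOfType (ListedAlgebra 14) .HR ∧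
    AdmitsCPSOfType (ListedAlgebra 14) .HH := by
  let c : TriangularData := ⟨1, 0, 1, 2, 0, 0, 0, 0, 0, by norm_num, by norm_num⟩
  have hc : ∀ X Y, ⁅coord c X, coord c Y⁆ = coord c (extBracket 1 0 (2 * 1) (2 * 0) X Y) :=
    fun X Y => by rw [mul_one, mul_zero]; exact lie_coord_ext rfl rfl rfl rfl rfl X Y
  obtain ⟨f⟩ := ext_iso_fourteen one_ne_zero two_ne_zero (by norm_num) hc
  exact ⟨admits_HR_left f (by norm_num [c]) rfl, admits_HH_left f (by norm_num [c]) rfl⟩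

end TriangularAlgebra

open TriangularAlgebra in
theorem ListedAlgebra.admitsCPSOfType_of_tableEntry {n : Fin 15} {t : DoubleType}
    (h : tableEntry n t = true) : AdmitsCPSOfType (ListedAlgebra n) t := by
  cases t
  · fin_cases n
    · exact admits_RR_zero
    · exact admits_RR_one
    · exact admits_RR_two
    · exact admits_RR_three
    · simp [tableEntry] at h
    · exact admits_RR_five
    · exact admits_RR_six
    · exact admits_RR_seven
    · simp [tableEntry] at h
    · simp [tableEntry] at h
    · simp [tableEntry] at h
    · simp [tableEntry] at h
    · simp [tableEntry] at h
    · simp [tableEntry] at h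
    · simp [tableEntry] at h
  · fin_cases n
    · simp [tableEntry] at h
    · simp [tableEntry] at h
    · simp [tableEntry] at h
    · simp [tableEntry] at h
    · exact admits_H_four.1
    · exact admits_H_five.1
    · exact admits_H_six.1
    · exact admits_H_seven.1
    · exact admits_H_eight.1
    · exact admits_H_nine.1
    · exact admits_H_ten.1
    · exact admits_H_eleven.1
    · exact admits_H_twelve.1
    · exact admits_H_thirteen.1
    · exact admits_H_fourteen.1
  · fin_cases n
    · simp [tableEntry] at h
    · simp [tableEntry] at h
    · simp [tableEntry] at h
    · simp [tableEntry] at h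
    · exact admits_H_four.2
    · exact admits_H_five.2
    · exact admits_H_six.2
    · exact admits_H_seven.2
    · exact admits_H_eight.2
    · exact admits_H_nine.2
    · exact admits_H_ten.2
    · exact admits_H_eleven.2
    · exact admits_H_twelve.2
    · exact admits_H_thirteen.2
    · exact admits_H_fourteen.2

/-! ### Isomorphism invariants defined by rank bounds. -/

section SpanRank

/-- The values of `F` lie in a subspace spanned by `k` vectors. -/
def SpanRankLE {α M : Type*} [AddCommGroup M] [Module ℝ M] (k : ℕ) (F : α → M) : Prop :=
  ∃ w : Fin k → M, ∀ a, F a ∈ Submodule.span ℝ (Set.range w)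

namespace SpanRankLE

variable {α β M N : Type*} [AddCommGroup M] [Module ℝ M] [AddCommGroup N] [Module ℝ N] {k : ℕ}
  {F : α → M}

theorem map (h : SpanRankLE k F) (f : M →ₗ[ℝ] N) {G : β → N} (u : β → α)
    (hG : ∀ b, G b = f (F (u b))) : SpanRankLE k G := by
  obtain ⟨w, hw⟩ := h
  refine ⟨f ∘ w, fun b => ?_⟩
  rw [hG, Set.range_comp, ← Submodule.map_span]
  exact Submodule.mem_map_of_mem (hw _)

theorem det_eq_zero {F : α → Fin (k + 1) → ℝ} (h : SpanRankLE k F) (a : Fin (k + 1) → α) :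
    Matrix.det (Matrix.of fun i => F (a i)) = 0 := by
  obtain ⟨w, hw⟩ := h
  by_contra hd
  have hli := Matrix.linearIndependent_rows_of_det_ne_zero hd
  have h1 : LinearIndependent ℝ fun i => (⟨F (a i), hw (a i)⟩ : Submodule.span ℝ (Set.range w)) :=
    LinearIndependent.of_comp (Submodule.subtype _) hli
  have h2 := h1.fintype_card_le_finrank
  have h3 := finrank_range_le_card (R := ℝ) w
  rw [Set.finrank] at h3
  simp only [Fintype.card_fin] at h2 h3
  omega

end SpanRankLE

theorem spanRankLE_one_of {α M : Type*} [AddCommGroup M] [Module ℝ M] {F : α → M} (w : M)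
    (c : α → ℝ) (h : ∀ a, F a = c a • w) : SpanRankLE 1 F := by
  refine ⟨![w], fun a => ?_⟩
  rw [h]
  exact Submodule.smul_mem _ _ (Submodule.subset_span ⟨0, rfl⟩)

theorem spanRankLE_two_of {α M : Type*} [AddCommGroup M] [Module ℝ M] {F : α → M} (w w' : M)
    (c c' : α → ℝ) (h : ∀ a, F a = c a • w + c' a • w') : SpanRankLE 2 F := by
  refine ⟨![w, w'], fun a => ?_⟩
  rw [h]
  exact Submodule.add_mem _ (Submodule.smul_mem _ _ (Submodule.subset_span ⟨0, rfl⟩))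
    (Submodule.smul_mem _ _ (Submodule.subset_span ⟨1, rfl⟩))

namespace ListedAlgebra

variable {n : Fin 15} {α : Type*} {k : ℕ} {F : α → ListedAlgebra n}

/-- The coordinates with the given indices. -/
def coords (n : Fin 15) (κ : Fin k → Fin 6) : ListedAlgebra n →ₗ[ℝ] (Fin k → ℝ) :=
  (LinearMap.funLeft ℝ ℝ κ : (Fin 6 → ℝ) →ₗ[ℝ] (Fin k → ℝ))

theorem det_eq_zero (h : SpanRankLE k F) (a : Fin (k + 1) → α) (κ : Fin (k + 1) → Fin 6) :
    Matrix.det (Matrix.of fun i j => F (a i) (κ j)) = 0 :=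
  (h.map (G := fun b j => F b (κ j)) (coords n κ) id fun _ => rfl).det_eq_zero a

/-- The standard basis vectors. -/
def stdVec (n : Fin 15) (l : Fin 6) : ListedAlgebra n := fun m => if m = l then 1 else 0

theorem stdVec_apply (l m : Fin 6) : stdVec n l m = if m = l then 1 else 0 := rfl

theorem spanRankLE_of_coords (κ : Fin k → Fin 6)
    (h : ∀ a l, F a l = 0 ∨ ∃ m, κ m = l) : SpanRankLE k F := by
  refine ⟨fun m => stdVec n (κ m), fun a => ?_⟩
  have hF : F a = ∑ l, F a l • stdVec n l := by
    have h1 : ∀ x : Fin 6 → ℝ, x = ∑ l, x l • (fun m => if m = l then (1 : ℝ) else 0) := by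
      intro x
      ext m
      simp [Finset.sum_apply]
    exact h1 (F a)
  rw [hF]
  refine Submodule.sum_mem _ fun l _ => ?_
  rcases h a l with h0 | ⟨m, rfl⟩
  · rw [h0, zero_smul]
    exact Submodule.zero_mem _
  · exact Submodule.smul_mem _ _ (Submodule.subset_span ⟨m, rfl⟩)

end ListedAlgebra

section Invariants

variable (g : Type*) {g' : Type*} [LieRing g] [LieAlgebra ℝ g] [LieRing g'] [LieAlgebra ℝ g']

/-- The derived algebra has dimension at most `k`. -/
def DerivedRankLE (k : ℕ) : Prop := SpanRankLE k fun z : g × g => ⁅z.1, z.2⁆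

/-- The second term of the lower central series has dimension at most `k`. -/
def TripleRankLE (k : ℕ) : Prop := SpanRankLE k fun z : g × g × g => ⁅z.1, ⁅z.2.1, z.2.2⁆⁆

variable {g}

/-- The rank of `ad x` is at most `k`. -/
def AdRankLE (k : ℕ) (x : g) : Prop := SpanRankLE k fun y : g => ⁅x, y⁆

theorem DerivedRankLE.of_equiv {k : ℕ} (h : DerivedRankLE g k) (f : g ≃ₗ⁅ℝ⁆ g') :
    DerivedRankLE g' k :=
  SpanRankLE.map h (f : g →ₗ[ℝ] g') (fun z => (f.symm z.1, f.symm z.2)) fun z => by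
    simp [LieEquiv.map_lie]

theorem TripleRankLE.of_equiv {k : ℕ} (h : TripleRankLE g k) (f : g ≃ₗ⁅ℝ⁆ g') :
    TripleRankLE g' k :=
  SpanRankLE.map h (f : g →ₗ[ℝ] g') (fun z => (f.symm z.1, f.symm z.2.1, f.symm z.2.2)) fun z => by
    simp [LieEquiv.map_lie]

theorem AdRankLE.of_equiv {k : ℕ} {x : g} (h : AdRankLE k x) (f : g ≃ₗ⁅ℝ⁆ g') :
    AdRankLE k (f x) :=
  SpanRankLE.map h (f : g →ₗ[ℝ] g') f.symm fun z => by
    simp [LieEquiv.map_lie]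

variable (g)

/-- The elements `x` with `ad x` of rank at most `k` are closed under addition. -/
def AdRankAddClosed (k : ℕ) : Prop :=
  ∀ x y : g, AdRankLE k x → AdRankLE k y → AdRankLE k (x + y)

/-- If the rank of `ad x` is at most `k`, then it is at most `l`. -/
def AdRankGap (k l : ℕ) : Prop := ∀ x : g, AdRankLE k x → AdRankLE l x

/-- The elements `x` with `ad x` of rank at most one, and one more element, span the algebra. -/
def AdRankOneCodimOne : Prop := ∃ x : g, ∀ y, ∃ c : ℝ, AdRankLE 1 (y - c • x)

/-- The centralizers of non-central elements are abelian. -/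
def CommutativeTransitive : Prop :=
  ∀ x y z w : g, ⁅x, w⁆ ≠ 0 → ⁅x, y⁆ = 0 → ⁅x, z⁆ = 0 → ⁅y, z⁆ = 0

variable {g}

theorem AdRankAddClosed.of_equiv {k : ℕ} (h : AdRankAddClosed g k) (f : g ≃ₗ⁅ℝ⁆ g') :
    AdRankAddClosed g' k := fun x y hx hy => by
  simpa using (h _ _ (hx.of_equiv f.symm) (hy.of_equiv f.symm)).of_equiv f

theorem AdRankGap.of_equiv {k l : ℕ} (h : AdRankGap g k l) (f : g ≃ₗ⁅ℝ⁆ g') :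
    AdRankGap g' k l := fun x hx => by
  simpa using (h _ (hx.of_equiv f.symm)).of_equiv f

theorem AdRankOneCodimOne.of_equiv (h : AdRankOneCodimOne g) (f : g ≃ₗ⁅ℝ⁆ g') :
    AdRankOneCodimOne g' := by
  obtain ⟨x, hx⟩ := h
  refine ⟨f x, fun y => ?_⟩
  obtain ⟨c, hc⟩ := hx (f.symm y)
  exact ⟨c, by simpa using hc.of_equiv f⟩

theorem CommutativeTransitive.of_equiv (h : CommutativeTransitive g) (f : g ≃ₗ⁅ℝ⁆ g') :
    CommutativeTransitive g' := by
  have key : ∀ a b : g', ⁅f.symm a, f.symm b⁆ = 0 ↔ ⁅a, b⁆ = 0 := fun a b => by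
    rw [← LieEquiv.map_lie]
    exact map_eq_zero_iff f.symm f.symm.injective
  intro x y z w hw hy hz
  rw [← key] at hy hz ⊢
  exact h _ _ _ (f.symm w) (fun h0 => hw ((key x w).mp h0)) hy hz

end Invariants

end SpanRank

/-! ### Values of the invariants on the listed algebras. -/

namespace ListedAlgebra

theorem sub_apply {n : Fin 15} (x y : ListedAlgebra n) (k : Fin 6) : (x - y) k = x k - y k := rfl

theorem apply_eq_zero {n : Fin 15} {α : Type*} {F : α → ListedAlgebra n} (h : SpanRankLE 0 F)
    (a : α) (k : Fin 6) : F a k = 0 := by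
  simpa using det_eq_zero h ![a] ![k]

theorem minor_two {n : Fin 15} {α : Type*} {F : α → ListedAlgebra n} (h : SpanRankLE 1 F)
    (a b : α) (k l : Fin 6) : F a k * F b l - F a l * F b k = 0 := by
  simpa [Matrix.det_fin_two] using det_eq_zero h ![a, b] ![k, l]

theorem minor_three {n : Fin 15} {α : Type*} {F : α → ListedAlgebra n} (h : SpanRankLE 2 F)
    (a b c : α) (k l m : Fin 6) :
    F a k * (F b l * F c m - F b m * F c l) - F a l * (F b k * F c m - F b m * F c k)
      + F a m * (F b k * F c l - F b l * F c k) = 0 := by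
  have h1 := det_eq_zero h ![a, b, c] ![k, l, m]
  rw [Matrix.det_fin_three] at h1
  change F a k * F b l * F c m - F a k * F b m * F c l - F a l * F b k * F c m
    + F a l * F b m * F c k + F a m * F b k * F c l - F a m * F b l * F c k = 0 at h1
  linear_combination h1

/-- An element with given coordinates. -/
def vec (n : Fin 15) (u : Fin 6 → ℝ) : ListedAlgebra n := u

theorem vec_apply {n : Fin 15} (u : Fin 6 → ℝ) (l : Fin 6) : vec n u l = u l := rfl

theorem lie_apply_eq_zero {n : Fin 15} {l : Fin 6} (h : differentials n l = [])
    (x y : ListedAlgebra n) : ⁅x, y⁆ l = 0 := by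
  rw [lie_apply]
  simp [dForm, h]

theorem lie_lie_apply_eq_zero {n : Fin 15} {l : Fin 6}
    (h : ∀ p ∈ differentials n l, differentials n p.1 = [] ∧ differentials n p.2 = [])
    (x y z : ListedAlgebra n) : ⁅x, ⁅y, z⁆⁆ l = 0 := by
  rw [lie_apply, neg_eq_zero]
  apply List.sum_eq_zero
  intro c hc
  obtain ⟨p, hp, rfl⟩ := List.mem_map.mp hc
  obtain ⟨h1, h2⟩ := h p hp
  rw [lie_apply_eq_zero h1, lie_apply_eq_zero h2, mul_zero, mul_zero, sub_zero]

theorem derivedRankLE_one {n : Fin 15} (hn : n < 3) : DerivedRankLE (ListedAlgebra n) 1 := by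
  have key : ∀ n : Fin 15, n < 3 → ∀ l, differentials n l = [] ∨ ∃ m, ![5] m = l := by decide
  exact spanRankLE_of_coords ![5] fun z l =>
    (key n hn l).imp_left fun h => lie_apply_eq_zero h _ _

theorem derivedRankLE_two {n : Fin 15} (hn : n < 8) : DerivedRankLE (ListedAlgebra n) 2 := by
  have key : ∀ n : Fin 15, n < 8 → ∀ l, differentials n l = [] ∨ ∃ m, ![4, 5] m = l := by decide
  exact spanRankLE_of_coords ![4, 5] fun z l =>
    (key n hn l).imp_left fun h => lie_apply_eq_zero h _ _

theorem tripleRankLE_zero {n : Fin 15} (hn : n ∈ ({0, 1, 2, 4, 5, 6, 7, 9} : Finset (Fin 15))) :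
    TripleRankLE (ListedAlgebra n) 0 := by
  have key : ∀ n ∈ ({0, 1, 2, 4, 5, 6, 7, 9} : Finset (Fin 15)), ∀ l, ∀ p ∈ differentials n l,
      differentials n p.1 = [] ∧ differentials n p.2 = [] := by decide
  exact spanRankLE_of_coords ![] fun z l =>
    Or.inl (lie_lie_apply_eq_zero (key n hn l) _ _ _)

theorem tripleRankLE_one {n : Fin 15} (hn : n ∉ ({10, 12, 14} : Finset (Fin 15))) :
    TripleRankLE (ListedAlgebra n) 1 := by
  have key : ∀ n ∉ ({10, 12, 14} : Finset (Fin 15)), ∀ l, (∀ p ∈ differentials n l,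
      differentials n p.1 = [] ∧ differentials n p.2 = []) ∨ ∃ m, ![5] m = l := by decide
  exact spanRankLE_of_coords ![5] fun z l =>
    (key n hn l).imp_left fun h => lie_lie_apply_eq_zero h _ _ _

theorem not_derivedRankLE_zero {n : Fin 15} (hn : n ∈ ({1, 2} : Finset (Fin 15))) :
    ¬ DerivedRankLE (ListedAlgebra n) 0 := by
  intro h
  fin_cases n
  · simp at hn
  · simpa [ListedAlgebra.lie_apply, ListedAlgebra.dForm, differentials, wedge, label,
      stdVec_apply] using
      apply_eq_zero h (stdVec _ 0, stdVec _ 1) 5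
  · simpa [ListedAlgebra.lie_apply, ListedAlgebra.dForm, differentials, wedge, label,
      stdVec_apply] using
      apply_eq_zero h (stdVec _ 0, stdVec _ 1) 5
  · simp at hn
  · simp at hn
  · simp at hn
  · simp at hn
  · simp at hn
  · simp at hn
  · simp at hn
  · simp at hn
  · simp at hn
  · simp at hn
  · simp at hn
  · simp at hn

theorem not_derivedRankLE_one {n : Fin 15} (hn : 2 < n) : ¬ DerivedRankLE (ListedAlgebra n) 1 := by
  intro h
  fin_cases n
  · simp at hn
  · simp at hn
  · simp at hn
  · simpa [ListedAlgebra.lie_apply, ListedAlgebra.dForm, differentials,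
      wedge, label, stdVec_apply] using
      minor_two h (stdVec _ 0, stdVec _ 1) (stdVec _ 0, stdVec _ 3) 4 5
  · simpa [ListedAlgebra.lie_apply, ListedAlgebra.dForm, differentials,
      wedge, label, stdVec_apply] using
      minor_two h (stdVec _ 0, stdVec _ 1) (stdVec _ 0, stdVec _ 2) 4 5
  · simpa [ListedAlgebra.lie_apply, ListedAlgebra.dForm, differentials,
      wedge, label, stdVec_apply] using
      minor_two h (stdVec _ 0, stdVec _ 2) (stdVec _ 0, stdVec _ 3) 4 5
  · simpa [ListedAlgebra.lie_apply, ListedAlgebra.dForm, differentials,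
      wedge, label, stdVec_apply] using
      minor_two h (stdVec _ 0, stdVec _ 1) (stdVec _ 0, stdVec _ 3) 4 5
  · simpa [ListedAlgebra.lie_apply, ListedAlgebra.dForm, differentials,
      wedge, label, stdVec_apply] using
      minor_two h (stdVec _ 0, stdVec _ 1) (stdVec _ 2, stdVec _ 3) 4 5
  · simpa [ListedAlgebra.lie_apply, ListedAlgebra.dForm, differentials,
      wedge, label, stdVec_apply] using
      minor_two h (stdVec _ 0, stdVec _ 2) (stdVec _ 0, stdVec _ 3) 4 5
  · simpa [ListedAlgebra.lie_apply, ListedAlgebra.dForm, differentials,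
      wedge, label, stdVec_apply] using
      minor_two h (stdVec _ 0, stdVec _ 2) (stdVec _ 1, stdVec _ 2) 4 5
  · simpa [ListedAlgebra.lie_apply, ListedAlgebra.dForm, differentials,
      wedge, label, stdVec_apply] using
      minor_two h (stdVec _ 0, stdVec _ 3) (stdVec _ 1, stdVec _ 3) 4 5
  · simpa [ListedAlgebra.lie_apply, ListedAlgebra.dForm, differentials,
      wedge, label, stdVec_apply] using
      minor_two h (stdVec _ 0, stdVec _ 2) (stdVec _ 1, stdVec _ 3) 4 5
  · simpa [ListedAlgebra.lie_apply, ListedAlgebra.dForm, differentials,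
      wedge, label, stdVec_apply] using
      minor_two h (stdVec _ 0, stdVec _ 2) (stdVec _ 1, stdVec _ 3) 4 5
  · simpa [ListedAlgebra.lie_apply, ListedAlgebra.dForm, differentials,
      wedge, label, stdVec_apply] using
      minor_two h (stdVec _ 0, stdVec _ 2) (stdVec _ 0, stdVec _ 3) 4 5
  · simpa [ListedAlgebra.lie_apply, ListedAlgebra.dForm, differentials,
      wedge, label, stdVec_apply] using
      minor_two h (stdVec _ 0, stdVec _ 3) (stdVec _ 0, stdVec _ 2) 4 5

theorem not_derivedRankLE_two {n : Fin 15} (hn : 7 < n) : ¬ DerivedRankLE (ListedAlgebra n) 2 := by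
  intro h
  fin_cases n
  · simp at hn
  · simp at hn
  · simp at hn
  · simp at hn
  · simp at hn
  · simp at hn
  · simp at hn
  · simp at hn
  · simpa [ListedAlgebra.lie_apply, ListedAlgebra.dForm, differentials,
      wedge, label, stdVec_apply] using
      minor_three h (stdVec _ 0, stdVec _ 1) (stdVec _ 0, stdVec _ 2) (stdVec _ 0,
          stdVec _ 3) 3 4 5
  · simpa [ListedAlgebra.lie_apply, ListedAlgebra.dForm, differentials,
      wedge, label, stdVec_apply] using
      minor_three h (stdVec _ 0, stdVec _ 1) (stdVec _ 0, stdVec _ 2) (stdVec _ 1,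
          stdVec _ 2) 3 4 5
  · simpa [ListedAlgebra.lie_apply, ListedAlgebra.dForm, differentials,
      wedge, label, stdVec_apply] using
      minor_three h (stdVec _ 0, stdVec _ 1) (stdVec _ 0, stdVec _ 3) (stdVec _ 1,
          stdVec _ 3) 3 4 5
  · simpa [ListedAlgebra.lie_apply, ListedAlgebra.dForm, differentials,
      wedge, label, stdVec_apply] using
      minor_three h (stdVec _ 0, stdVec _ 1) (stdVec _ 0, stdVec _ 2) (stdVec _ 1,
          stdVec _ 3) 3 4 5
  · simpa [ListedAlgebra.lie_apply, ListedAlgebra.dForm, differentials,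
      wedge, label, stdVec_apply] using
      minor_three h (stdVec _ 0, stdVec _ 1) (stdVec _ 0, stdVec _ 2) (stdVec _ 1,
          stdVec _ 3) 3 4 5
  · simpa [ListedAlgebra.lie_apply, ListedAlgebra.dForm, differentials,
      wedge, label, stdVec_apply] using
      minor_three h (stdVec _ 0, stdVec _ 1) (stdVec _ 0, stdVec _ 2) (stdVec _ 0,
          stdVec _ 3) 3 4 5
  · simpa [ListedAlgebra.lie_apply, ListedAlgebra.dForm, differentials,
      wedge, label, stdVec_apply] using
      minor_three h (stdVec _ 0, stdVec _ 1) (stdVec _ 0, stdVec _ 3) (stdVec _ 0,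
          stdVec _ 2) 3 4 5

theorem not_tripleRankLE_zero {n : Fin 15} (hn : n ∉ ({0, 1, 2, 4, 5, 6, 7, 9} : Finset (Fin 15))) :
    ¬ TripleRankLE (ListedAlgebra n) 0 := by
  intro h
  fin_cases n
  · simp at hn
  · simp at hn
  · simp at hn
  · simpa [ListedAlgebra.lie_apply, ListedAlgebra.dForm, differentials, wedge, label,
      stdVec_apply] using
      apply_eq_zero h (stdVec _ 1, stdVec _ 0, stdVec _ 1) 5
  · simp at hn
  · simp at hn
  · simp at hn
  · simp at hn
  · simpa [ListedAlgebra.lie_apply, ListedAlgebra.dForm, differentials, wedge, label,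
      stdVec_apply] using
      apply_eq_zero h (stdVec _ 0, stdVec _ 0, stdVec _ 1) 5
  · simp at hn
  · simpa [ListedAlgebra.lie_apply, ListedAlgebra.dForm, differentials, wedge, label,
      stdVec_apply] using
      apply_eq_zero h (stdVec _ 1, stdVec _ 0, stdVec _ 1) 5
  · simpa [ListedAlgebra.lie_apply, ListedAlgebra.dForm, differentials, wedge, label,
      stdVec_apply] using
      apply_eq_zero h (stdVec _ 1, stdVec _ 0, stdVec _ 1) 5
  · simpa [ListedAlgebra.lie_apply, ListedAlgebra.dForm, differentials, wedge, label,
      stdVec_apply] using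
      apply_eq_zero h (stdVec _ 1, stdVec _ 0, stdVec _ 1) 5
  · simpa [ListedAlgebra.lie_apply, ListedAlgebra.dForm, differentials, wedge, label,
      stdVec_apply] using
      apply_eq_zero h (stdVec _ 0, stdVec _ 0, stdVec _ 1) 5
  · simpa [ListedAlgebra.lie_apply, ListedAlgebra.dForm, differentials, wedge, label,
      stdVec_apply] using
      apply_eq_zero h (stdVec _ 1, stdVec _ 0, stdVec _ 1) 5

theorem not_tripleRankLE_one {n : Fin 15} (hn : n ∈ ({10, 12, 14} : Finset (Fin 15))) :
    ¬ TripleRankLE (ListedAlgebra n) 1 := by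
  intro h
  fin_cases n
  · simp at hn
  · simp at hn
  · simp at hn
  · simp at hn
  · simp at hn
  · simp at hn
  · simp at hn
  · simp at hn
  · simp at hn
  · simp at hn
  · simpa [ListedAlgebra.lie_apply, ListedAlgebra.dForm, differentials,
      wedge, label, stdVec_apply] using
      minor_two h (stdVec _ 0, stdVec _ 0, stdVec _ 1) (stdVec _ 1, stdVec _ 0,
          stdVec _ 1) 4 5
  · simp at hn
  · simpa [ListedAlgebra.lie_apply, ListedAlgebra.dForm, differentials,
      wedge, label, stdVec_apply] using
      minor_two h (stdVec _ 0, stdVec _ 0, stdVec _ 1) (stdVec _ 1, stdVec _ 0,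
          stdVec _ 1) 4 5
  · simp at hn
  · simpa [ListedAlgebra.lie_apply, ListedAlgebra.dForm, differentials,
      wedge, label, stdVec_apply] using
      minor_two h (stdVec _ 0, stdVec _ 0, stdVec _ 1) (stdVec _ 1, stdVec _ 0,
          stdVec _ 1) 4 5

theorem derivedRankLE_zero : DerivedRankLE (ListedAlgebra 0) 0 := by
  refine spanRankLE_of_coords ![] ?_
  rintro ⟨x, y⟩ l
  fin_cases l <;> simp [ListedAlgebra.lie_apply, ListedAlgebra.dForm, differentials, wedge, label]

theorem adRankLE_four (x : ListedAlgebra 4) : AdRankLE 1 x ↔ x 0 = 0 := by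
  refine ⟨fun h => ?_, fun h => ?_⟩
  · simpa [ListedAlgebra.lie_apply, ListedAlgebra.dForm, differentials,
      wedge, label, stdVec_apply] using
      minor_two h (stdVec _ 1) (stdVec _ 2) 4 5
  · refine spanRankLE_one_of (vec 4 ![0, 0, 0, 0, x 1, x 2]) (fun y => y 0)
      fun y => ListedAlgebra.ext' fun l => ?_
    fin_cases l <;>
      simp [ListedAlgebra.lie_apply, ListedAlgebra.dForm, differentials, wedge, label,
          ListedAlgebra.smul_apply, vec_apply, h,
        mul_comm]

/-- This is the complex Heisenberg algebra viewed over ℝ, so ad x has even rank; the minors used are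
sums of two squares. -/
theorem adRankLE_five (x : ListedAlgebra 5) :
    AdRankLE 1 x ↔ x 0 = 0 ∧ x 1 = 0 ∧ x 2 = 0 ∧ x 3 = 0 := by
  refine ⟨fun h => ?_, fun ⟨h0, h1, h2, h3⟩ => ?_⟩
  · have h1 := minor_two h (stdVec _ 0) (stdVec _ 1) 4 5
    have h2 := minor_two h (stdVec _ 2) (stdVec _ 3) 4 5
    simp [ListedAlgebra.lie_apply, ListedAlgebra.dForm, differentials, wedge,
        label, stdVec_apply] at h1 h2
    refine ⟨?_, ?_, ?_, ?_⟩ <;> nlinarith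
  · refine spanRankLE_of_coords ![4] fun y l => ?_
    fin_cases l <;>
      simp [ListedAlgebra.lie_apply, ListedAlgebra.dForm, differentials, wedge, label, h0, h1,
          h2, h3]

theorem adRankLE_six (x : ListedAlgebra 6) : AdRankLE 1 x ↔ x 0 = 0 ∧ x 1 = 0 := by
  refine ⟨fun h => ?_, fun ⟨h0, h1⟩ => ?_⟩
  · have h1 := minor_two h (stdVec _ 1) (stdVec _ 3) 4 5
    have h2 := minor_two h (stdVec _ 0) (stdVec _ 2) 4 5
    simp [ListedAlgebra.lie_apply, ListedAlgebra.dForm, differentials, wedge,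
        label, stdVec_apply] at h1 h2
    exact ⟨h1, h2⟩
  · refine spanRankLE_of_coords ![5] fun y l => ?_
    fin_cases l <;>
      simp [ListedAlgebra.lie_apply, ListedAlgebra.dForm, differentials, wedge, label, h0, h1]

theorem adRankLE_eight (x : ListedAlgebra 8) : AdRankLE 2 x ↔ x 0 = 0 := by
  refine ⟨fun h => ?_, fun h => ?_⟩
  · simpa [ListedAlgebra.lie_apply, ListedAlgebra.dForm, differentials,
      wedge, label, stdVec_apply] using
      minor_three h (stdVec _ 1) (stdVec _ 2) (stdVec _ 3) 3 4 5
  · refine spanRankLE_two_of (vec 8 ![0, 0, 0, x 1, x 2, x 3]) (stdVec 8 5)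
      (fun y => y 0) 0 fun y => ListedAlgebra.ext' fun l => ?_
    fin_cases l <;>
      simp [ListedAlgebra.lie_apply, ListedAlgebra.dForm, differentials, wedge, label,
          ListedAlgebra.smul_apply, ListedAlgebra.add_apply, vec_apply,
        ListedAlgebra.zero_apply, h, mul_comm]

theorem adRankLE_one_eight {x : ListedAlgebra 8} (h : x 0 = 0) : AdRankLE 1 x := by
  refine spanRankLE_one_of (vec 8 ![0, 0, 0, x 1, x 2, x 3]) (fun y => y 0)
    fun y => ListedAlgebra.ext' fun l => ?_
  fin_cases l <;>
    simp [ListedAlgebra.lie_apply, ListedAlgebra.dForm, differentials, wedge, label,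
        ListedAlgebra.smul_apply, vec_apply, h,
        mul_comm]

theorem adRankLE_thirteen (x : ListedAlgebra 13) : AdRankLE 2 x ↔ x 0 = 0 := by
  refine ⟨fun h => ?_, fun h => ?_⟩
  · simpa [ListedAlgebra.lie_apply, ListedAlgebra.dForm, differentials,
      wedge, label, stdVec_apply] using
      minor_three h (stdVec _ 1) (stdVec _ 2) (stdVec _ 3) 3 4 5
  · refine spanRankLE_two_of (vec 13 ![0, 0, 0, x 1, x 2, x 3])
      (stdVec 13 5) (fun y => y 0) (fun y => x 2 * y 1 - x 1 * y 2)
      fun y => ListedAlgebra.ext' fun l => ?_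
    fin_cases l <;>
      simp [ListedAlgebra.lie_apply, ListedAlgebra.dForm, differentials, wedge, label,
          stdVec_apply, ListedAlgebra.smul_apply, ListedAlgebra.add_apply, vec_apply,
        h, mul_comm]
    ring

theorem adRankLE_fourteen (x : ListedAlgebra 14) : AdRankLE 2 x ↔ x 0 = 0 := by
  refine ⟨fun h => ?_, fun h => ?_⟩
  · simpa [ListedAlgebra.lie_apply, ListedAlgebra.dForm, differentials,
      wedge, label, stdVec_apply] using
      minor_three h (stdVec _ 1) (stdVec _ 2) (stdVec _ 3) 3 4 5
  · refine spanRankLE_two_of (vec 14 ![0, 0, 0, x 1, x 3, x 2])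
      (stdVec 14 5) (fun y => y 0) (fun y => x 1 * y 3 - x 3 * y 1)
      fun y => ListedAlgebra.ext' fun l => ?_
    fin_cases l <;>
      simp [ListedAlgebra.lie_apply, ListedAlgebra.dForm, differentials, wedge, label,
          stdVec_apply, ListedAlgebra.smul_apply, ListedAlgebra.add_apply, vec_apply,
        h, mul_comm]
    ring

theorem adRankAddClosed_four : AdRankAddClosed (ListedAlgebra 4) 1 := by
  intro x y
  simp only [adRankLE_four, ListedAlgebra.add_apply]
  exact fun hx hy => by rw [hx, hy, add_zero]

theorem adRankAddClosed_five : AdRankAddClosed (ListedAlgebra 5) 1 := by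
  intro x y
  simp only [adRankLE_five, ListedAlgebra.add_apply]
  grind

theorem adRankAddClosed_six : AdRankAddClosed (ListedAlgebra 6) 1 := by
  intro x y
  simp only [adRankLE_six, ListedAlgebra.add_apply]
  grind

theorem adRankAddClosed_eight : AdRankAddClosed (ListedAlgebra 8) 2 := by
  intro x y
  simp only [adRankLE_eight, ListedAlgebra.add_apply]
  exact fun hx hy => by rw [hx, hy, add_zero]

theorem adRankAddClosed_thirteen : AdRankAddClosed (ListedAlgebra 13) 2 := by
  intro x y
  simp only [adRankLE_thirteen, ListedAlgebra.add_apply]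
  exact fun hx hy => by rw [hx, hy, add_zero]

theorem adRankAddClosed_fourteen : AdRankAddClosed (ListedAlgebra 14) 2 := by
  intro x y
  simp only [adRankLE_fourteen, ListedAlgebra.add_apply]
  exact fun hx hy => by rw [hx, hy, add_zero]

/-- For h₃ ⊕ h₃, vectors from different summands have ad of rank one while their sum has rank two.
-/
theorem not_adRankAddClosed_seven : ¬ AdRankAddClosed (ListedAlgebra 7) 1 := by
  intro h
  have h1 := h (stdVec _ 0) (stdVec _ 2) (spanRankLE_of_coords ![4] fun y l => by
    fin_cases l <;> simp [ListedAlgebra.lie_apply, ListedAlgebra.dForm, differentials, wedge,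
        label, stdVec_apply])
    (spanRankLE_of_coords ![5] fun y l => by
      fin_cases l <;> simp [ListedAlgebra.lie_apply, ListedAlgebra.dForm, differentials, wedge,
          label, stdVec_apply])
  simpa [ListedAlgebra.lie_apply, ListedAlgebra.dForm, differentials, wedge,
      label, stdVec_apply,
    ListedAlgebra.add_apply] using minor_two h1 (stdVec _ 1) (stdVec _ 3) 4 5

theorem not_adRankAddClosed_eleven : ¬ AdRankAddClosed (ListedAlgebra 11) 2 := by
  intro h
  have h1 := h (stdVec _ 0) (stdVec _ 1) (spanRankLE_of_coords ![3, 4] fun y l => by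
    fin_cases l <;> simp [ListedAlgebra.lie_apply, ListedAlgebra.dForm, differentials, wedge,
        label, stdVec_apply])
    (spanRankLE_of_coords ![3, 5] fun y l => by
      fin_cases l <;> simp [ListedAlgebra.lie_apply, ListedAlgebra.dForm, differentials, wedge,
          label, stdVec_apply])
  simpa [ListedAlgebra.lie_apply, ListedAlgebra.dForm, differentials,
      wedge, label, stdVec_apply,
    ListedAlgebra.add_apply] using minor_three h1 (stdVec _ 1) (stdVec _ 2) (stdVec _ 3) 3 4 5

theorem not_adRankAddClosed_twelve : ¬ AdRankAddClosed (ListedAlgebra 12) 2 := by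
  intro h
  have h1 := h (stdVec _ 0) (stdVec _ 1) (spanRankLE_of_coords ![3, 4] fun y l => by
    fin_cases l <;> simp [ListedAlgebra.lie_apply, ListedAlgebra.dForm, differentials, wedge,
        label, stdVec_apply])
    (spanRankLE_of_coords ![3, 5] fun y l => by
      fin_cases l <;> simp [ListedAlgebra.lie_apply, ListedAlgebra.dForm, differentials, wedge,
          label, stdVec_apply])
  simpa [ListedAlgebra.lie_apply, ListedAlgebra.dForm, differentials,
      wedge, label, stdVec_apply,
    ListedAlgebra.add_apply] using minor_three h1 (stdVec _ 1) (stdVec _ 2) (stdVec _ 3) 3 4 5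

theorem adRankOneCodimOne_four : AdRankOneCodimOne (ListedAlgebra 4) := by
  refine ⟨stdVec _ 0, fun y => ⟨y 0, ?_⟩⟩
  simp [adRankLE_four, sub_apply, ListedAlgebra.smul_apply, stdVec_apply]

/-- The rank-one elements lie in a subspace of codimension two, which one extra vector cannot
complete. -/
theorem not_adRankOneCodimOne_of {n : Fin 15}
    (hn : ∀ x : ListedAlgebra n, AdRankLE 1 x → x 0 = 0 ∧ x 1 = 0) :
    ¬ AdRankOneCodimOne (ListedAlgebra n) := by
  rintro ⟨x, hx⟩
  obtain ⟨c, hc⟩ := hx (stdVec _ 0)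
  obtain ⟨d, hd⟩ := hx (stdVec _ 1)
  obtain ⟨h1, h2⟩ := hn _ hc
  obtain ⟨h3, h4⟩ := hn _ hd
  simp [sub_apply, ListedAlgebra.smul_apply, stdVec_apply] at h1 h2 h3 h4
  grind

theorem adRankGap_five : AdRankGap (ListedAlgebra 5) 1 0 := by
  intro x hx
  obtain ⟨h0, h1, h2, h3⟩ := (adRankLE_five x).mp hx
  refine spanRankLE_of_coords ![] fun y l => ?_
  fin_cases l <;>
    simp [ListedAlgebra.lie_apply, ListedAlgebra.dForm, differentials, wedge, label, h0, h1, h2, h3]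

theorem not_adRankGap_six : ¬ AdRankGap (ListedAlgebra 6) 1 0 := by
  intro h
  have h1 := h (stdVec _ 2) ((adRankLE_six _).mpr (by simp [stdVec_apply]))
  simpa [ListedAlgebra.lie_apply, ListedAlgebra.dForm, differentials, wedge, label,
      stdVec_apply] using
    apply_eq_zero h1 (stdVec _ 1) 5

theorem adRankGap_eight : AdRankGap (ListedAlgebra 8) 2 1 :=
  fun x hx => adRankLE_one_eight ((adRankLE_eight x).mp hx)

theorem not_adRankGap_thirteen : ¬ AdRankGap (ListedAlgebra 13) 2 1 := by
  intro h
  have h1 := h (stdVec _ 1) ((adRankLE_thirteen _).mpr (by simp [stdVec_apply]))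
  simpa [ListedAlgebra.lie_apply, ListedAlgebra.dForm, differentials, wedge,
      label, stdVec_apply] using
    minor_two h1 (stdVec _ 0) (stdVec _ 2) 3 5

theorem commutativeTransitive_one : CommutativeTransitive (ListedAlgebra 1) := by
  intro x y z w hw hy hz
  have hw' : ¬ (x 0 = 0 ∧ x 1 = 0) := fun ⟨h0, h1⟩ => hw (ListedAlgebra.ext' fun l => by
    fin_cases l <;> simp [ListedAlgebra.lie_apply, ListedAlgebra.dForm, differentials, wedge,
        label, ListedAlgebra.zero_apply, h0, h1])
  have hy5 := congrFun hy 5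
  have hz5 := congrFun hz 5
  simp only [ListedAlgebra.lie_apply, ListedAlgebra.zero_apply] at hy5 hz5
  simp [ListedAlgebra.dForm, differentials, wedge, label] at hy5 hz5
  refine ListedAlgebra.ext' fun l => ?_
  fin_cases l <;> simp [ListedAlgebra.lie_apply, ListedAlgebra.dForm, differentials, wedge,
      label, ListedAlgebra.zero_apply]
  grind

theorem not_commutativeTransitive_two : ¬ CommutativeTransitive (ListedAlgebra 2) := by
  intro h
  have h1 := h (stdVec _ 0) (stdVec _ 2) (stdVec _ 3) (stdVec _ 1)
    (fun h0 => by simpa [ListedAlgebra.lie_apply, ListedAlgebra.dForm, differentials, wedge,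
        label, stdVec_apply, ListedAlgebra.zero_apply] using congrFun h0 5)
    (ListedAlgebra.ext' fun l => by
      fin_cases l <;> simp [ListedAlgebra.lie_apply, ListedAlgebra.dForm, differentials, wedge,
          label, stdVec_apply, ListedAlgebra.zero_apply])
    (ListedAlgebra.ext' fun l => by
      fin_cases l <;> simp [ListedAlgebra.lie_apply, ListedAlgebra.dForm, differentials, wedge,
          label, stdVec_apply, ListedAlgebra.zero_apply])
  simpa [ListedAlgebra.lie_apply, ListedAlgebra.dForm, differentials, wedge, label, stdVec_apply,
      ListedAlgebra.zero_apply] using congrFun h1 5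

/-- Up to order and sign the bracket is the cross product of the coordinates 0, 1, 3, so commuting
with a non-central x means being proportional to it in those coordinates. -/
theorem commutativeTransitive_ten : CommutativeTransitive (ListedAlgebra 10) := by
  intro x y z w hw hy hz
  have hw' : ¬ (x 0 = 0 ∧ x 1 = 0 ∧ x 3 = 0) := fun ⟨h0, h1, h3⟩ =>
    hw (ListedAlgebra.ext' fun l => by
      fin_cases l <;> simp [ListedAlgebra.lie_apply, ListedAlgebra.dForm, differentials, wedge,
          label, ListedAlgebra.zero_apply, h0, h1, h3])
  have key : ∀ a : ListedAlgebra 10, ⁅x, a⁆ = 0 → x 0 * a 1 = x 1 * a 0 ∧ x 0 * a 3 = x 3 * a 0 ∧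
      x 1 * a 3 = x 3 * a 1 := fun a ha => by
    have h3 := congrFun ha 3
    have h4 := congrFun ha 4
    have h5 := congrFun ha 5
    simp only [ListedAlgebra.lie_apply, ListedAlgebra.zero_apply] at h3 h4 h5
    simp [ListedAlgebra.dForm, differentials, wedge, label] at h3 h4 h5
    exact ⟨by linarith, by linarith, by linarith⟩
  obtain ⟨a1, a2, a3⟩ := key y hy
  obtain ⟨b1, b2, b3⟩ := key z hz
  refine ListedAlgebra.ext' fun l => ?_
  fin_cases l <;> simp [ListedAlgebra.lie_apply, ListedAlgebra.dForm, differentials, wedge,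
      label, ListedAlgebra.zero_apply]
  all_goals grind

theorem not_commutativeTransitive_of_mem {n : Fin 15} (hn : n ∈ ({12, 14} : Finset (Fin 15))) :
    ¬ CommutativeTransitive (ListedAlgebra n) := by
  intro h
  fin_cases n
  · simp at hn
  · simp at hn
  · simp at hn
  · simp at hn
  · simp at hn
  · simp at hn
  · simp at hn
  · simp at hn
  · simp at hn
  · simp at hn
  · simp at hn
  · simp at hn
  · have h1 := h (stdVec _ 2) (stdVec _ 1) (stdVec _ 3) (stdVec _ 0)
      (fun h0 => by simpa [ListedAlgebra.lie_apply, ListedAlgebra.dForm, differentials, wedge,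
          label, stdVec_apply, ListedAlgebra.zero_apply]
        using congrFun h0 4)
      (ListedAlgebra.ext' fun l => by
        fin_cases l <;> simp [ListedAlgebra.lie_apply, ListedAlgebra.dForm, differentials, wedge,
            label, stdVec_apply, ListedAlgebra.zero_apply])
      (ListedAlgebra.ext' fun l => by
        fin_cases l <;> simp [ListedAlgebra.lie_apply, ListedAlgebra.dForm, differentials, wedge,
            label, stdVec_apply, ListedAlgebra.zero_apply])
    simpa [ListedAlgebra.lie_apply, ListedAlgebra.dForm, differentials, wedge, label,
        stdVec_apply, ListedAlgebra.zero_apply] using congrFun h1 5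
  · simp at hn
  · have h1 := h (stdVec _ 2) (stdVec _ 1) (stdVec _ 3) (stdVec _ 0)
      (fun h0 => by simpa [ListedAlgebra.lie_apply, ListedAlgebra.dForm, differentials, wedge,
          label, stdVec_apply, ListedAlgebra.zero_apply]
        using congrFun h0 5)
      (ListedAlgebra.ext' fun l => by
        fin_cases l <;> simp [ListedAlgebra.lie_apply, ListedAlgebra.dForm, differentials, wedge,
            label, stdVec_apply, ListedAlgebra.zero_apply])
      (ListedAlgebra.ext' fun l => by
        fin_cases l <;> simp [ListedAlgebra.lie_apply, ListedAlgebra.dForm, differentials, wedge,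
            label, stdVec_apply, ListedAlgebra.zero_apply])
    simpa [ListedAlgebra.lie_apply, ListedAlgebra.dForm, differentials, wedge, label,
        stdVec_apply, ListedAlgebra.zero_apply] using congrFun h1 5

end ListedAlgebra

/-! ### Pairwise non-isomorphism. -/

namespace ListedAlgebra

/-- Dimensions of the derived algebra and of the next term of the lower central series leave few
pairs; the finer invariants treat these one at a time. -/
theorem not_nonempty_lieEquiv_of_lt {i j : Fin 15} (hij : i < j) :
    ¬ Nonempty (ListedAlgebra i ≃ₗ⁅ℝ⁆ ListedAlgebra j) := by
  rintro ⟨f⟩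
  have d1 : i < 3 ↔ j < 3 := by
    constructor <;> intro h <;> by_contra hn
    · exact not_derivedRankLE_one (by omega) ((derivedRankLE_one h).of_equiv f)
    · exact not_derivedRankLE_one (by omega) ((derivedRankLE_one h).of_equiv f.symm)
  have d2 : i < 8 ↔ j < 8 := by
    constructor <;> intro h <;> by_contra hn
    · exact not_derivedRankLE_two (by omega) ((derivedRankLE_two h).of_equiv f)
    · exact not_derivedRankLE_two (by omega) ((derivedRankLE_two h).of_equiv f.symm)
  have t0 : i ∈ ({0, 1, 2, 4, 5, 6, 7, 9} : Finset (Fin 15)) ↔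
      j ∈ ({0, 1, 2, 4, 5, 6, 7, 9} : Finset (Fin 15)) := by
    constructor <;> intro h <;> by_contra hn
    · exact not_tripleRankLE_zero hn ((tripleRankLE_zero h).of_equiv f)
    · exact not_tripleRankLE_zero hn ((tripleRankLE_zero h).of_equiv f.symm)
  have t1 : i ∈ ({10, 12, 14} : Finset (Fin 15)) ↔ j ∈ ({10, 12, 14} : Finset (Fin 15)) := by
    constructor <;> intro h <;> by_contra hn
    · exact not_tripleRankLE_one h ((tripleRankLE_one hn).of_equiv f.symm)
    · exact not_tripleRankLE_one h ((tripleRankLE_one hn).of_equiv f)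
  -- The pairs not separated by the four dimension conditions, found by finite enumeration.
  have key : ∀ i j : Fin 15, i < j → (i < 3 ↔ j < 3) → (i < 8 ↔ j < 8) →
      (i ∈ ({0, 1, 2, 4, 5, 6, 7, 9} : Finset (Fin 15)) ↔
        j ∈ ({0, 1, 2, 4, 5, 6, 7, 9} : Finset (Fin 15))) →
      (i ∈ ({10, 12, 14} : Finset (Fin 15)) ↔ j ∈ ({10, 12, 14} : Finset (Fin 15))) →
      (i = 0 ∧ j ∈ ({1, 2} : Finset (Fin 15))) ∨ (i = 1 ∧ j = 2) ∨ (i = 4 ∧ j = 5) ∨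
      (i = 4 ∧ j = 6) ∨ (i = 4 ∧ j = 7) ∨ (i = 5 ∧ j = 6) ∨ (i = 5 ∧ j = 7) ∨ (i = 6 ∧ j = 7) ∨
      (i = 8 ∧ j = 11) ∨ (i = 8 ∧ j = 13) ∨ (i = 11 ∧ j = 13) ∨
      (i = 10 ∧ j ∈ ({12, 14} : Finset (Fin 15))) ∨ (i = 12 ∧ j = 14) := by
    decide
  rcases key i j hij d1 d2 t0 t1 with ⟨rfl, hj⟩ | ⟨rfl, rfl⟩ | ⟨rfl, rfl⟩ | ⟨rfl, rfl⟩ | ⟨rfl, rfl⟩ |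
    ⟨rfl, rfl⟩ | ⟨rfl, rfl⟩ | ⟨rfl, rfl⟩ | ⟨rfl, rfl⟩ | ⟨rfl, rfl⟩ | ⟨rfl, rfl⟩ | ⟨rfl, hj⟩ | ⟨rfl, rfl⟩
  · exact not_derivedRankLE_zero hj (derivedRankLE_zero.of_equiv f)
  · exact not_commutativeTransitive_two (commutativeTransitive_one.of_equiv f)
  · refine not_adRankOneCodimOne_of (fun x hx => ?_) (adRankOneCodimOne_four.of_equiv f)
    exact ⟨((adRankLE_five x).mp hx).1, ((adRankLE_five x).mp hx).2.1⟩
  · exact not_adRankOneCodimOne_of (fun x hx => (adRankLE_six x).mp hx)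
      (adRankOneCodimOne_four.of_equiv f)
  · exact not_adRankAddClosed_seven (adRankAddClosed_four.of_equiv f)
  · exact not_adRankGap_six (adRankGap_five.of_equiv f)
  · exact not_adRankAddClosed_seven (adRankAddClosed_five.of_equiv f)
  · exact not_adRankAddClosed_seven (adRankAddClosed_six.of_equiv f)
  · exact not_adRankAddClosed_eleven (adRankAddClosed_eight.of_equiv f)
  · exact not_adRankGap_thirteen (adRankGap_eight.of_equiv f)
  · exact not_adRankAddClosed_eleven (adRankAddClosed_thirteen.of_equiv f.symm)
  · exact not_commutativeTransitive_of_mem hj (commutativeTransitive_ten.of_equiv f)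
  · exact not_adRankAddClosed_twelve (adRankAddClosed_fourteen.of_equiv f.symm)

theorem eq_of_nonempty_lieEquiv {i j : Fin 15}
    (h : Nonempty (ListedAlgebra i ≃ₗ⁅ℝ⁆ ListedAlgebra j)) : i = j := by
  rcases lt_trichotomy i j with hij | hij | hij
  · exact (not_nonempty_lieEquiv_of_lt hij h).elim
  · exact hij
  · exact (not_nonempty_lieEquiv_of_lt hij ⟨h.some.symm⟩).elim

end ListedAlgebra

/-! ### Obstructions: the negative entries of the table. -/

theorem IsTriangular.apply_eq {V : Type*} [AddCommGroup V] [Module ℝ V]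
    {e : Module.Basis (Fin 3) ℝ V} {A : V →ₗ[ℝ] V →ₗ[ℝ] V} {s t p q r : ℝ}
    (hA : IsTriangular e A s t p q r) (x y : V) :
    A x y = (e.repr x 0 * e.repr y 0 * s) • e 1 + (e.repr x 0 * e.repr y 0 * t
      + e.repr x 0 * e.repr y 1 * p + e.repr x 1 * e.repr y 0 * q
      + e.repr x 1 * e.repr y 1 * r) • e 2 := by
  conv_lhs => rw [e.three_expand x, e.three_expand y]
  simp only [map_add, map_smul, LinearMap.add_apply, LinearMap.smul_apply, hA.h00, hA.h01, hA.h10,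
    hA.h11, hA.left, hA.right]
  module

namespace IsPencil

variable {V g : Type*} [AddCommGroup V] [Module ℝ V] [LieRing g] [LieAlgebra ℝ g]
  {i j : V →ₗ[ℝ] g} {A B : V →ₗ[ℝ] V →ₗ[ℝ] V} {e : Module.Basis (Fin 3) ℝ V}
  {s t p q r s' t' p' q' r' : ℝ}

theorem lie_left_zero_one (h : IsPencil i j A B) (hA : IsTriangular e A s t p q r) :
    ⁅i (e 0), i (e 1)⁆ = (p - q) • i (e 2) := by
  rw [h.lie_ii, hA.h01, hA.h10, ← sub_smul, map_smul]

theorem lie_zero_one (h : IsPencil i j A B) (hA : IsTriangular e A s t p q r)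
    (hB : IsTriangular e B s' t' p' q' r') :
    ⁅i (e 0), j (e 1)⁆ = p • j (e 2) - q' • i (e 2) := by
  rw [h.lie_ij, hA.h01, hB.h10, map_smul, map_smul]

theorem lie_one_zero (h : IsPencil i j A B) (hA : IsTriangular e A s t p q r)
    (hB : IsTriangular e B s' t' p' q' r') :
    ⁅i (e 1), j (e 0)⁆ = q • j (e 2) - p' • i (e 2) := by
  rw [h.lie_ij, hA.h10, hB.h01, map_smul, map_smul]

/-- The derived algebra is spanned by these six brackets, as e₂ contributes nothing; thus it can be
bounded or confined to a hyperplane. -/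
theorem lie_mem (h : IsPencil i j A B) (hA : IsTriangular e A s t p q r)
    (hB : IsTriangular e B s' t' p' q' r') (W : Submodule ℝ g)
    (h1 : (p - q) • i (e 2) ∈ W) (h2 : (p' - q') • j (e 2) ∈ W)
    (h3 : ⁅i (e 0), j (e 0)⁆ ∈ W) (h4 : ⁅i (e 0), j (e 1)⁆ ∈ W) (h5 : ⁅i (e 1), j (e 0)⁆ ∈ W)
    (h6 : ⁅i (e 1), j (e 1)⁆ ∈ W) (z w : g) : ⁅z, w⁆ ∈ W := by
  obtain ⟨x, y, rfl⟩ := h.surj z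
  obtain ⟨x', y', rfl⟩ := h.surj w
  set a := e.repr x
  set b := e.repr y
  set a' := e.repr x'
  set b' := e.repr y'
  have key : ⁅i x + j y, i x' + j y'⁆ = (a 0 * a' 1 - a 1 * a' 0) • (p - q) • i (e 2)
      + (b 0 * b' 1 - b 1 * b' 0) • (p' - q') • j (e 2)
      + (a 0 * b' 0 - a' 0 * b 0) • ⁅i (e 0), j (e 0)⁆
      + (a 0 * b' 1 - a' 0 * b 1) • ⁅i (e 0), j (e 1)⁆
      + (a 1 * b' 0 - a' 1 * b 0) • ⁅i (e 1), j (e 0)⁆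
      + (a 1 * b' 1 - a' 1 * b 1) • ⁅i (e 1), j (e 1)⁆ := by
    simp only [add_lie, lie_add, h.lie_ii, h.lie_ij, h.lie_jj, h.lie_ji]
    simp only [hA.apply_eq x, hA.apply_eq x', hB.apply_eq y, hB.apply_eq y', hA.h00, hA.h01,
      hA.h10, hA.h11, hB.h00, hB.h01, hB.h10, hB.h11, map_add, map_sub, map_smul]
    module
  rw [key]
  exact W.add_mem (W.add_mem (W.add_mem (W.add_mem (W.add_mem (W.smul_mem _ h1) (W.smul_mem _ h2))
    (W.smul_mem _ h3)) (W.smul_mem _ h4)) (W.smul_mem _ h5)) (W.smul_mem _ h6)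

theorem lie_eq_zero_left (h : IsPencil i j A B) (hA : IsTriangular e A s t p q r)
    (hB : IsTriangular e B s' t' p' q' r') (w : g) : ⁅i (e 2), w⁆ = 0 := by
  obtain ⟨x, y, rfl⟩ := h.surj w
  simp [h.lie_ii, h.lie_ij, hA.left, hA.right, hB.right]

/-- If s vanishes, all brackets lie in ⟨i e₂, j e₂⟩. If r vanishes, p = q and p' = q' give [i e₁, j
e₀] = [i e₀, j e₁] and [i e₁, j e₁] = 0, so two generators remain. -/
theorem derivedRankLE_two (h : IsPencil i j A B) (hA : IsTriangular e A s t p p r)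
    (hB : IsTriangular e B s' t' p' p' r') : DerivedRankLE g 2 := by
  rcases h.forms_eq_zero_of_isTriangular hA hB with ⟨rfl, rfl⟩ | ⟨rfl, rfl⟩
  · refine ⟨![i (e 2), j (e 2)], fun z => ?_⟩
    set W := Submodule.span ℝ (Set.range ![i (e 2), j (e 2)])
    have hi : i (e 2) ∈ W := Submodule.subset_span ⟨0, rfl⟩
    have hj : j (e 2) ∈ W := Submodule.subset_span ⟨1, rfl⟩
    have hW : ∀ a b : ℝ, a • j (e 2) - b • i (e 2) ∈ W := fun a b =>
      W.sub_mem (W.smul_mem _ hj) (W.smul_mem _ hi)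
    refine h.lie_mem hA hB W (by simp) (by simp) ?_ ?_ ?_ ?_ _ _
    · simpa [h.lie_ij, hA.h00, hB.h00] using hW t t'
    · simpa [h.lie_ij, hA.h01, hB.h10] using hW p p'
    · simpa [h.lie_ij, hA.h10, hB.h01] using hW p p'
    · simpa [h.lie_ij, hA.h11, hB.h11] using hW r r'
  · refine ⟨![⁅i (e 0), j (e 0)⁆, ⁅i (e 0), j (e 1)⁆], fun z => ?_⟩
    set W := Submodule.span ℝ (Set.range ![⁅i (e 0), j (e 0)⁆, ⁅i (e 0), j (e 1)⁆])
    have h4 : ⁅i (e 0), j (e 1)⁆ ∈ W := Submodule.subset_span ⟨1, rfl⟩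
    refine h.lie_mem hA hB W (by simp) (by simp) (Submodule.subset_span ⟨0, rfl⟩) h4 ?_ ?_ _ _
    · rwa [h.lie_one_zero hA hB, ← h.lie_zero_one hA hB]
    · simp [h.lie_ij, hA.h11, hB.h11]

end IsPencil

namespace ListedAlgebra

/-- The quadratic form t r - p² on ℝ³ has Witt index one, so two vectors spanning a totally
isotropic subspace are dependent. -/
theorem minors_eq_zero {t₁ t₂ p₁ p₂ r₁ r₂ : ℝ} (h1 : t₁ * r₁ = p₁ * p₁) (h2 : t₂ * r₂ = p₂ * p₂)
    (h3 : t₁ * r₂ + t₂ * r₁ = 2 * (p₁ * p₂)) :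
    ∃ α β : ℝ, ¬ (α = 0 ∧ β = 0) ∧ α * t₁ + β * t₂ = 0 ∧ α * p₁ + β * p₂ = 0 ∧
      α * r₁ + β * r₂ = 0 := by
  have e1 : t₁ * r₂ - t₂ * r₁ = 0 := by
    apply pow_eq_zero_iff (two_ne_zero) |>.mp
    linear_combination (t₁ * r₂ + t₂ * r₁ + 2 * (p₁ * p₂)) * h3 - 4 * t₂ * r₂ * h1
      - 4 * p₁ * p₁ * h2
  have e2 : t₁ * p₂ - t₂ * p₁ = 0 := by
    apply pow_eq_zero_iff (two_ne_zero) |>.mp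
    linear_combination t₁ * t₂ * h3 - t₁ * t₁ * h2 - t₂ * t₂ * h1
  by_cases ht : t₁ = 0 ∧ t₂ = 0
  · obtain ⟨rfl, rfl⟩ := ht
    have hp1 : p₁ = 0 := by simpa using h1
    have hp2 : p₂ = 0 := by simpa using h2
    by_cases hr : r₁ = 0 ∧ r₂ = 0
    · exact ⟨1, 0, by simp, by simp, by simp [hp1], by simp [hr.1]⟩
    · exact ⟨r₂, -r₁, by simpa [and_comm] using hr, by simp, by simp [hp1, hp2], by ring⟩
  · exact ⟨t₂, -t₁, by simpa [and_comm] using ht, by ring, by linear_combination -e2,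
      by linear_combination -e1⟩

variable {V : Type*} [AddCommGroup V] [Module ℝ V] {A B : V →ₗ[ℝ] V →ₗ[ℝ] V}
  {e : Module.Basis (Fin 3) ℝ V} {s t p q r s' t' p' q' r' : ℝ}

/-- Both non-zero differentials are divisible by e¹, so every combination of them is decomposable
and satisfies the Plücker relation on i e₀, i e₁, j e₀, j e₁. For commutative products it reads t r
= p², polarised over the pair; then the derived algebra would lie in the kernel of a non-zero
combination, although it has dimension two. -/
theorem not_isPencil_four {i j : V →ₗ[ℝ] ListedAlgebra 4} (hA : IsTriangular e A s t p p r)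
    (hB : IsTriangular e B s' t' p' p' r') : ¬ IsPencil i j A B := by
  intro h
  have hc : ∀ x y : ListedAlgebra 4, ⁅x, y⁆ 4 = -(x 0 * y 1 - x 1 * y 0) ∧
      ⁅x, y⁆ 5 = -(x 0 * y 2 - x 2 * y 0) := fun x y => by
    simp [lie_apply, dForm, differentials, wedge, label]
  have e1 : ⁅i (e 0), i (e 1)⁆ = 0 := by rw [h.lie_left_zero_one hA, sub_self, zero_smul]
  have e2 : ⁅j (e 0), j (e 1)⁆ = 0 := by rw [h.swap.lie_left_zero_one hB, sub_self, zero_smul]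
  have e3 : ⁅i (e 1), j (e 0)⁆ = ⁅i (e 0), j (e 1)⁆ := by
    rw [h.lie_one_zero hA hB, h.lie_zero_one hA hB]
  have a4 := (hc (i (e 0)) (i (e 1))).1
  have a5 := (hc (i (e 0)) (i (e 1))).2
  have b4 := (hc (j (e 0)) (j (e 1))).1
  have b5 := (hc (j (e 0)) (j (e 1))).2
  have c4 := (hc (i (e 1)) (j (e 0))).1
  have c5 := (hc (i (e 1)) (j (e 0))).2
  have t4 := (hc (i (e 0)) (j (e 0))).1
  have t5 := (hc (i (e 0)) (j (e 0))).2
  have p4 := (hc (i (e 0)) (j (e 1))).1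
  have p5 := (hc (i (e 0)) (j (e 1))).2
  have r4 := (hc (i (e 1)) (j (e 1))).1
  have r5 := (hc (i (e 1)) (j (e 1))).2
  rw [e1, zero_apply] at a4 a5
  rw [e2, zero_apply] at b4 b5
  rw [e3] at c4 c5
  obtain ⟨α, β, hne, ht, hp, hr⟩ := minors_eq_zero
    (t₁ := ⁅i (e 0), j (e 0)⁆ 4) (t₂ := ⁅i (e 0), j (e 0)⁆ 5)
    (p₁ := ⁅i (e 0), j (e 1)⁆ 4) (p₂ := ⁅i (e 0), j (e 1)⁆ 5)
    (r₁ := ⁅i (e 1), j (e 1)⁆ 4) (r₂ := ⁅i (e 1), j (e 1)⁆ 5)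
    (by grind) (by grind) (by grind)
  let φ : ListedAlgebra 4 →ₗ[ℝ] ℝ :=
    (α • LinearMap.proj 4 + β • LinearMap.proj 5 : (Fin 6 → ℝ) →ₗ[ℝ] ℝ)
  have hφ : ∀ z, φ z = α * z 4 + β * z 5 := fun z => rfl
  have hmem := h.lie_mem hA hB (LinearMap.ker φ) (by simp) (by simp) ht hp (by rw [e3]; exact hp) hr
  have h1 : φ ⁅stdVec 4 0, stdVec 4 1⁆ = 0 := hmem _ _
  have h2 : φ ⁅stdVec 4 0, stdVec 4 2⁆ = 0 := hmem _ _
  rw [hφ, (hc _ _).1, (hc _ _).2] at h1 h2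
  simp [stdVec_apply] at h1 h2
  exact hne ⟨h1, h2⟩

/-- When p ≠ q, both i e₂ and j e₂ are central elements of the derived algebra. In the first four
algebras such elements are multiples of the last basis vector, whereas i e₂ and j e₂ are
independent. -/
theorem not_isPencil_of_ne {n : Fin 15} (hn : n < 4) {i j : V →ₗ[ℝ] ListedAlgebra n}
    (hA : IsTriangular e A s t p q r) (hB : IsTriangular e B s' t' p' q' r') (hpq : p ≠ q) :
    ¬ IsPencil i j A B := by
  intro h
  have hd : p - q ≠ 0 := sub_ne_zero.mpr hpq
  have hz : ∀ k, (∀ x y : ListedAlgebra n, ⁅x, y⁆ k = 0) →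
      i (e 2) k = 0 ∧ j (e 2) k = 0 := by
    intro k hk
    have h1 : ∀ a b : ℝ, (a • i (e 2) + b • j (e 2) : ListedAlgebra n) k =
      a * i (e 2) k + b * j (e 2) k := fun a b => rfl
    have e1 := hk (i (e 0)) (i (e 1))
    have e2 : (⁅i (e 0), j (e 1)⁆ - ⁅i (e 1), j (e 0)⁆) k = 0 := by
      rw [sub_apply, hk, hk, sub_zero]
    rw [h.lie_left_zero_one hA, smul_apply] at e1
    have e3 := (mul_eq_zero.mp e1).resolve_left hd
    rw [h.lie_zero_one hA hB, h.lie_one_zero hA hB, show p • j (e 2) - q' • i (e 2)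
      - (q • j (e 2) - p' • i (e 2)) = (p' - q') • i (e 2) + (p - q) • j (e 2) by module, h1, e3,
      mul_zero, zero_add] at e2
    exact ⟨e3, (mul_eq_zero.mp e2).resolve_left hd⟩
  have hk : ∀ k, k ≠ 5 → i (e 2) k = 0 ∧ j (e 2) k = 0 := by
    intro k hk5
    have key : ∀ n : Fin 15, n < 4 → ∀ k, k ≠ 5 → differentials n k = [] ∨ (n = 3 ∧ k = 4) := by
      decide
    rcases key n hn k hk5 with h0 | ⟨rfl, rfl⟩
    · exact hz k fun x y => lie_apply_eq_zero h0 x y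
    -- Coordinate 4 of this algebra does occur in brackets, but centrality kills it: it is read off
    -- by bracketing with the basis vector of index 1.
    · have h1 := congrFun (h.lie_eq_zero_left hA hB (stdVec 3 1)) 5
      have h2 := congrFun (h.swap.lie_eq_zero_left hB hA (stdVec 3 1)) 5
      have hc : ∀ x : ListedAlgebra 3, ⁅x, stdVec 3 1⁆ 5 = x 4 := fun x => by
        simp [lie_apply, dForm, differentials, wedge, label, stdVec_apply]
      exact ⟨(hc _).symm.trans h1, (hc _).symm.trans h2⟩
  -- Two multiples of one vector are dependent; the coefficients are their coordinates along it.
  have hdep : i (-(j (e 2) 5) • e 2) + j ((i (e 2) 5) • e 2) = 0 := by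
    refine ListedAlgebra.ext' fun k => ?_
    rw [map_smul, map_smul, add_apply, smul_apply, smul_apply, zero_apply]
    by_cases hk5 : k = 5
    · rw [hk5]
      ring
    · rw [(hk k hk5).1, (hk k hk5).2]
      ring
  have h5 : i (e 2) 5 = 0 := (smul_eq_zero.mp (h.inj _ _ hdep).2).resolve_right (e.ne_zero 2)
  have h0 : i (e 2) = 0 := ListedAlgebra.ext' fun k => by
    by_cases hk5 : k = 5
    · rw [hk5, h5, zero_apply]
    · rw [(hk k hk5).1, zero_apply]
  exact e.ne_zero 2 (h.injective_left (h0.trans (map_zero i).symm))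

theorem tableEntry_of_hasType {n : Fin 15} {t : DoubleType}
    {J E : ListedAlgebra n →ₗ[ℝ] ListedAlgebra n}
    (h : IsComplexProductStructure J E) (ht : h.product.HasType t) : tableEntry n t = true := by
  have := isNilpotent n
  obtain ⟨e, s, t', p, q, r, s', t'', p', q', r', hA, hB⟩ :=
    h.isPencil.exists_isTriangular (h.finrank_plus (finrank_eq n))
  have hP := h.isPencil
  have h1 := IsComplexProductStructure.isAbelianThree_or_isHeisenbergThree hP hA h.mem_plus
  have h2 := IsComplexProductStructure.isAbelianThree_or_isHeisenbergThree hP.swap hB h.mem_minus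
  have hlt : p ≠ q ∨ p' ≠ q' → ¬ n < 4 := by
    rintro (hpq | hpq) hn
    · exact not_isPencil_of_ne hn hA hB hpq hP
    · exact not_isPencil_of_ne hn hB hA hpq hP.swap
  have kH : ∀ n : Fin 15, ¬ n < 4 → tableEntry n .HR = true ∧ tableEntry n .HH = true := by decide
  cases t with
  | RR =>
    obtain ⟨k1, k2⟩ := ht
    have e1 : p = q := by
      rcases h1 with h1 | h1
      · exact h1.2
      · exact (not_isAbelianThree_of_isHeisenbergThree h1.1 k1).elim
    have e2 : p' = q' := by
      rcases h2 with h2 | h2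
      · exact h2.2
      · exact (not_isAbelianThree_of_isHeisenbergThree h2.1 k2).elim
    subst e1 e2
    have k3 : n < 8 := by
      by_contra hn
      exact not_derivedRankLE_two (by omega) (hP.derivedRankLE_two hA hB)
    have k4 : n ≠ 4 := by
      rintro rfl
      exact not_isPencil_four hA hB hP
    have key : ∀ n : Fin 15, n < 8 → n ≠ 4 → tableEntry n .RR = true := by decide
    exact key n k3 k4
  | HR =>
    refine (kH n (hlt ?_)).1
    rcases ht with ⟨k1, -⟩ | ⟨-, k2⟩
    · rcases h1 with h1 | h1
      · exact (not_isAbelianThree_of_isHeisenbergThree k1 h1.1).elim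
      · exact Or.inl h1.2
    · rcases h2 with h2 | h2
      · exact (not_isAbelianThree_of_isHeisenbergThree k2 h2.1).elim
      · exact Or.inr h2.2
  | HH =>
    refine (kH n (hlt ?_)).2
    rcases h1 with h1 | h1
    · exact (not_isAbelianThree_of_isHeisenbergThree ht.1 h1.1).elim
    · exact Or.inl h1.2

end ListedAlgebra

/-! ### Assembly. -/

theorem mainTheorem2 :
    -- the list: fifteen pairwise non-isomorphic 6-dimensional nilpotent Lie algebras
    (∀ i : Fin 15, Module.finrank ℝ (ListedAlgebra i) = 6 ∧
      LieRing.IsNilpotent (ListedAlgebra i)) ∧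
    (∀ i j : Fin 15, Nonempty (ListedAlgebra i ≃ₗ⁅ℝ⁆ ListedAlgebra j) → i = j) ∧
    -- the classification
    (∀ (g : Type*) [LieRing g] [LieAlgebra ℝ g] [LieRing.IsNilpotent g],
      Module.finrank ℝ g = 6 →
        (AdmitsCPS g ↔ ∃ i : Fin 15, Nonempty (g ≃ₗ⁅ℝ⁆ ListedAlgebra i)) ∧
        -- every complex product structure is of one of the three types
        (∀ (J E : g →ₗ[ℝ] g) (h : IsComplexProductStructure J E),
          ∃ t : DoubleType, h.product.HasType t)) ∧
    -- the entries of the table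
    (∀ (i : Fin 15) (t : DoubleType),
      AdmitsCPSOfType (ListedAlgebra i) t ↔ tableEntry i t = true) := by
  refine ⟨fun i => ⟨ListedAlgebra.finrank_eq i, ListedAlgebra.isNilpotent i⟩,
    fun i j h => ListedAlgebra.eq_of_nonempty_lieEquiv h, fun g _ _ _ hg => ⟨⟨?_, ?_⟩, ?_⟩,
    fun i t => ⟨?_, ListedAlgebra.admitsCPSOfType_of_tableEntry⟩⟩
  · rintro ⟨J, E, h⟩
    exact h.isPencil.classify hg (h.finrank_plus hg)
  · rintro ⟨n, ⟨f⟩⟩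
    -- Every row has a positive entry in one of the first two columns, so each listed algebra has a
    -- structure; its pencil is then transported along the isomorphism.
    have key : ∀ n : Fin 15, tableEntry n .RR = true ∨ tableEntry n .HR = true := by decide
    have hn : AdmitsCPS (ListedAlgebra n) := by
      rcases key n with h | h <;>
      · obtain ⟨J, E, hJE, -⟩ := ListedAlgebra.admitsCPSOfType_of_tableEntry h
        exact ⟨J, E, hJE⟩
    obtain ⟨J, E, h⟩ := hn
    have : Nontrivial h.product.plus := Module.nontrivial_of_finrank_pos (R := ℝ)
      (by rw [h.finrank_plus (ListedAlgebra.finrank_eq n)]; norm_num)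
    exact ⟨_, _, (h.isPencil.map f.symm).isComplexProductStructure⟩
  · exact fun J E h => h.exists_hasType hg
  · rintro ⟨J, E, h, ht⟩
    exact ListedAlgebra.tableEntry_of_hasType h ht
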